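/- Setting. Let $\mathcal H$ be a complex Hilbert space, $d\ge 1$, and $\Gamma$ the symmetric Fock space over $L^2(\mathbb R;\mathbb C^d)$ with coherent vectors $e(f)$, annihilation/creation processes $B_k,B_k^\dagger$ and operators $c_1(g)=\int\overline{g(t)}\,dB_1(t)$. Let $H_0=H_0^\dagger$ and $R_1,\dots,R_d$ be bounded operators on $\mathcal H$, and let $(U_t)_{t\ge0}$ be a strongly continuous adapted family of unitaries on $\mathcal H\otimes\Gamma$ solving the Hudson–Parthasarathy equation $dU_t=\{\sum_k R_k\,dB_k^\dagger(t)-\sum_kR_k^\dagger\,dB_k(t)+K\,dt\}U_t$, $U_0=1$, $K=-iH_0-\tfrac12\sum_kR_k^\dagger R_k$. For a statistical operator $\rho$ on $\mathcal H$ and $f\in L^2(\mathbb R;\mathbb C^d)$ let $\Pi_f(T)=\mathrm{Tr}_{\mathcal H}\{U_T(\rho\otimes|e(f)\rangle\langle e(f)|)U_T^\dagger\}$ be the reduced field state at time $T>0$. Let $h$ be measurable with $|h(t)|=1$ on $[0,T]$, and $Q(t;\vartheta,h)=e^{-i\vartheta}\int_0^th\,dB_1^\dagger+\text{h.c.}$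 Let $E_\vartheta$ be the joint projection valued measure of the commuting operators $Q(t;\vartheta,h)$, $0\le t\le T$, represented by a continuous process $W(t)$: there is a unitary from $\Gamma$ onto an $L^2$ space over a probability space which turns each $Q(t;\vartheta,h)$ into multiplication by $W(t)$, and $E_\vartheta(G)$ into multiplication by $1_G$. The law of the output is $\mathbb P_\vartheta(G)=\mathrm{Tr}\{E_\vartheta(G)\Pi_f(T)\}$. For $\mu\in\mathbb R$ put $$S_T^{\rm el}(\mu;\vartheta)=\frac1T\Bigl|\mathbb E_\vartheta\Bigl[\int_0^Te^{i\mu t}dW(t)\Bigr]\Bigr|^2,\qquad S_T^{\rm inel}(\mu;\vartheta)=\frac1T\mathrm{Var}_\vartheta\Bigl[\int_0^T\cos\mu t\,dW(t)\Bigr]+\frac1T\mathrm{Var}_\vartheta\Bigl[\int_0^T\sin\mu t\,dW(t)\Bigr],$$ $$a_T(\mu)=\frac1{\sqrt T}\int_0^Te^{i\mu t}\,\overline{h(t)}\,dB_1(t),\qquad \tilde a_T(\mu)=a_T(\mu)-\mathrm{Tr}_\Gamma\{\Pi_f(T)a_T(\mu)\}.$$ Theorem. For all $\vartheta,\mu\in\mathbb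 R$, all $T>0$ and all data as above, all second moments below (of $a_T(\pm\mu)$ in the state $\Pi_f(T)$, and of the stochastic integrals under the two output laws) are finite, and $$\tfrac12\bigl(S_T^{\rm el}(\mu;\vartheta)+S_T^{\rm el}(\mu;\vartheta\pm\tfrac\pi2)\bigr)=\bigl|\mathrm{Tr}_\Gamma\{\Pi_f(T)a_T(\mu)\}\bigr|^2+\bigl|\mathrm{Tr}_\Gamma\{\Pi_f(T)a_T(-\mu)\}\bigr|^2,$$ $$\tfrac12\bigl(S_T^{\rm inel}(\mu;\vartheta)+S_T^{\rm inel}(\mu;\vartheta\pm\tfrac\pi2)\bigr)=1+\mathrm{Tr}_\Gamma\bigl\{\Pi_f(T)\bigl(\tilde a_T^\dagger(\mu)\tilde a_T(\mu)+\tilde a_T^\dagger(-\mu)\tilde a_T(-\mu)\bigr)\bigr\},$$ $$\sqrt{S_T^{\rm inel}(\mu;\vartheta)\,S_T^{\rm inel}(\mu;\vartheta\pm\tfrac\pi2)}\ \ge\ 1+\bigl|\mathrm{Tr}_\Gamma\bigl\{\Pi_f(T)\bigl(\tilde a_T^\dagger(\mu)\tilde a_T(\mu)-\tilde a_T^\dagger(-\mu)\tilde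 a_T(-\mu)\bigr)\bigr\}\bigr| .$$ Consequently, for every $\rho$, $f$, $h$ and every Hudson–Parthasarathy evolution $U$, $$S_T^{\rm inel}(\mu;\vartheta)\,S_T^{\rm inel}(\mu;\vartheta\pm\tfrac\pi2)\ge1,\qquad \tfrac12\bigl(S_T^{\rm inel}(\mu;\vartheta)+S_T^{\rm inel}(\mu;\vartheta\pm\tfrac\pi2)\bigr)\ge1 .$$ Moreover, if (with $h=h_T$ and $f=f_T$ possibly depending on $T$) the spectra $S_T^{\rm inel}(\mu;\vartheta)$ and $S_T^{\rm inel}(\mu;\vartheta\pm\frac\pi2)$ converge for $T\to+\infty$ to the same limit $S$, as happens for heterodyne detection, then $S\ge1$. -/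

import Mathlib

open MeasureTheory ProbabilityTheory Filter Topology
open scoped TensorProduct InnerProductSpace ComplexConjugate

noncomputable section

namespace QuantumOutput

/-! ### The symmetric Fock space over `L²(ℝ; ℂ^d)` -/

/-- Labels of a single boson: the time variable and the channel index. -/
abbrev Label (d : ℕ) : Type := ℝ × Fin d

/-- Lebesgue measure in time, counting measure in the channel index. -/
def labelMeasure (d : ℕ) : Measure (Label d) := (volume : Measure ℝ).prod Measure.count

instance (d : ℕ) : SigmaFinite (labelMeasure d) := by
  unfold labelMeasure; infer_instance

/-- The one-particle space `L²(ℝ; ℂ^d) = L²(ℝ) ⊗ ℂ^d`; the component `f_k(t)` is `f (t, k)`. -/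
abbrev OneParticle (d : ℕ) : Type := Lp ℂ 2 (labelMeasure d)

/-- The Hilbert tensor power `L²(ℝ; ℂ^d)^{⊗ n}`, realised as the square integrable functions of `n`
labels. -/
abbrev TensorPower (d n : ℕ) : Type :=
  Lp ℂ 2 (Measure.pi fun _ : Fin n => labelMeasure d)

lemma measurePreserving_permute (d n : ℕ) (σ : Equiv.Perm (Fin n)) :
    MeasurePreserving (fun x : Fin n → Label d => x ∘ σ)
      (Measure.pi fun _ : Fin n => labelMeasure d)
      (Measure.pi fun _ : Fin n => labelMeasure d) := by
  have h := measurePreserving_arrowCongr' (fun _ : Fin n => labelMeasure d)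
    (fun _ : Fin n => labelMeasure d) σ.symm (MeasurableEquiv.refl (Label d))
    (fun _ => MeasurePreserving.id _)
  have h2 : (fun x : Fin n → Label d => x ∘ σ)
      = MeasurableEquiv.arrowCongr' σ.symm (MeasurableEquiv.refl (Label d)) := by
    funext x i
    rfl
  rw [h2]
  exact h

/-- The action of permutations, `(σ ψ)(x₁, …, xₙ) = ψ(x_{σ 1}, …, x_{σ n})`. -/
def permute (d n : ℕ) (σ : Equiv.Perm (Fin n)) : TensorPower d n →L[ℂ] TensorPower d n :=
  (Lp.compMeasurePreservingₗᵢ ℂ (fun x : Fin n → Label d => x ∘ σ)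
    (measurePreserving_permute d n σ)).toContinuousLinearMap

/-- The `n`-boson space: the permutation invariant part of the tensor power. -/
def bosonSpace (d n : ℕ) : Submodule ℂ (TensorPower d n) :=
  ⨅ σ : Equiv.Perm (Fin n), ((permute d n σ - ContinuousLinearMap.id ℂ _).ker)

lemma mem_bosonSpace {d n : ℕ} {ψ : TensorPower d n} :
    ψ ∈ bosonSpace d n ↔ ∀ σ : Equiv.Perm (Fin n), permute d n σ ψ = ψ := by
  simp [bosonSpace, Submodule.mem_iInf, sub_eq_zero]

instance (d n : ℕ) : CompleteSpace (bosonSpace d n) := by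
  have h : IsClosed (bosonSpace d n : Set (TensorPower d n)) := by
    rw [bosonSpace, Submodule.coe_iInf]
    exact isClosed_iInter fun σ => ContinuousLinearMap.isClosed_ker _
  exact h.completeSpace_coe

/-- The symmetric Fock space `Γ = ⊕ₙ L²(ℝ; ℂ^d)^{⊗ₛ n}` (Hilbert direct sum). -/
def Fock (d : ℕ) : Type := lp (fun n : ℕ => bosonSpace d n) 2

instance (d : ℕ) : NormedAddCommGroup (Fock d) :=
  inferInstanceAs (NormedAddCommGroup (lp (fun n : ℕ => bosonSpace d n) 2))

instance (d : ℕ) : InnerProductSpace ℂ (Fock d) :=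
  inferInstanceAs (InnerProductSpace ℂ (lp (fun n : ℕ => bosonSpace d n) 2))

instance (d : ℕ) : CompleteSpace (Fock d) :=
  inferInstanceAs (CompleteSpace (lp (fun n : ℕ => bosonSpace d n) 2))

/-- The `n`-boson component `e^{-‖f‖²/2} f^{⊗ n} / √(n!)` of a coherent vector, as a function. -/
def coherentFun {d : ℕ} (f : OneParticle d) (n : ℕ) (x : Fin n → Label d) : ℂ :=
  ((Real.exp (-‖f‖ ^ 2 / 2) / √(n.factorial : ℝ) : ℝ) : ℂ) * ∏ i, f (x i)

lemma integrable_norm_sq {d : ℕ} (f : OneParticle d) :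
    Integrable (fun y => ‖f y‖ ^ 2) (labelMeasure d) :=
  (memLp_two_iff_integrable_sq_norm (Lp.memLp f).1).1 (Lp.memLp f)

lemma integral_norm_sq {d : ℕ} (f : OneParticle d) :
    ∫ y, ‖f y‖ ^ 2 ∂(labelMeasure d) = ‖f‖ ^ 2 := by
  have h := L2.inner_def (𝕜 := ℂ) f f
  rw [inner_self_eq_norm_sq_to_K] at h
  have h2 : ∀ y, ⟪f y, f y⟫_ℂ = ((‖f y‖ ^ 2 : ℝ) : ℂ) := fun y => by
    rw [inner_self_eq_norm_sq_to_K]; norm_cast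
  simp_rw [h2] at h
  rw [integral_complex_ofReal] at h
  apply Complex.ofReal_injective
  rw [← h]
  push_cast
  rfl

lemma coherentFun_norm_sq {d : ℕ} (f : OneParticle d) (n : ℕ) (x : Fin n → Label d) :
    ‖coherentFun f n x‖ ^ 2
      = (Real.exp (-‖f‖ ^ 2 / 2) / √(n.factorial : ℝ)) ^ 2 * ∏ i, ‖f (x i)‖ ^ 2 := by
  rw [coherentFun, norm_mul, mul_pow, norm_prod, Finset.prod_pow, Complex.norm_real,
    Real.norm_eq_abs, sq_abs]

lemma memLp_coherentFun {d : ℕ} (f : OneParticle d) (n : ℕ) :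
    MemLp (coherentFun f n) 2 (Measure.pi fun _ : Fin n => labelMeasure d) := by
  have hm : StronglyMeasurable (coherentFun f n) := by
    unfold coherentFun
    refine stronglyMeasurable_const.mul ?_
    exact Finset.stronglyMeasurable_fun_prod _ fun i _ =>
      (Lp.stronglyMeasurable f).comp_measurable (measurable_pi_apply i)
  rw [memLp_two_iff_integrable_sq_norm hm.aestronglyMeasurable]
  simp_rw [coherentFun_norm_sq]
  exact (Integrable.fintype_prod (fun _ => integrable_norm_sq f)).const_mul _

lemma norm_toLp_coherentFun_sq {d : ℕ} (f : OneParticle d) (n : ℕ) :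
    ‖(memLp_coherentFun f n).toLp (coherentFun f n)‖ ^ 2
      = Real.exp (-‖f‖ ^ 2) * ((‖f‖ ^ 2) ^ n / n.factorial) := by
  have h := L2.inner_def (𝕜 := ℂ) ((memLp_coherentFun f n).toLp (coherentFun f n))
    ((memLp_coherentFun f n).toLp (coherentFun f n))
  rw [inner_self_eq_norm_sq_to_K] at h
  have h2 : (fun x => ⟪((memLp_coherentFun f n).toLp (coherentFun f n)) x,
      ((memLp_coherentFun f n).toLp (coherentFun f n)) x⟫_ℂ)
      =ᵐ[Measure.pi fun _ : Fin n => labelMeasure d]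
      fun x => ((‖coherentFun f n x‖ ^ 2 : ℝ) : ℂ) := by
    filter_upwards [(memLp_coherentFun f n).coeFn_toLp] with x hx
    rw [hx, inner_self_eq_norm_sq_to_K]; norm_cast
  rw [integral_congr_ae h2, integral_complex_ofReal] at h
  have h3 : ‖(memLp_coherentFun f n).toLp (coherentFun f n)‖ ^ 2
      = ∫ x, ‖coherentFun f n x‖ ^ 2 ∂(Measure.pi fun _ : Fin n => labelMeasure d) := by
    apply Complex.ofReal_injective
    rw [← h]
    push_cast
    rfl
  rw [h3]
  simp_rw [coherentFun_norm_sq]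
  rw [integral_const_mul, integral_fintype_prod_eq_pow (fun y => ‖f y‖ ^ 2), integral_norm_sq,
    Fintype.card_fin, div_pow, Real.sq_sqrt (by positivity), ← Real.exp_nat_mul]
  have : ((2 : ℕ) : ℝ) * (-‖f‖ ^ 2 / 2) = -‖f‖ ^ 2 := by push_cast; ring
  rw [this]; ring

/-- The `n`-boson component of the coherent vector `e(f)`. -/
def coherentComponent {d : ℕ} (f : OneParticle d) (n : ℕ) : bosonSpace d n :=
  ⟨(memLp_coherentFun f n).toLp (coherentFun f n), by
    rw [mem_bosonSpace]
    intro σ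
    change Lp.compMeasurePreserving _ (measurePreserving_permute d n σ)
      ((memLp_coherentFun f n).toLp (coherentFun f n)) = _
    rw [Lp.toLp_compMeasurePreserving]
    congr 1
    funext x
    simp only [coherentFun, Function.comp]
    rw [Equiv.prod_comp σ (fun i => f (x i))]⟩

/-- The coherent vector `e(f) = e^{-‖f‖²/2} (1, f, f ⊗ f / √2!, …, f^{⊗ n} / √n!, …)`. -/
def coherent {d : ℕ} (f : OneParticle d) : Fock d :=
  ⟨fun n => coherentComponent f n, by
    refine memℓp_gen ?_
    have h : ∀ n : ℕ, ‖coherentComponent f n‖ ^ ((2 : ENNReal).toReal)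
        = Real.exp (-‖f‖ ^ 2) * ((‖f‖ ^ 2) ^ n / n.factorial) := by
      intro n
      rw [← norm_toLp_coherentFun_sq]
      norm_num [coherentComponent]
    simp_rw [h]
    exact (Real.summable_pow_div_factorial (‖f‖ ^ 2)).mul_left _⟩

/-- The product `1_A f` of a one-particle vector with the indicator of a time set `A`. -/
def restrict {d : ℕ} (A : Set ℝ) (hA : MeasurableSet A) (f : OneParticle d) : OneParticle d :=
  ((Lp.memLp f).indicator (measurable_fst hA)).toLp
    (Set.indicator (Prod.fst ⁻¹' A : Set (Label d)) f)

/-! ### Creation and annihilation operators, quadratures -/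

/-- The graph of the creation operator: `χ = c†(q) ψ` iff
`⟨e(g)| χ⟩ = ⟨g|q⟩ ⟨e(g)|ψ⟩` for all coherent vectors `e(g)`. -/
def creationGraph {d : ℕ} (q : OneParticle d) : Submodule ℂ (Fock d × Fock d) where
  carrier := {p | ∀ g : OneParticle d, ⟪coherent g, p.2⟫_ℂ = ⟪g, q⟫_ℂ * ⟪coherent g, p.1⟫_ℂ}
  add_mem' := by
    intro a b ha hb g
    simp only [Prod.snd_add, Prod.fst_add, inner_add_right, ha g, hb g, mul_add]
  zero_mem' := by intro g; simp
  smul_mem' := by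
    intro c a ha g
    simp only [Prod.smul_snd, Prod.smul_fst, inner_smul_right, ha g]
    ring

/-- The (closed, unbounded) creation operator `c†(q) = ∑ₖ ∫ qₖ(s) dBₖ†(s)`. It is the adjoint of
the operator `e(g) ↦ ⟨q|g⟩ e(g)` on the span of the coherent vectors. -/
def creation {d : ℕ} (q : OneParticle d) : Fock d →ₗ.[ℂ] Fock d := (creationGraph q).toLinearPMap

/-- The (closed, unbounded) annihilation operator `c(q) = ∑ₖ ∫ conj (qₖ(s)) dBₖ(s)`, the adjoint of
the creation operator; it satisfies `c(q) e(f) = ⟨q|f⟩ e(f)`. -/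
def annihilation {d : ℕ} (q : OneParticle d) : Fock d →ₗ.[ℂ] Fock d := (creation q).adjoint

open Classical in
/-- The one-particle vector `(c 1_{[0,t]}, 0, …, 0)`, supported in the first channel. The value `0`
is used when this function is not square integrable. -/
def firstChannel (d : ℕ) [NeZero d] (c : ℝ → ℂ) (t : ℝ) : OneParticle d :=
  if hc : MemLp (fun x : Label d => if x.2 = 0 ∧ x.1 ∈ Set.Icc 0 t then c x.1 else 0) 2
      (labelMeasure d)
  then hc.toLp _ else 0

/-- The quadrature `Q(t; ϑ, h) = e^{-iϑ} ∫₀ᵗ h(s) dB₁†(s) + h.c.` -/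
def quadrature (d : ℕ) [NeZero d] (ϑ : ℝ) (h : ℝ → ℂ) (t : ℝ) : Fock d →ₗ.[ℂ] Fock d :=
  creation (firstChannel d (fun s => Complex.exp (-(Complex.I * ϑ)) * h s) t)
    + annihilation (firstChannel d (fun s => Complex.exp (-(Complex.I * ϑ)) * h s) t)

/-- The temporal mode `a_T(μ) = T^{-1/2} ∫₀ᵀ e^{iμt} conj (h(t)) dB₁(t) = c₁(g)` with
`g(t) = T^{-1/2} e^{-iμt} h(t) 1_{[0,T]}(t)`. -/
def mode (d : ℕ) [NeZero d] (h : ℝ → ℂ) (T μ : ℝ) : Fock d →ₗ.[ℂ] Fock d :=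
  annihilation (firstChannel d
    (fun t => ((1 / √T : ℝ) : ℂ) * Complex.exp (-(Complex.I * μ * t)) * h t) T)

/-! ### Traces and states -/

section Trace

variable {E : Type*} [NormedAddCommGroup E] [InnerProductSpace ℂ E] [CompleteSpace E]

/-- The index set of a fixed orthonormal basis of `E`. -/
def basisIndex (E : Type*) [NormedAddCommGroup E] [InnerProductSpace ℂ E] [CompleteSpace E] :
    Set E :=
  (exists_hilbertBasis ℂ E).choose

/-- A fixed orthonormal basis of `E`; the traces below do not depend on it. -/
def basis (E : Type*) [NormedAddCommGroup E] [InnerProductSpace ℂ E] [CompleteSpace E] :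
    HilbertBasis (basisIndex E) ℂ E :=
  (exists_hilbertBasis ℂ E).choose_spec.choose

/-- The trace of a (trace-class) operator. -/
def trace (A : E →L[ℂ] E) : ℂ := ∑' i, ⟪basis E i, A (basis E i)⟫_ℂ

/-- Statistical operators: positive operators of trace one. -/
structure IsState (ρ : E →L[ℂ] E) : Prop where
  isPositive : ρ.IsPositive
  hasSum_trace : HasSum (fun i => ⟪basis E i, ρ (basis E i)⟫_ℂ) 1

open Classical in
/-- Evaluation of an unbounded operator (zero outside its domain). -/
def opApply (X : E →ₗ.[ℂ] E) (ψ : E) : E := if hψ : ψ ∈ X.domain then X ⟨ψ, hψ⟩ else 0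

/-- `X` has finite second moment in the state `ϱ`: `X √ϱ` is a Hilbert–Schmidt operator, that is
`Tr {X ϱ X†} < ∞`. -/
def FiniteSecondMoment (ϱ : E →L[ℂ] E) (X : E →ₗ.[ℂ] E) : Prop :=
  (∀ ψ, CFC.sqrt ϱ ψ ∈ X.domain) ∧
    Summable fun i => ‖opApply X (CFC.sqrt ϱ (basis E i))‖ ^ 2

/-- The mean `Tr {ϱ X} = ∑ᵢ ⟨√ϱ bᵢ | X √ϱ bᵢ⟩` of an unbounded operator. -/
def mean (ϱ : E →L[ℂ] E) (X : E →ₗ.[ℂ] E) : ℂ :=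
  ∑' i, ⟪CFC.sqrt ϱ (basis E i), opApply X (CFC.sqrt ϱ (basis E i))⟫_ℂ

/-- `Tr {ϱ X† X} = ∑ᵢ ‖X √ϱ bᵢ‖²`. -/
def meanAbsSq (ϱ : E →L[ℂ] E) (X : E →ₗ.[ℂ] E) : ℝ :=
  ∑' i, ‖opApply X (CFC.sqrt ϱ (basis E i))‖ ^ 2

/-- The centred operator `X - Tr {ϱ X}`. -/
def centred (ϱ : E →L[ℂ] E) (X : E →ₗ.[ℂ] E) : E →ₗ.[ℂ] E :=
  ⟨X.domain, X.toFun - mean ϱ X • X.domain.subtype⟩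

end Trace

/-! ### The Hudson–Parthasarathy evolution and the reduced field state -/

section Dynamics

variable {H : Type*} [NormedAddCommGroup H] [InnerProductSpace ℂ H] [CompleteSpace H] {d : ℕ}

/-- The Hilbert space `ℋ ⊗ Γ` of the system and the fields (completed tensor product). -/
def SysFock (H : Type*) [NormedAddCommGroup H] [InnerProductSpace ℂ H] (d : ℕ) : Type _ :=
  UniformSpace.Completion (H ⊗[ℂ] Fock d)

instance : NormedAddCommGroup (SysFock H d) :=
  inferInstanceAs (NormedAddCommGroup (UniformSpace.Completion (H ⊗[ℂ] Fock d)))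

instance : InnerProductSpace ℂ (SysFock H d) :=
  inferInstanceAs (InnerProductSpace ℂ (UniformSpace.Completion (H ⊗[ℂ] Fock d)))

instance : CompleteSpace (SysFock H d) :=
  inferInstanceAs (CompleteSpace (UniformSpace.Completion (H ⊗[ℂ] Fock d)))

/-- The canonical isometry of the algebraic tensor product into `ℋ ⊗ Γ`. -/
def toSysFock (H : Type*) [NormedAddCommGroup H] [InnerProductSpace ℂ H] (d : ℕ) :
    (H ⊗[ℂ] Fock d) →ₗᵢ[ℂ] SysFock H d :=
  UniformSpace.Completion.toComplₗᵢ (𝕜 := ℂ) (E := H ⊗[ℂ] Fock d)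

/-- The map `φ ↦ v ⊗ φ` from `Γ` to `ℋ ⊗ Γ`. -/
def tensorLeft (v : H) : Fock d →L[ℂ] SysFock H d :=
  (toSysFock H d).toContinuousLinearMap ∘L TensorProduct.mkL ℂ H (Fock d) v

/-- The map `v ↦ v ⊗ φ` from `ℋ` to `ℋ ⊗ Γ`. -/
def tensorRight (φ : Fock d) : H →L[ℂ] SysFock H d :=
  (toSysFock H d).toContinuousLinearMap ∘L (TensorProduct.mkL ℂ H (Fock d)).flip φ

/-- The vector `v ⊗ e(f)`. -/
def tensorCoherent (v : H) (f : OneParticle d) : SysFock H d := tensorLeft v (coherent f)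

/-- `K = -i H₀ - ½ ∑ₖ Rₖ† Rₖ`. -/
def driftOp (H₀ : H →L[ℂ] H) (R : Fin d → H →L[ℂ] H) : H →L[ℂ] H :=
  -(Complex.I • H₀) - (1 / 2 : ℂ) • ∑ k, (R k).adjoint ∘L R k

/-- `U` is a strongly continuous adapted family of unitary operators on `ℋ ⊗ Γ` solving the
Hudson–Parthasarathy equation
`dU_t = {∑ₖ Rₖ dBₖ†(t) - ∑ₖ Rₖ† dBₖ(t) + K dt} U_t`, `U_0 = 1`.
As usual in quantum stochastic calculus, the stochastic integrals are given by their matrix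
elements between vectors `u ⊗ e(g)` and `v ⊗ e(f)`: `dBₖ†(s)` contributes `conj (gₖ(s)) ds` and
`dBₖ(s)` contributes `fₖ(s) ds`. System operators are moved to the left-hand vector `u`. -/
structure IsHPEvolution (H₀ : H →L[ℂ] H) (R : Fin d → H →L[ℂ] H)
    (U : ℝ → SysFock H d →L[ℂ] SysFock H d) : Prop where
  mem_unitary : ∀ t, 0 ≤ t → U t ∈ unitary (SysFock H d →L[ℂ] SysFock H d)
  continuousOn : ∀ Ψ : SysFock H d, ContinuousOn (fun t => U t Ψ) (Set.Ici 0)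
  adapted : ∀ t, 0 ≤ t → ∀ (u v : H) (g f : OneParticle d),
    ⟪tensorCoherent u g, U t (tensorCoherent v f)⟫_ℂ =
      ⟪tensorCoherent u (restrict (Set.Ioo 0 t) measurableSet_Ioo g),
        U t (tensorCoherent v (restrict (Set.Ioo 0 t) measurableSet_Ioo f))⟫_ℂ *
      ⟪coherent (restrict (Set.Ioo 0 t)ᶜ measurableSet_Ioo.compl g),
        coherent (restrict (Set.Ioo 0 t)ᶜ measurableSet_Ioo.compl f)⟫_ℂ
  equation : ∀ t, 0 ≤ t → ∀ (u v : H) (g f : OneParticle d),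
    ⟪tensorCoherent u g, U t (tensorCoherent v f)⟫_ℂ =
      ⟪tensorCoherent u g, tensorCoherent v f⟫_ℂ +
      ∫ s in (0 : ℝ)..t,
        (∑ k, conj (g (s, k)) *
            ⟪tensorCoherent ((R k).adjoint u) g, U s (tensorCoherent v f)⟫_ℂ
          - ∑ k, f (s, k) * ⟪tensorCoherent (R k u) g, U s (tensorCoherent v f)⟫_ℂ
          + ⟪tensorCoherent ((driftOp H₀ R).adjoint u) g, U s (tensorCoherent v f)⟫_ℂ)

/-- The state `Σ_f = V (ρ ⊗ |e(f)⟩⟨e(f)|) V†` of system and fields; with `j v = v ⊗ e(f)` one has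
`ρ ⊗ |e(f)⟩⟨e(f)| = j ρ j†`. -/
def totalState (ρ : H →L[ℂ] H) (f : OneParticle d) (V : SysFock H d →L[ℂ] SysFock H d) :
    SysFock H d →L[ℂ] SysFock H d :=
  V ∘L (tensorRight (coherent f) ∘L ρ ∘L (tensorRight (H := H) (coherent f)).adjoint) ∘L V.adjoint

/-- The partial trace over the system space `ℋ`. -/
def partialTrace (S : SysFock H d →L[ℂ] SysFock H d) : Fock d →L[ℂ] Fock d :=
  ∑' i, (tensorLeft (basis H i)).adjoint ∘L S ∘L tensorLeft (basis H i)

/-- The reduced field state `Π_f = Tr_ℋ {V (ρ ⊗ |e(f)⟩⟨e(f)|) V†}`. -/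
def reducedFieldState (ρ : H →L[ℂ] H) (f : OneParticle d)
    (V : SysFock H d →L[ℂ] SysFock H d) : Fock d →L[ℂ] Fock d :=
  partialTrace (totalState ρ f V)

end Dynamics

/-! ### The output process and its spectra -/

/-- Multiplication by the indicator function of a measurable set `G` on `L²`. -/
def indicatorOp {Ω : Type*} {mΩ : MeasurableSpace Ω} (Q : Measure Ω) (G : Set Ω)
    (hG : MeasurableSet G) : Lp ℂ 2 Q →L[ℂ] Lp ℂ 2 Q :=
  LinearMap.mkContinuous
    { toFun := fun φ => ((Lp.memLp φ).indicator hG).toLp (G.indicator φ)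
      map_add' := by
        intro φ ψ
        rw [← MemLp.toLp_add]
        refine MemLp.toLp_congr _ _ ?_
        filter_upwards [Lp.coeFn_add φ ψ] with ω hω
        rw [Pi.add_apply]
        by_cases h : ω ∈ G
        · rw [Set.indicator_of_mem h, Set.indicator_of_mem h, Set.indicator_of_mem h, hω,
            Pi.add_apply]
        · rw [Set.indicator_of_notMem h, Set.indicator_of_notMem h, Set.indicator_of_notMem h,
            add_zero]
      map_smul' := by
        intro c φ
        rw [RingHom.id_apply, ← MemLp.toLp_const_smul]
        refine MemLp.toLp_congr _ _ ?_
        filter_upwards [Lp.coeFn_smul c φ] with ω hω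
        by_cases h : ω ∈ G
        · rw [Pi.smul_apply, Set.indicator_of_mem h, Set.indicator_of_mem h, hω, Pi.smul_apply]
        · rw [Pi.smul_apply, Set.indicator_of_notMem h, Set.indicator_of_notMem h, smul_zero] }
    1 (by
      intro φ
      rw [one_mul]
      refine Lp.norm_le_norm_of_ae_le ?_
      filter_upwards [((Lp.memLp φ).indicator hG).coeFn_toLp] with ω hω
      simp only [LinearMap.coe_mk, AddHom.coe_mk]
      rw [hω]
      exact norm_indicator_le_norm_self _ _)

/-- A joint diagonalisation of the commuting quadratures `Q(t; ϑ, h)`, `0 ≤ t ≤ T`: a continuous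
process `W` on a probability space `(Ω, Q)` and a unitary `J : Γ → L²(Ω, Q)` which carries
`Q(t; ϑ, h)` into the multiplication by `W(t)`. -/
structure Diagonalisation (d : ℕ) [NeZero d] (ϑ : ℝ) (h : ℝ → ℂ) (T : ℝ) where
  Ω : Type*
  mΩ : MeasurableSpace Ω
  Q : Measure Ω
  isProbabilityMeasure : IsProbabilityMeasure Q
  W : ℝ → Ω → ℝ
  measurable : ∀ t ∈ Set.Icc 0 T, Measurable (W t)
  continuousOn : ∀ ω, ContinuousOn (fun t => W t ω) (Set.Icc 0 T)
  zero : ∀ ω, W 0 ω = 0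
  J : Fock d ≃ₗᵢ[ℂ] Lp ℂ 2 Q
  diagonal : ∀ t ∈ Set.Icc 0 T, ∀ Ψ : (quadrature d ϑ h t).domain,
    (J (quadrature d ϑ h t Ψ) : Ω → ℂ) =ᵐ[Q] fun ω => (W t ω : ℂ) * J (Ψ : Fock d) ω

attribute [instance] Diagonalisation.mΩ

/-- The joint projection valued measure `E(G) = J⁻¹ 1_G J` of the quadratures. -/
def Diagonalisation.pvm {d : ℕ} [NeZero d] {ϑ : ℝ} {h : ℝ → ℂ} {T : ℝ}
    (D : Diagonalisation d ϑ h T) (G : Set D.Ω) (hG : MeasurableSet G) : Fock d →L[ℂ] Fock d :=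
  (D.J.symm.toLinearIsometry.toContinuousLinearMap) ∘L indicatorOp D.Q G hG ∘L
    (D.J.toLinearIsometry.toContinuousLinearMap)

/-- `P` is the physical probability given by the Born rule, `P(G) = Tr {E(G) ϱ}`. -/
def Diagonalisation.IsPhysicalProbability {d : ℕ} [NeZero d] {ϑ : ℝ} {h : ℝ → ℂ} {T : ℝ}
    (D : Diagonalisation d ϑ h T) (ϱ : Fock d →L[ℂ] Fock d) (P : Measure D.Ω) : Prop :=
  ∀ (G : Set D.Ω) (hG : MeasurableSet G), P G = ENNReal.ofReal (trace (D.pvm G hG ∘L ϱ)).re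

/-- The stochastic integral `∫₀ᵀ k(t) dW(t)` of a smooth deterministic function with respect to a
process with continuous paths: the pathwise Riemann–Stieltjes integral, written by parts. -/
def stochIntegral {Ω : Type*} (k : ℝ → ℝ) (W : ℝ → Ω → ℝ) (T : ℝ) (ω : Ω) : ℝ :=
  k T * W T ω - k 0 * W 0 ω - ∫ t in (0 : ℝ)..T, deriv k t * W t ω

/-- `∫₀ᵀ cos(μ t) dW(t)` -/
def cosIntegral {Ω : Type*} (W : ℝ → Ω → ℝ) (T μ : ℝ) : Ω → ℝ :=
  stochIntegral (fun t => Real.cos (μ * t)) W T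

/-- `∫₀ᵀ sin(μ t) dW(t)` -/
def sinIntegral {Ω : Type*} (W : ℝ → Ω → ℝ) (T μ : ℝ) : Ω → ℝ :=
  stochIntegral (fun t => Real.sin (μ * t)) W T

/-- The elastic spectrum `S_T^el = T⁻¹ |E[∫₀ᵀ e^{iμt} dW(t)]|²`. -/
def elasticSpectrum {Ω : Type*} {mΩ : MeasurableSpace Ω} (P : Measure Ω) (W : ℝ → Ω → ℝ)
    (T μ : ℝ) : ℝ :=
  1 / T * ‖∫ ω, ((cosIntegral W T μ ω : ℂ) + Complex.I * (sinIntegral W T μ ω : ℂ)) ∂P‖ ^ 2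

/-- The inelastic spectrum
`S_T^inel = T⁻¹ Var[∫₀ᵀ cos(μt) dW(t)] + T⁻¹ Var[∫₀ᵀ sin(μt) dW(t)]`. -/
def inelasticSpectrum {Ω : Type*} {mΩ : MeasurableSpace Ω} (P : Measure Ω) (W : ℝ → Ω → ℝ)
    (T μ : ℝ) : ℝ :=
  1 / T * variance (cosIntegral W T μ) P + 1 / T * variance (sinIntegral W T μ) P

/-- The stochastic integrals entering the spectra have finite second moments. -/
def HasSecondMoments {Ω : Type*} {mΩ : MeasurableSpace Ω} (P : Measure Ω) (W : ℝ → Ω → ℝ)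
    (T μ : ℝ) : Prop :=
  MemLp (cosIntegral W T μ) 2 P ∧ MemLp (sinIntegral W T μ) 2 P

end QuantumOutput

end

noncomputable section

namespace QuantumOutput

/-! ### Exponential vectors and their totality -/

/-! Let ϱ be the output state, ξ_i = √ϱ b_i for an orthonormal basis b_i of the Fock space, and Ξ =
(ξ_i), a unit vector of ℓ²(Γ). By the Born rule the output law is ∑ |J ξ_i|² dQ
(`Diagonalisation.IsPhysicalProbability.eq_sum`). Put X = ∫ cos μt dW and Y = ∫ sin μt dW.
Multiplication by X or Y on the vectors J ξ_i is a field operator c†(q) + c(q) acting on ξ_i, so the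
moments are inner products and norms in ℓ²(Γ): E X = ⟨Ξ, XΞ⟩ and E X² = ‖XΞ‖². Since X and Y are
real multiplication operators, ⟨XΞ, YΞ⟩ is real and ‖XΞ‖² + ‖YΞ‖² = ‖(X ± iY)Ξ‖². With e = exp(iϑ),
A± = a_T(±μ)Ξ and C± = a_T†(±μ)Ξ, Euler's formula gives (X + iY)Ξ = √T (e A₊ + ē C₋) and (X - iY)Ξ =
√T (e A₋ + ē C₊). Hence the inelastic spectrum has two expressions as the squared norm of a centred
vector (`ModeData.spectra`).

A phase shift by ±π/2 replaces e by ±ie, which up to a unimodular factor flips the relative sign of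
the two terms. The parallelogram identity then gives both arithmetic means. The canonical
commutation relation, in the form ‖C±‖² = ‖A±‖² + 1, supplies the constant 1. Cauchy–Schwarz for
Re⟨α + β, α - β⟩ = ‖α‖² - ‖β‖² gives the Robertson bound, one sign of the difference from each of
the two expressions (`complementary_relations`).

The rest is control of domains. Creation operators are defined by their maximal weak graph and
annihilation operators as adjoints of these. The bounded operators B = r^N c(q) with 0 < r < 1,
followed by r → 1, show that a weak value of c(q)ψ, tested on exponential vectors only (`IsAnn`),
already puts ψ in the domains of c(q) and c†(q), with the norms related by the commutation relation
(`IsAnn.inner_eq`, `IsAnn.exists_creation`).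

For the output, Ψ = v ⊗ E(f) satisfies c(q) U_t Ψ = ⟨q, f⟩ U_t Ψ + ∑_k U_t ∫₀ᵗ conj(q_k(s)) U_s† R_k
U_s Ψ ds (`IsHPEvolution.slice_crea_eq`). Tested on E(g), both sides solve the same linear integral
equation, so Gronwall's lemma identifies them. Adaptedness enters because U_s† R_k U_s Ψ must still
look like E(f) after time s. The resulting bound is linear in ‖q‖ and ‖v‖. It survives the partial
trace and passes from the vectors of the mixture to √ϱ (`exists_isAnn_sqrt`). It also makes q ↦
(c†(q) + c(q))ξ_i continuous, and so the diagonalisation of the quadratures extends, through Riemann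
sums, to X and Y (`Diagonalisation.actsAs_stochIntegral`). -/

lemma inner_coherentComponent {d : ℕ} (g f : OneParticle d) (n : ℕ) :
    ⟪coherentComponent g n, coherentComponent f n⟫_ℂ =
      Complex.exp (-(‖g‖ ^ 2 / 2) - ‖f‖ ^ 2 / 2) * (⟪g, f⟫_ℂ ^ n / n.factorial) := by
  have h1 : ⟪coherentComponent g n, coherentComponent f n⟫_ℂ =
      ∫ x, ⟪coherentFun g n x, coherentFun f n x⟫_ℂ
        ∂(Measure.pi fun _ : Fin n => labelMeasure d) := by
    rw [Submodule.coe_inner, L2.inner_def]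
    refine integral_congr_ae ?_
    filter_upwards [(memLp_coherentFun g n).coeFn_toLp, (memLp_coherentFun f n).coeFn_toLp]
      with x h1 h2
    simp only [coherentComponent]
    rw [h1, h2]
  rw [h1]
  have h2 : ∀ x : Fin n → Label d, ⟪coherentFun g n x, coherentFun f n x⟫_ℂ =
      (((Real.exp (-‖g‖ ^ 2 / 2) / √(n.factorial : ℝ) : ℝ) : ℂ) *
        ((Real.exp (-‖f‖ ^ 2 / 2) / √(n.factorial : ℝ) : ℝ) : ℂ)) *
        ∏ i, ⟪g (x i), f (x i)⟫_ℂ := by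
    intro x
    simp only [coherentFun, RCLike.inner_apply, map_mul, map_prod, Complex.conj_ofReal,
      Finset.prod_mul_distrib]
    ring
  simp_rw [h2]
  rw [integral_const_mul, integral_fintype_prod_eq_pow (fun y => ⟪g y, f y⟫_ℂ), Fintype.card_fin,
    ← L2.inner_def]
  have h3 : (((Real.exp (-‖g‖ ^ 2 / 2) / √(n.factorial : ℝ) : ℝ) : ℂ) *
        ((Real.exp (-‖f‖ ^ 2 / 2) / √(n.factorial : ℝ) : ℝ) : ℂ)) =
      Complex.exp (-(‖g‖ ^ 2 / 2) - ‖f‖ ^ 2 / 2) / n.factorial := by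
    rw [← Complex.ofReal_mul, div_mul_div_comm, ← Real.exp_add, Real.mul_self_sqrt (by positivity)]
    push_cast
    ring_nf
  rw [h3]
  ring

/-- The `n`-boson component of a Fock vector. -/
def component {d : ℕ} (n : ℕ) (Ψ : Fock d) : bosonSpace d n :=
  (id Ψ : lp (fun n : ℕ => bosonSpace d n) 2) n

lemma component_coherent {d : ℕ} (f : OneParticle d) (n : ℕ) :
    component n (coherent f) = coherentComponent f n := rfl

lemma hasSum_inner_component {d : ℕ} (Φ Ψ : Fock d) :
    HasSum (fun n => ⟪component n Φ, component n Ψ⟫_ℂ) ⟪Φ, Ψ⟫_ℂ :=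
  lp.hasSum_inner (𝕜 := ℂ) (G := fun n : ℕ => bosonSpace d n) Φ Ψ

lemma inner_coherent {d : ℕ} (g f : OneParticle d) :
    ⟪coherent g, coherent f⟫_ℂ =
      Complex.exp (-(‖g‖ ^ 2 / 2) - ‖f‖ ^ 2 / 2) * Complex.exp ⟪g, f⟫_ℂ := by
  have h := hasSum_inner_component (coherent g) (coherent f)
  have h2 : HasSum (fun n : ℕ => Complex.exp (-(‖g‖ ^ 2 / 2) - ‖f‖ ^ 2 / 2) *
      (⟪g, f⟫_ℂ ^ n / n.factorial))
      (Complex.exp (-(‖g‖ ^ 2 / 2) - ‖f‖ ^ 2 / 2) * Complex.exp ⟪g, f⟫_ℂ) := by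
    refine HasSum.mul_left _ ?_
    rw [Complex.exp_eq_exp_ℂ]
    exact NormedSpace.expSeries_div_hasSum_exp _
  refine h.unique ?_
  convert h2 using 2
  exact inner_coherentComponent g f _

/-- The exponential vector `E(f) = ⊕ₙ f^{⊗ n} / √n!`. -/
def expVec {d : ℕ} (f : OneParticle d) : Fock d := ((Real.exp (‖f‖ ^ 2 / 2) : ℝ) : ℂ) • coherent f

lemma coherent_eq {d : ℕ} (f : OneParticle d) :
    coherent f = ((Real.exp (-(‖f‖ ^ 2 / 2)) : ℝ) : ℂ) • expVec f := by
  rw [expVec, smul_smul, ← Complex.ofReal_mul, ← Real.exp_add]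
  simp

lemma inner_expVec {d : ℕ} (g f : OneParticle d) :
    ⟪expVec g, expVec f⟫_ℂ = Complex.exp ⟪g, f⟫_ℂ := by
  rw [expVec, expVec, inner_smul_left, inner_smul_right, inner_coherent, Complex.conj_ofReal,
    ← mul_assoc, ← mul_assoc, Complex.ofReal_exp, Complex.ofReal_exp, ← Complex.exp_add,
    ← Complex.exp_add, ← Complex.exp_add]
  congr 1
  push_cast
  ring

/-- The tensor power `f^{⊗ n}`, up to the factor in `coherentFun`. -/
lemma inner_bosonSpace_coherentComponent {d n : ℕ} (ψ : bosonSpace d n) (f : OneParticle d) :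
    ⟪ψ, coherentComponent f n⟫_ℂ =
      ((Real.exp (-‖f‖ ^ 2 / 2) / √(n.factorial : ℝ) : ℝ) : ℂ) *
        ∫ x, conj ((ψ : TensorPower d n) x) * ∏ i, f (x i)
          ∂(Measure.pi fun _ : Fin n => labelMeasure d) := by
  rw [Submodule.coe_inner, L2.inner_def, ← integral_const_mul]
  refine integral_congr_ae ?_
  filter_upwards [(memLp_coherentFun f n).coeFn_toLp] with x h1
  simp only [coherentComponent]
  rw [h1, RCLike.inner_apply, coherentFun]
  ring

lemma smul_coeFn_pi {d n : ℕ} (c : ℂ) (f : OneParticle d) :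
    (fun x : Fin n → Label d => ∏ i, (c • f) (x i))
      =ᵐ[Measure.pi fun _ : Fin n => labelMeasure d] fun x => c ^ n * ∏ i, f (x i) := by
  have h : ∀ i : Fin n, ∀ᵐ x ∂(Measure.pi fun _ : Fin n => labelMeasure d),
      (c • f) (x i) = c * f (x i) := fun i =>
    (Measure.quasiMeasurePreserving_eval (fun _ : Fin n => labelMeasure d) i).ae
      (Lp.coeFn_smul c f)
  filter_upwards [ae_all_iff.2 h] with x hx
  rw [Finset.prod_congr rfl fun i _ => hx i, Finset.prod_mul_distrib]
  simp

/-- A vector orthogonal to all coherent vectors has all its components orthogonal to the tensor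
powers. -/
lemma integral_prod_eq_zero_of_orthogonal {d : ℕ} {Ψ : Fock d}
    (hΨ : ∀ f : OneParticle d, ⟪Ψ, coherent f⟫_ℂ = 0) (n : ℕ) (f : OneParticle d) :
    ∫ x, conj ((component n Ψ : TensorPower d n) x) * ∏ i, f (x i)
      ∂(Measure.pi fun _ : Fin n => labelMeasure d) = 0 := by
  set a : ℕ → ℂ := fun n => ((1 / √(n.factorial : ℝ) : ℝ) : ℂ) *
    ∫ x, conj ((component n Ψ : TensorPower d n) x) * ∏ i, f (x i)
      ∂(Measure.pi fun _ : Fin n => labelMeasure d) with ha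
  -- Replacing f by z f turns orthogonality into an everywhere vanishing power series in z whose
  -- coefficients are the wanted integrals, up to nonzero factors.
  have key : ∀ z : ℂ, HasSum (fun n => z ^ n * a n) 0 := by
    intro z
    have h := hasSum_inner_component Ψ (coherent (z • f))
    rw [hΨ] at h
    have h3 := h.mul_left ((Real.exp (‖z • f‖ ^ 2 / 2) : ℝ) : ℂ)
    rw [mul_zero] at h3
    suffices hs : (fun n => z ^ n * a n) = fun n => ((Real.exp (‖z • f‖ ^ 2 / 2) : ℝ) : ℂ) *
        ⟪component n Ψ, component n (coherent (z • f))⟫_ℂ by rw [hs]; exact h3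
    funext n
    have h4 := inner_bosonSpace_coherentComponent (component n Ψ) (z • f)
    rw [component_coherent, h4]
    have h5 : ∫ x, conj ((component n Ψ : TensorPower d n) x) * ∏ i, (z • f) (x i)
        ∂(Measure.pi fun _ : Fin n => labelMeasure d) = z ^ n *
        ∫ x, conj ((component n Ψ : TensorPower d n) x) * ∏ i, f (x i)
        ∂(Measure.pi fun _ : Fin n => labelMeasure d) := by
      rw [← integral_const_mul]
      refine integral_congr_ae ?_
      filter_upwards [smul_coeFn_pi z f] with x hx
      rw [hx]; ring
    rw [h5, ha, ← mul_assoc, ← mul_assoc, ← mul_assoc, ← Complex.ofReal_mul, ← mul_div_assoc,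
      ← Real.exp_add]
    have : ‖z • f‖ ^ 2 / 2 + -‖z • f‖ ^ 2 / 2 = 0 := by ring
    rw [this, Real.exp_zero]
    ring
  have hps : HasFPowerSeriesAt (fun _ : ℂ => (0 : ℂ))
      (FormalMultilinearSeries.ofScalars ℂ a) 0 := by
    rw [hasFPowerSeriesAt_iff]
    refine Eventually.of_forall fun z => ?_
    simpa using key z
  have h0 := hps.eq_zero
  have han : a n = 0 := by
    have := congrArg (fun p : FormalMultilinearSeries ℂ ℂ ℂ => p.coeff n) h0
    rw [FormalMultilinearSeries.coeff_ofScalars] at this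
    exact this
  rw [ha] at han
  have hne : ((1 / √(n.factorial : ℝ) : ℝ) : ℂ) ≠ 0 := by
    rw [Ne, Complex.ofReal_eq_zero]; positivity
  exact (mul_eq_zero.1 han).resolve_left hne

/-- The integrals of a symmetric function against products of indicator functions, as a multilinear
form of the coefficients. -/
lemma sum_perm_eq_zero_of_diagonal {n : ℕ} (I : (Fin n → Fin n) → ℂ)
    (hI : ∀ s : Fin n → ℂ, ∑ τ : Fin n → Fin n, (∏ i, s (τ i)) * I τ = 0) :
    ∑ σ : Equiv.Perm (Fin n), I σ = 0 := by
  set F : ContinuousMultilinearMap ℂ (fun _ : Fin n => (Fin n → ℂ)) ℂ :=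
    ∑ τ : Fin n → Fin n, I τ • (ContinuousMultilinearMap.mkPiAlgebra ℂ (Fin n) ℂ
      ).compContinuousLinearMap (fun i => ContinuousLinearMap.proj (τ i)) with hF
  have hFa : ∀ w : Fin n → Fin n → ℂ, F w = ∑ τ : Fin n → Fin n, (∏ i, w i (τ i)) * I τ := by
    intro w
    simp [hF, mul_comm]
  have h0 : (fun x : Fin n → ℂ => F fun _ => x) = fun _ => 0 := by
    funext x
    rw [hFa]
    exact hI x
  -- Polarisation: the n-th derivative of the diagonal restriction of F, in the n coordinate
  -- directions, is the sum of F over all orderings of the coordinate vectors. The restriction is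
  -- zero, so this sum is zero.
  have h1 := F.iteratedFDeriv_comp_diagonal (0 : Fin n → ℂ) (fun i => Pi.single i 1)
  rw [h0] at h1
  have h2 : ∀ σ : Equiv.Perm (Fin n), F (fun i => Pi.single (σ i) 1) = I σ := by
    intro σ
    rw [hFa, Finset.sum_eq_single (σ : Fin n → Fin n)]
    · simp
    · intro τ _ hτ
      obtain ⟨i, hi⟩ := Function.ne_iff.1 hτ
      rw [Finset.prod_eq_zero (Finset.mem_univ i), zero_mul]
      exact Pi.single_eq_of_ne hi _
    · simp
  simp_rw [h2] at h1
  rw [← h1]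
  simp

/-- A symmetric function whose integrals against tensor powers vanish has vanishing integrals
over boxes. -/
lemma setIntegral_box_eq_zero {d n : ℕ} (ψ : bosonSpace d n)
    (hψ : ∀ f : OneParticle d, ∫ x, conj ((ψ : TensorPower d n) x) * ∏ i, f (x i)
      ∂(Measure.pi fun _ : Fin n => labelMeasure d) = 0)
    (A : Fin n → Set (Label d)) (hA : ∀ i, MeasurableSet (A i))
    (hA' : ∀ i, labelMeasure d (A i) ≠ ⊤) :
    ∫ x in Set.univ.pi A, conj ((ψ : TensorPower d n) x)
      ∂(Measure.pi fun _ : Fin n => labelMeasure d) = 0 := by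
  set ν := Measure.pi fun _ : Fin n => labelMeasure d with hν
  have hint : ∀ τ : Fin n → Fin n, IntegrableOn (fun x => conj ((ψ : TensorPower d n) x))
      (Set.univ.pi fun i => A (τ i)) ν := by
    intro τ
    have h1 : MemLp (fun x => conj ((ψ : TensorPower d n) x)) 2 ν :=
      (Lp.memLp (ψ : TensorPower d n)).star
    have : IsFiniteMeasure (ν.restrict (Set.univ.pi fun i => A (τ i))) := by
      refine ⟨?_⟩
      rw [Measure.restrict_apply_univ, hν, Measure.pi_pi]
      exact ENNReal.prod_lt_top fun i _ => (hA' _).lt_top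
    exact (h1.restrict _).integrable (by norm_num)
  have hmeas : ∀ τ : Fin n → Fin n, MeasurableSet (Set.univ.pi fun i => A (τ i)) := fun τ =>
    MeasurableSet.univ_pi fun i => hA _
  -- The hypothesis is applied to f = ∑ s_j 1_{A_j}. Expanding the product gives a polynomial
  -- identity in the s_j, and polarisation selects the boxes with permuted sides.
  have hsum : ∑ σ : Equiv.Perm (Fin n), (∫ x in Set.univ.pi fun i => A (σ i),
      conj ((ψ : TensorPower d n) x) ∂ν) = 0 := by
    refine sum_perm_eq_zero_of_diagonal (fun τ => ∫ x in Set.univ.pi fun i => A (τ i),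
      conj ((ψ : TensorPower d n) x) ∂ν) fun s => ?_
    rw [← hψ (∑ j, s j • indicatorConstLp 2 (hA j) (hA' j) (1 : ℂ))]
    have h1 : ∀ᵐ y ∂(labelMeasure d), (∑ j, s j • indicatorConstLp 2 (hA j) (hA' j) (1 : ℂ) :
        OneParticle d) y = ∑ j, s j * (A j).indicator (fun _ => (1 : ℂ)) y := by
      have h2 : ∀ j, ∀ᵐ y ∂(labelMeasure d), (s j • indicatorConstLp 2 (hA j) (hA' j) (1 : ℂ) :
          OneParticle d) y = s j * (A j).indicator (fun _ => (1 : ℂ)) y := by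
        intro j
        filter_upwards [Lp.coeFn_smul (s j) (indicatorConstLp 2 (hA j) (hA' j) (1 : ℂ)),
          indicatorConstLp_coeFn (p := 2) (hs := hA j) (hμs := hA' j) (c := (1 : ℂ))] with y h3 h4
        rw [h3, Pi.smul_apply, h4, smul_eq_mul]
      filter_upwards [Lp.coeFn_fun_finsetSum Finset.univ
        (fun j => (s j • indicatorConstLp 2 (hA j) (hA' j) (1 : ℂ) : OneParticle d)),
        ae_all_iff.2 h2] with y h3 h4
      rw [h3]
      exact Finset.sum_congr rfl fun j _ => h4 j
    have h2 : ∀ᵐ x ∂ν, ∀ i : Fin n, (∑ j, s j • indicatorConstLp 2 (hA j) (hA' j) (1 : ℂ) :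
        OneParticle d) (x i) = ∑ j, s j * (A j).indicator (fun _ => (1 : ℂ)) (x i) :=
      ae_all_iff.2 fun i =>
        (Measure.quasiMeasurePreserving_eval (fun _ : Fin n => labelMeasure d) i).ae h1
    have h3 : ∫ x, conj ((ψ : TensorPower d n) x) * ∏ i, (∑ j, s j •
        indicatorConstLp 2 (hA j) (hA' j) (1 : ℂ) : OneParticle d) (x i) ∂ν =
        ∫ x, ∑ τ : Fin n → Fin n, (∏ i, s (τ i)) * (Set.univ.pi fun i => A (τ i)).indicator
          (fun x => conj ((ψ : TensorPower d n) x)) x ∂ν := by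
      refine integral_congr_ae ?_
      filter_upwards [h2] with x hx
      rw [Finset.prod_congr rfl fun i _ => hx i, Finset.prod_univ_sum, Fintype.piFinset_univ,
        Finset.mul_sum]
      refine Finset.sum_congr rfl fun τ _ => ?_
      rw [Finset.prod_mul_distrib]
      by_cases hx : x ∈ Set.univ.pi fun i => A (τ i)
      · rw [Set.indicator_of_mem hx, Finset.prod_eq_one (s := Finset.univ) (f := fun i =>
          (A (τ i)).indicator (fun _ => (1 : ℂ)) (x i))]
        · ring
        · intro i _
          exact Set.indicator_of_mem (hx i (Set.mem_univ i)) _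
      · rw [Set.indicator_of_notMem hx]
        simp only [Set.mem_pi, Set.mem_univ, forall_const, not_forall] at hx
        obtain ⟨i, hi⟩ := hx
        rw [Finset.prod_eq_zero (s := Finset.univ) (f := fun i =>
          (A (τ i)).indicator (fun _ => (1 : ℂ)) (x i)) (Finset.mem_univ i)]
        · ring
        · exact Set.indicator_of_notMem hi _
    rw [h3, integral_finsetSum]
    · refine Finset.sum_congr rfl fun τ _ => ?_
      rw [integral_const_mul, integral_indicator (hmeas τ)]
    · intro τ _
      exact ((integrable_indicator_iff (hmeas τ)).2 (hint τ)).const_mul _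
  -- Bosonic symmetry makes all n! permuted boxes contribute equally, so the vanishing sum is n!
  -- times the integral in question.
  have hconst : ∀ σ : Equiv.Perm (Fin n), ∫ x in Set.univ.pi fun i => A (σ i),
      conj ((ψ : TensorPower d n) x) ∂ν =
      ∫ x in Set.univ.pi A, conj ((ψ : TensorPower d n) x) ∂ν := by
    intro σ
    have h1 : ∀ᵐ x ∂ν, (ψ : TensorPower d n) (x ∘ σ) = (ψ : TensorPower d n) x := by
      have h2 := mem_bosonSpace.1 ψ.2 σ
      have h3 : (permute d n σ (ψ : TensorPower d n) : (Fin n → Label d) → ℂ) =ᵐ[ν]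
          (ψ : TensorPower d n) ∘ (fun x => x ∘ σ) :=
        Lp.coeFn_compMeasurePreserving _ (measurePreserving_permute d n σ)
      rw [h2] at h3
      filter_upwards [h3] with x hx
      exact hx.symm
    have h4 := (measurePreserving_permute d n σ).setIntegral_preimage_emb
      (MeasurableEquiv.arrowCongr' σ.symm (MeasurableEquiv.refl (Label d))).measurableEmbedding
      (fun x => conj ((ψ : TensorPower d n) x)) (Set.univ.pi fun i => A (σ i))
    refine h4.symm.trans ?_
    have h5 : (fun x : Fin n → Label d => x ∘ σ) ⁻¹' (Set.univ.pi fun i => A (σ i)) =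
        Set.univ.pi A := by
      ext x
      simp only [Set.mem_preimage, Set.mem_pi, Set.mem_univ, forall_const, Function.comp]
      exact ⟨fun h i => by simpa using h (σ.symm i), fun h i => h _⟩
    rw [h5]
    refine integral_congr_ae (ae_restrict_of_ae ?_)
    filter_upwards [h1] with x hx
    rw [hx]
  simp_rw [hconst] at hsum
  simpa [Finset.card_univ, Fintype.card_perm, Nat.factorial_ne_zero] using hsum

/-- A π-λ argument: boxes form a π-system generating the product σ-algebra. It is run inside the
cubes `B m` of finite measure, which exhaust the space, because a square integrable function need
not be integrable globally. -/
lemma eq_zero_of_setIntegral_box_eq_zero {d n : ℕ} (ψ : TensorPower d n)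
    (hψ : ∀ A : Fin n → Set (Label d), (∀ i, MeasurableSet (A i)) →
      (∀ i, labelMeasure d (A i) ≠ ⊤) → ∫ x in Set.univ.pi A, conj (ψ x)
      ∂(Measure.pi fun _ : Fin n => labelMeasure d) = 0) : ψ = 0 := by
  set ν := Measure.pi fun _ : Fin n => labelMeasure d with hν
  have hL : MemLp (fun x => conj (ψ x)) 2 ν := (Lp.memLp ψ).star
  set B : ℕ → Set (Fin n → Label d) := fun m =>
    Set.univ.pi fun _ => spanningSets (labelMeasure d) m with hB
  have hBm : ∀ m, MeasurableSet (B m) := fun m =>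
    MeasurableSet.univ_pi fun i => measurableSet_spanningSets _ _
  have hfin : ∀ m, IsFiniteMeasure (ν.restrict (B m)) := fun m => by
    refine ⟨?_⟩
    rw [Measure.restrict_apply_univ, hν, Measure.pi_pi]
    exact ENNReal.prod_lt_top fun i _ => measure_spanningSets_lt_top _ _
  have hint : ∀ m, Integrable (fun x => conj (ψ x)) (ν.restrict (B m)) := fun m =>
    (hL.restrict _).integrable (by norm_num)
  have hzero : ∀ m, ∀ C, MeasurableSet C → ∫ x in C, conj (ψ x) ∂(ν.restrict (B m)) = 0 := by
    intro m C hC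
    induction C, hC using MeasurableSpace.induction_on_inter (s := Set.univ.pi '' Set.univ.pi
        fun _ : Fin n => {s : Set (Label d) | MeasurableSet s}) generateFrom_pi.symm
        isPiSystem_pi with
    | empty => simp
    | basic t ht =>
      obtain ⟨A, hA, rfl⟩ := ht
      have hA : ∀ i, MeasurableSet (A i) := fun i => hA i (Set.mem_univ i)
      rw [Measure.restrict_restrict (MeasurableSet.univ_pi hA), hB, Set.pi_inter_distrib.symm]
      refine hψ _ (fun i => (hA i).inter (measurableSet_spanningSets _ _)) fun i => ?_
      exact ((measure_mono Set.inter_subset_right).trans_lt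
        (measure_spanningSets_lt_top _ _)).ne
    | compl t ht ih =>
      have h1 := integral_add_compl ht (hint m)
      rw [ih, zero_add] at h1
      rw [h1]
      exact hψ _ (fun i => measurableSet_spanningSets _ _)
        fun i => (measure_spanningSets_lt_top _ _).ne
    | iUnion f hd hf ih =>
      rw [integral_iUnion hf hd (hint m).integrableOn]
      simp [ih]
  have hae : ∀ m, ∀ᵐ x ∂(ν.restrict (B m)), conj (ψ x) = 0 := fun m =>
    (hint m).ae_eq_zero_of_forall_setIntegral_eq_zero fun C hC _ => hzero m C hC
  have hun : ⋃ m, B m = Set.univ := by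
    refine Set.eq_univ_of_forall fun x => ?_
    refine Set.mem_iUnion.2 ⟨Finset.univ.sup fun i => spanningSetsIndex (labelMeasure d) (x i), ?_⟩
    intro i _
    exact monotone_spanningSets _ (Finset.le_sup (f := fun i =>
      spanningSetsIndex (labelMeasure d) (x i)) (Finset.mem_univ i)) (mem_spanningSetsIndex _ _)
  have hall : ∀ᵐ x ∂ν, conj (ψ x) = 0 := by
    rw [← Measure.restrict_univ (μ := ν), ← hun, ae_restrict_iUnion_iff]
    exact hae
  refine Lp.ext ?_
  filter_upwards [hall, Lp.coeFn_zero ℂ 2 ν] with x h1 h2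
  rw [h2]
  simpa using h1

/-- The coherent vectors are total. -/
lemma eq_zero_of_inner_coherent_eq_zero {d : ℕ} {Ψ : Fock d}
    (hΨ : ∀ f : OneParticle d, ⟪Ψ, coherent f⟫_ℂ = 0) : Ψ = 0 := by
  have h : ∀ n, component n Ψ = 0 := by
    intro n
    refine Subtype.ext (eq_zero_of_setIntegral_box_eq_zero _ fun A hA hA' => ?_)
    exact setIntegral_box_eq_zero _ (integral_prod_eq_zero_of_orthogonal hΨ n) A hA hA'
  exact lp.ext (funext h)

lemma inner_self_eq_ofReal {X : Type*} [NormedAddCommGroup X] [InnerProductSpace ℂ X] (x : X) :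
    ⟪x, x⟫_ℂ = ((‖x‖ ^ 2 : ℝ) : ℂ) := by
  rw [inner_self_eq_norm_sq_to_K]
  norm_cast

/-! ### Operators prescribed on exponential vectors, and the contraction r^N. -/

section Exponential

variable {d : ℕ}

lemma eq_of_forall_inner_expVec {Φ Ψ : Fock d} (h : ∀ g, ⟪expVec g, Φ⟫_ℂ = ⟪expVec g, Ψ⟫_ℂ) :
    Φ = Ψ := by
  rw [← sub_eq_zero]
  refine eq_zero_of_inner_coherent_eq_zero fun f => ?_
  rw [coherent_eq, inner_smul_right, ← inner_conj_symm, inner_sub_right, h, sub_self, map_zero,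
    mul_zero]

/-- Finite linear combinations of exponential vectors. -/
def expSum (d : ℕ) : (OneParticle d →₀ ℂ) →ₗ[ℂ] Fock d := Finsupp.linearCombination ℂ expVec

lemma denseRange_expSum : DenseRange (expSum d) := by
  have h : (LinearMap.range (expSum d)).topologicalClosure = ⊤ := by
    rw [Submodule.topologicalClosure_eq_top_iff, Submodule.eq_bot_iff]
    intro Ψ hΨ
    refine eq_of_forall_inner_expVec fun g => ?_
    rw [inner_zero_right]
    refine (Submodule.mem_orthogonal _ _).1 hΨ _ ⟨Finsupp.single g 1, ?_⟩
    simp [expSum]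
  have h2 := Submodule.dense_iff_topologicalClosure_eq_top.2 h
  rwa [DenseRange, ← LinearMap.coe_range]

/-- An operator is determined by, and can be prescribed on, the exponential vectors. -/
lemma exists_clm_expVec {Y : Type*} [NormedAddCommGroup Y] [NormedSpace ℂ Y] [CompleteSpace Y]
    (F : OneParticle d → Y) (C : ℝ)
    (hF : ∀ c : OneParticle d →₀ ℂ, ‖Finsupp.linearCombination ℂ F c‖ ≤ C * ‖expSum d c‖) :
    ∃ B : Fock d →L[ℂ] Y, (∀ g, B (expVec g) = F g) ∧ ∀ x, ‖B x‖ ≤ C * ‖x‖ := by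
  refine ⟨(Finsupp.linearCombination ℂ F).extendOfNorm (expSum d), fun g => ?_, fun x => ?_⟩
  · have h := LinearMap.extendOfNorm_eq (f := Finsupp.linearCombination ℂ F) (e := expSum d)
      denseRange_expSum ⟨C, hF⟩ (Finsupp.single g 1)
    simpa [expSum] using h
  · exact LinearMap.norm_extendOfNorm_apply_le denseRange_expSum C hF x

/-- The norm of a linear combination depends only on the Gram matrix. This yields isometries, such
as the Weyl operators, from a computation with kernels. -/
lemma norm_linearCombination_eq {ι X Y : Type*} [NormedAddCommGroup X] [InnerProductSpace ℂ X]
    [NormedAddCommGroup Y] [InnerProductSpace ℂ Y] (E : ι → X) (F : ι → Y)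
    (h : ∀ g f, ⟪F g, F f⟫_ℂ = ⟪E g, E f⟫_ℂ) (c : ι →₀ ℂ) :
    ‖Finsupp.linearCombination ℂ F c‖ = ‖Finsupp.linearCombination ℂ E c‖ := by
  have h2 : ⟪Finsupp.linearCombination ℂ F c, Finsupp.linearCombination ℂ F c⟫_ℂ =
      ⟪Finsupp.linearCombination ℂ E c, Finsupp.linearCombination ℂ E c⟫_ℂ := by
    simp only [Finsupp.linearCombination_apply, Finsupp.sum, sum_inner, inner_sum,
      inner_smul_left, inner_smul_right, h]
  rw [inner_self_eq_norm_sq_to_K, inner_self_eq_norm_sq_to_K] at h2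
  have h3 : ‖Finsupp.linearCombination ℂ F c‖ ^ 2 = ‖Finsupp.linearCombination ℂ E c‖ ^ 2 := by
    exact_mod_cast h2
  exact (sq_eq_sq₀ (norm_nonneg _) (norm_nonneg _)).1 h3

/-- The component map as a linear map. -/
def componentₗ (d n : ℕ) : Fock d →ₗ[ℂ] bosonSpace d n where
  toFun := component n
  map_add' _ _ := rfl
  map_smul' _ _ := rfl

lemma hasSum_norm_sq_component (Ψ : Fock d) :
    HasSum (fun n => ‖component n Ψ‖ ^ 2) (‖Ψ‖ ^ 2) := by
  have h := hasSum_inner_component Ψ Ψ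
  simp_rw [inner_self_eq_ofReal] at h
  exact Complex.hasSum_ofReal.1 h

/-- By homogeneity of degree n, the map E(g) ↦ E(r g) multiplies the n-boson component by r^n. For 0
≤ r ≤ 1 it is therefore a well defined contraction on the span. -/
lemma component_expVec_smul (c : ℂ) (g : OneParticle d) (n : ℕ) :
    component n (expVec (c • g)) = c ^ n • component n (expVec g) := by
  refine Subtype.ext (Lp.ext ?_)
  have h1 : ∀ g : OneParticle d, ((component n (expVec g) : TensorPower d n) :
      (Fin n → Label d) → ℂ) =ᵐ[Measure.pi fun _ : Fin n => labelMeasure d]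
      fun x => ((1 / √(n.factorial : ℝ) : ℝ) : ℂ) * ∏ i, g (x i) := by
    intro g
    have h2 : (component n (expVec g) : TensorPower d n) =
        ((Real.exp (‖g‖ ^ 2 / 2) : ℝ) : ℂ) • (memLp_coherentFun g n).toLp (coherentFun g n) := rfl
    rw [h2]
    filter_upwards [(memLp_coherentFun g n).coeFn_toLp,
      Lp.coeFn_smul ((Real.exp (‖g‖ ^ 2 / 2) : ℝ) : ℂ)
        ((memLp_coherentFun g n).toLp (coherentFun g n))] with x h3 h4
    rw [h4, Pi.smul_apply, h3, coherentFun, smul_eq_mul, ← mul_assoc, ← Complex.ofReal_mul,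
      ← mul_div_assoc, ← Real.exp_add]
    congr 4
    rw [Real.exp_eq_one_iff]
    ring
  have h5 : ((c ^ n • component n (expVec g) : bosonSpace d n) : TensorPower d n) =
      c ^ n • (component n (expVec g) : TensorPower d n) := rfl
  rw [h5]
  filter_upwards [h1 g, h1 (c • g), smul_coeFn_pi c g,
    Lp.coeFn_smul (c ^ n) (component n (expVec g) : TensorPower d n)] with x h6 h7 h8 h9
  rw [h7, h8, h9, Pi.smul_apply, h6, smul_eq_mul]
  ring

/-- The second quantisation `r^N` of a real number `0 ≤ r ≤ 1`. -/
lemma exists_rescale (r : ℝ) (hr : 0 ≤ r) (hr1 : r ≤ 1) :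
    ∃ B : Fock d →L[ℂ] Fock d, (∀ g, B (expVec g) = expVec ((r : ℂ) • g)) ∧ ∀ x, ‖B x‖ ≤ ‖x‖ := by
  have hF : ∀ c : OneParticle d →₀ ℂ, ‖Finsupp.linearCombination ℂ
      (fun g : OneParticle d => expVec ((r : ℂ) • g)) c‖ ≤ 1 * ‖expSum d c‖ := by
    intro c
    rw [one_mul]
    refine (sq_le_sq₀ (norm_nonneg _) (norm_nonneg _)).1 ?_
    have hc : ∀ n, component n (Finsupp.linearCombination ℂ
        (fun g : OneParticle d => expVec ((r : ℂ) • g)) c) =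
        (r : ℂ) ^ n • component n (expSum d c) := by
      intro n
      change componentₗ d n _ = (r : ℂ) ^ n • componentₗ d n _
      simp only [expSum, Finsupp.linearCombination_apply, Finsupp.sum, map_sum, map_smul,
        Finset.smul_sum]
      refine Finset.sum_congr rfl fun g _ => ?_
      change c g • component n (expVec ((r : ℂ) • g)) = _ • c g • component n (expVec g)
      rw [component_expVec_smul, smul_comm]
    refine hasSum_le (fun n => ?_) (hasSum_norm_sq_component _) (hasSum_norm_sq_component _)
    rw [hc, norm_smul]
    refine pow_le_pow_left₀ (by positivity) ?_ 2
    refine mul_le_of_le_one_left (norm_nonneg _) ?_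
    rw [norm_pow, Complex.norm_real, Real.norm_of_nonneg hr]
    exact pow_le_one₀ hr hr1
  obtain ⟨B, h1, h2⟩ := exists_clm_expVec _ 1 hF
  exact ⟨B, h1, fun x => by simpa using h2 x⟩

/-- `r^N` for `0 ≤ r ≤ 1`, the zero operator otherwise. -/
def rescale (d : ℕ) (r : ℝ) : Fock d →L[ℂ] Fock d :=
  if h : 0 ≤ r ∧ r ≤ 1 then (exists_rescale r h.1 h.2).choose else 0

lemma rescale_expVec {r : ℝ} (hr : 0 ≤ r) (hr1 : r ≤ 1) (g : OneParticle d) :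
    rescale d r (expVec g) = expVec ((r : ℂ) • g) := by
  rw [rescale, dif_pos ⟨hr, hr1⟩]
  exact (exists_rescale r hr hr1).choose_spec.1 g

lemma norm_rescale_le {r : ℝ} (hr : 0 ≤ r) (hr1 : r ≤ 1) (x : Fock d) : ‖rescale d r x‖ ≤ ‖x‖ := by
  rw [rescale, dif_pos ⟨hr, hr1⟩]
  exact (exists_rescale r hr hr1).choose_spec.2 x

/-- The kernel gives ‖E(f) - E(g)‖² = exp‖f‖² + exp‖g‖² - 2 Re exp⟨f, g⟩, which is continuous in f
and vanishes at f = g. -/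
lemma continuous_expVec : Continuous (expVec : OneParticle d → Fock d) := by
  rw [continuous_iff_continuousAt]
  intro g
  rw [ContinuousAt, tendsto_iff_norm_sub_tendsto_zero]
  have h : ∀ f : OneParticle d, ‖expVec f - expVec g‖ =
      √(Real.exp (‖f‖ ^ 2) + Real.exp (‖g‖ ^ 2) - 2 * (Complex.exp ⟪f, g⟫_ℂ).re) := by
    intro f
    have hn : ∀ f : OneParticle d, ‖expVec f‖ ^ 2 = Real.exp (‖f‖ ^ 2) := by
      intro f
      have h1 := inner_expVec f f
      rw [inner_self_eq_ofReal, inner_self_eq_ofReal, ← Complex.ofReal_exp] at h1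
      exact Complex.ofReal_injective h1
    have h2 := norm_sub_sq (𝕜 := ℂ) (expVec f) (expVec g)
    rw [inner_expVec, hn, hn] at h2
    rw [← Real.sqrt_sq (norm_nonneg (expVec f - expVec g)), h2]
    congr 1
    simp only [RCLike.re_eq_complex_re]
    ring
  simp_rw [h]
  have h3 : Continuous fun f : OneParticle d =>
      √(Real.exp (‖f‖ ^ 2) + Real.exp (‖g‖ ^ 2) - 2 * (Complex.exp ⟪f, g⟫_ℂ).re) := by
    fun_prop
  have h4 := h3.tendsto g
  convert h4 using 2
  rw [inner_self_eq_norm_sq_to_K]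
  have : Complex.exp ((‖g‖ : ℂ) ^ 2) = ((Real.exp (‖g‖ ^ 2) : ℝ) : ℂ) := by push_cast; rfl
  change 0 = √(_ - 2 * (Complex.exp ((‖g‖ : ℂ) ^ 2)).re)
  rw [this, Complex.ofReal_re]
  ring_nf
  simp

/-- Removes the regularisation: convergence holds on exponential vectors by continuity, and extends
to all vectors by density, the operators being contractions. -/
lemma tendsto_rescale (x : Fock d) : Tendsto (fun r => rescale d r x) (𝓝[<] 1) (𝓝 x) := by
  have hI : ∀ᶠ r : ℝ in 𝓝[<] 1, 0 ≤ r ∧ r ≤ 1 := by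
    filter_upwards [self_mem_nhdsWithin, mem_nhdsWithin_of_mem_nhds
      (lt_mem_nhds (zero_lt_one (α := ℝ)))] with r h1 h2
    exact ⟨le_of_lt h2, le_of_lt h1⟩
  have hE : ∀ c, Tendsto (fun r => rescale d r (expSum d c)) (𝓝[<] 1) (𝓝 (expSum d c)) := by
    intro c
    simp only [expSum, Finsupp.linearCombination_apply, Finsupp.sum, map_sum, map_smul]
    refine tendsto_finsetSum _ fun g _ => Tendsto.const_smul ?_ _
    have h1 : Tendsto (fun r : ℝ => expVec ((r : ℂ) • g)) (𝓝[<] 1) (𝓝 (expVec g)) := by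
      have h2 : Continuous fun r : ℝ => expVec ((r : ℂ) • g) :=
        continuous_expVec.comp (by fun_prop)
      have h3 := h2.tendsto 1
      simp only [Complex.ofReal_one, one_smul] at h3
      exact h3.mono_left nhdsWithin_le_nhds
    refine h1.congr' ?_
    filter_upwards [hI] with r hr
    rw [rescale_expVec hr.1 hr.2]
  rw [Metric.tendsto_nhds]
  intro ε hε
  obtain ⟨c, hc⟩ := denseRange_expSum.exists_dist_lt x (show 0 < ε / 3 by positivity)
  filter_upwards [hI, Metric.tendsto_nhds.1 (hE c) (ε / 3) (by positivity)] with r hr h1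
  have h2 : dist (rescale d r x) (rescale d r (expSum d c)) ≤ dist x (expSum d c) := by
    rw [dist_eq_norm, ← map_sub, dist_eq_norm]
    exact norm_rescale_le hr.1 hr.2 _
  have h3 := dist_triangle4_right (rescale d r x) x (rescale d r (expSum d c)) (expSum d c)
  linarith [dist_comm (rescale d r x) (rescale d r (expSum d c))]

end Exponential

section Operators

variable {d : ℕ}

/-! ### Differentiation of exponential vectors -/

lemma inner_expVec_add_smul (g' g q : OneParticle d) (z : ℂ) :
    ⟪expVec g', expVec (g + z • q)⟫_ℂ = Complex.exp (⟪g', g⟫_ℂ + z * ⟪g', q⟫_ℂ) := by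
  rw [inner_expVec, inner_add_right, inner_smul_right]

/-- The Cauchy integral of the curve over the unit circle is analytic. It coincides with the curve
because it does so after pairing with each exponential vector, where the curve becomes a scalar
entire function. -/
lemma differentiableAt_expVec_add_smul (g q : OneParticle d) :
    DifferentiableAt ℂ (fun z : ℂ => expVec (g + z • q)) 0 := by
  have hc : Continuous fun z : ℂ => expVec (g + z • q) := continuous_expVec.comp (by fun_prop)
  have hci : CircleIntegrable (fun z : ℂ => expVec (g + z • q)) 0 1 :=
    hc.continuousOn.circleIntegrable zero_le_one
  have h := hasFPowerSeriesOn_cauchy_integral (R := 1) hci one_pos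
  refine (h.hasFPowerSeriesAt.differentiableAt).congr_of_eventuallyEq ?_
  filter_upwards [Metric.ball_mem_nhds (0 : ℂ) one_pos] with w hw
  refine eq_of_forall_inner_expVec fun g' => ?_
  have hd : Differentiable ℂ fun z : ℂ => ⟪expVec g', expVec (g + z • q)⟫_ℂ := by
    simp_rw [inner_expVec_add_smul]
    fun_prop
  have h2 := (hd.diffContOnCl (s := Metric.ball (0 : ℂ) 1)).two_pi_i_inv_smul_circleIntegral_sub_inv_smul hw
  rw [inner_smul_right, ← h2, smul_eq_mul]
  congr 1
  simp only [circleIntegral]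
  rw [← innerSL_apply_apply ℂ (expVec g'), ← ContinuousLinearMap.intervalIntegral_comp_comm]
  · refine intervalIntegral.integral_congr fun θ _ => ?_
    simp [innerSL_apply_apply]
  · have h3 : ContinuousOn (fun z : ℂ => (z - w)⁻¹ • expVec (g + z • q)) (Metric.sphere 0 1) := by
      refine ContinuousOn.smul (ContinuousOn.inv₀ (f := fun z : ℂ => z - w) (by fun_prop)
        fun z hz => ?_) hc.continuousOn
      rw [sub_ne_zero]
      rintro rfl
      rw [mem_sphere_iff_norm] at hz
      rw [mem_ball_iff_norm] at hw
      exact absurd hz hw.ne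
    exact (h3.circleIntegrable zero_le_one).out

/-- The creation operator applied to an exponential vector, `c†(q) E(g)`. -/
def crea (q g : OneParticle d) : Fock d := deriv (fun z : ℂ => expVec (g + z • q)) 0

lemma hasDerivAt_expVec (q g : OneParticle d) :
    HasDerivAt (fun z : ℂ => expVec (g + z • q)) (crea q g) 0 :=
  (differentiableAt_expVec_add_smul g q).hasDerivAt

lemma hasDerivAt_inner_expVec (Ψ : Fock d) (q g : OneParticle d) :
    HasDerivAt (fun z : ℂ => ⟪Ψ, expVec (g + z • q)⟫_ℂ) ⟪Ψ, crea q g⟫_ℂ 0 :=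
  (innerSL ℂ Ψ).hasFDerivAt.comp_hasDerivAt 0 (hasDerivAt_expVec q g)

lemma inner_expVec_crea (g' q g : OneParticle d) :
    ⟪expVec g', crea q g⟫_ℂ = ⟪g', q⟫_ℂ * Complex.exp ⟪g', g⟫_ℂ := by
  have h1 := hasDerivAt_inner_expVec (expVec g') q g
  simp_rw [inner_expVec_add_smul] at h1
  have h2 : HasDerivAt (fun z : ℂ => Complex.exp (⟪g', g⟫_ℂ + z * ⟪g', q⟫_ℂ))
      (Complex.exp (⟪g', g⟫_ℂ + 0 * ⟪g', q⟫_ℂ) * (1 * ⟪g', q⟫_ℂ)) 0 :=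
    (((hasDerivAt_id (0 : ℂ)).mul_const _).const_add _).cexp
  rw [h1.unique h2]
  simp [mul_comm]

lemma inner_crea_expVec (g' q g : OneParticle d) :
    ⟪crea q g, expVec g'⟫_ℂ = ⟪q, g'⟫_ℂ * Complex.exp ⟪g, g'⟫_ℂ := by
  rw [← inner_conj_symm, inner_expVec_crea, map_mul, inner_conj_symm, ← Complex.exp_conj,
    inner_conj_symm]

/-- Differentiating ⟨c†(q)E(g), E(f + zq)⟩ at z = 0, the product rule produces the extra term ‖q‖².
This is the canonical commutation relation on exponential vectors and the origin of the constant 1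
in the bounds. -/
lemma inner_crea_crea (q g f : OneParticle d) :
    ⟪crea q g, crea q f⟫_ℂ =
      (((‖q‖ ^ 2 : ℝ) : ℂ) + ⟪g, q⟫_ℂ * ⟪q, f⟫_ℂ) * Complex.exp ⟪g, f⟫_ℂ := by
  have h1 := hasDerivAt_inner_expVec (crea q g) q f
  simp_rw [inner_crea_expVec, inner_add_right, inner_smul_right, inner_self_eq_ofReal] at h1
  have h2 : HasDerivAt (fun z : ℂ => (⟪q, f⟫_ℂ + z * ((‖q‖ ^ 2 : ℝ) : ℂ)) *
      Complex.exp (⟪g, f⟫_ℂ + z * ⟪g, q⟫_ℂ))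
      ((1 * ((‖q‖ ^ 2 : ℝ) : ℂ)) * Complex.exp (⟪g, f⟫_ℂ + 0 * ⟪g, q⟫_ℂ) +
      (⟪q, f⟫_ℂ + 0 * ((‖q‖ ^ 2 : ℝ) : ℂ)) *
        (Complex.exp (⟪g, f⟫_ℂ + 0 * ⟪g, q⟫_ℂ) * (1 * ⟪g, q⟫_ℂ))) 0 :=
    (((hasDerivAt_id (0 : ℂ)).mul_const _).const_add _).mul
      (((hasDerivAt_id (0 : ℂ)).mul_const _).const_add _).cexp
  rw [h1.unique h2]
  simp only [one_mul, zero_mul, add_zero]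
  ring

lemma crea_add (q₁ q₂ g : OneParticle d) : crea (q₁ + q₂) g = crea q₁ g + crea q₂ g := by
  refine eq_of_forall_inner_expVec fun g' => ?_
  simp only [inner_add_right, inner_expVec_crea, add_mul]

lemma crea_smul (c : ℂ) (q g : OneParticle d) : crea (c • q) g = c • crea q g := by
  refine eq_of_forall_inner_expVec fun g' => ?_
  simp only [inner_smul_right, inner_expVec_crea, mul_assoc]

/-! ### Weyl operators and regularised annihilation operators -/

/-- The prefactor is the one for which the shift g ↦ g + p preserves the exponential kernel; Gram
matrices then agree and the map is isometric on the span. -/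
lemma exists_weyl (p : OneParticle d) :
    ∃ W : Fock d →L[ℂ] Fock d, (∀ g, W (expVec g) =
      (Complex.exp (-(‖p‖ ^ 2 / 2)) * Complex.exp (-⟪p, g⟫_ℂ)) • expVec (g + p)) ∧
      ∀ x, ‖W x‖ ≤ ‖x‖ := by
  have hF := fun c => (norm_linearCombination_eq (expVec : OneParticle d → Fock d)
    (fun g => (Complex.exp (-(‖p‖ ^ 2 / 2)) * Complex.exp (-⟪p, g⟫_ℂ)) • expVec (g + p))
    (fun g f => ?_) c).le
  · obtain ⟨W, h1, h2⟩ := exists_clm_expVec _ 1 (fun c => by rw [one_mul]; exact hF c)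
    exact ⟨W, h1, fun x => by simpa using h2 x⟩
  · rw [inner_smul_left, inner_smul_right, inner_expVec, inner_expVec, map_mul, ← Complex.exp_conj,
      ← Complex.exp_conj, ← Complex.exp_add, ← Complex.exp_add, ← Complex.exp_add,
      ← Complex.exp_add]
    congr 1
    simp only [map_neg, inner_conj_symm, inner_add_left, inner_add_right, map_div₀, map_pow,
      Complex.conj_ofReal, map_ofNat]
    rw [inner_self_eq_ofReal p]
    push_cast
    ring

/-- The operator is built as a multiple of (Weyl) r^N (Weyl). Each factor is a contraction, so the
multiple alone gives the norm bound. -/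
lemma exists_exp_lowering (q : OneParticle d) {r : ℝ} (hr : 0 ≤ r) (hr1 : r < 1) :
    ∃ V : Fock d →L[ℂ] Fock d,
      (∀ g, V (expVec g) = Complex.exp ⟪q, g⟫_ℂ • expVec ((r : ℂ) • g)) ∧
      ∀ x, ‖V x‖ ≤ Real.exp (‖q‖ ^ 2 / (2 * (1 - r ^ 2))) * ‖x‖ := by
  have hs : 0 < 1 - r ^ 2 := by nlinarith
  -- Shifting by p, scaling by r and shifting back by -r p produces exp(-(1 - r²)⟨p, g⟩), which this
  -- p turns into exp⟨q, g⟩. The remaining factor exp(-‖q‖²/(2(1 - r²))) does not depend on g and is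
  -- cancelled by the scalar in front.
  set p : OneParticle d := ((-(1 - r ^ 2)⁻¹ : ℝ) : ℂ) • q with hp
  obtain ⟨W₁, h1, h1'⟩ := exists_weyl p
  obtain ⟨W₂, h2, h2'⟩ := exists_weyl (-((r : ℂ) • p))
  refine ⟨((Real.exp (‖q‖ ^ 2 / (2 * (1 - r ^ 2))) : ℝ) : ℂ) • (W₂ ∘L rescale d r ∘L W₁),
    fun g => ?_, fun x => ?_⟩
  · simp only [smul_apply, ContinuousLinearMap.comp_apply, h1, map_smul,
      rescale_expVec hr hr1.le, h2, smul_smul]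
    have e1 : (r : ℂ) • (g + p) + -((r : ℂ) • p) = (r : ℂ) • g := by
      rw [smul_add]; abel
    rw [e1]
    congr 1
    rw [Complex.ofReal_exp, ← Complex.exp_add, ← Complex.exp_add, ← Complex.exp_add,
      ← Complex.exp_add]
    congr 1
    have e2 : ‖-((r : ℂ) • p)‖ = r * ((1 - r ^ 2)⁻¹ * ‖q‖) := by
      rw [norm_neg, norm_smul, hp, norm_smul, Complex.norm_real, Complex.norm_real, norm_neg,
        Real.norm_of_nonneg hr, Real.norm_of_nonneg (inv_nonneg.2 hs.le)]
    have e3 : ‖p‖ = (1 - r ^ 2)⁻¹ * ‖q‖ := by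
      rw [hp, norm_smul, Complex.norm_real, norm_neg, Real.norm_of_nonneg (inv_nonneg.2 hs.le)]
    have e4 : ⟪p, g⟫_ℂ = ((-(1 - r ^ 2)⁻¹ : ℝ) : ℂ) * ⟪q, g⟫_ℂ := by
      rw [hp, inner_smul_left, Complex.conj_ofReal]
    have e5 : ⟪p, p⟫_ℂ = (((1 - r ^ 2)⁻¹ * ‖q‖) ^ 2 : ℝ) := by
      rw [inner_self_eq_ofReal, e3]
    rw [e2, e3]
    simp only [inner_neg_left, inner_smul_left, inner_smul_right, inner_add_right,
      Complex.conj_ofReal, e4, e5]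
    have hs' : (1 - (r : ℂ) ^ 2) ≠ 0 := by
      exact_mod_cast hs.ne'
    push_cast
    field_simp
    ring
  · rw [smul_apply, norm_smul, Complex.norm_real,
      Real.norm_of_nonneg (Real.exp_pos _).le]
    gcongr
    exact (h2' _).trans ((norm_rescale_le hr hr1.le _).trans (h1' _))

/-- The bounded operators `c(q) r^N`, up to a factor. -/
lemma exists_lowering (q : OneParticle d) {r : ℝ} (hr : 0 ≤ r) (hr1 : r < 1) :
    ∃ B : Fock d →L[ℂ] Fock d, ∀ g, B (expVec g) = ⟪q, g⟫_ℂ • expVec ((r : ℂ) • g) := by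
  set C := Real.exp (‖q‖ ^ 2 / (2 * (1 - r ^ 2))) with hC
  have hF : ∀ c : OneParticle d →₀ ℂ, ‖Finsupp.linearCombination ℂ
      (fun g : OneParticle d => ⟪q, g⟫_ℂ • expVec ((r : ℂ) • g)) c‖ ≤ C * ‖expSum d c‖ := by
    intro c
    -- The wanted combination is the derivative of `h` at 0. For |z| = 1 the values of `h` come from
    -- `exists_exp_lowering` with a vector of norm ‖q‖, so Cauchy's estimate on the unit circle
    -- transfers the bound C.
    set h : ℂ → Fock d := fun z => Finsupp.linearCombination ℂ
      (fun g : OneParticle d => Complex.exp (z * ⟪q, g⟫_ℂ) • expVec ((r : ℂ) • g)) c with hh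
    have hd : ∀ z, HasDerivAt h (Finsupp.linearCombination ℂ (fun g : OneParticle d =>
        (Complex.exp (z * ⟪q, g⟫_ℂ) * (1 * ⟪q, g⟫_ℂ)) • expVec ((r : ℂ) • g)) c) z := by
      intro z
      simp only [hh, Finsupp.linearCombination_apply, Finsupp.sum]
      refine HasDerivAt.fun_sum fun g _ => ?_
      exact ((((hasDerivAt_id z).mul_const ⟪q, g⟫_ℂ).cexp).smul_const
        (expVec ((r : ℂ) • g))).const_smul (c g)
    have h0 := (hd 0).deriv
    simp only [zero_mul, Complex.exp_zero, one_mul] at h0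
    rw [← h0]
    have h2 : ∀ z ∈ Metric.sphere (0 : ℂ) 1, ‖h z‖ ≤ C * ‖expSum d c‖ := by
      intro z hz
      obtain ⟨V, hV, hV'⟩ := exists_exp_lowering (conj z • q) hr hr1
      have h3 : h z = V (expSum d c) := by
        simp only [hh, expSum, Finsupp.linearCombination_apply, Finsupp.sum, map_sum, map_smul, hV,
          inner_smul_left, Complex.conj_conj]
      have h4 : ‖conj z • q‖ = ‖q‖ := by
        rw [norm_smul, Complex.norm_conj, mem_sphere_zero_iff_norm.1 hz, one_mul]
      rw [h3]
      simpa [h4] using hV' (expSum d c)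
    have h5 := Complex.norm_deriv_le_of_forall_mem_sphere_norm_le one_pos
      (Differentiable.diffContOnCl (fun z => (hd z).differentiableAt)) h2
    rwa [div_one] at h5
  obtain ⟨B, h1, -⟩ := exists_clm_expVec _ C hF
  exact ⟨B, h1⟩

/-! ### The graphs of the creation and annihilation operators -/

lemma mem_creationGraph {q : OneParticle d} {ψ χ : Fock d} :
    (ψ, χ) ∈ creationGraph q ↔ ∀ g, ⟪expVec g, χ⟫_ℂ = ⟪g, q⟫_ℂ * ⟪expVec g, ψ⟫_ℂ := by
  refine forall_congr' fun g => ?_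
  change ⟪coherent g, χ⟫_ℂ = ⟪g, q⟫_ℂ * ⟪coherent g, ψ⟫_ℂ ↔ _
  have hne : ((Real.exp (-(‖g‖ ^ 2 / 2)) : ℝ) : ℂ) ≠ 0 :=
    Complex.ofReal_ne_zero.2 (Real.exp_pos _).ne'
  rw [coherent_eq, inner_smul_left, inner_smul_left, Complex.conj_ofReal, mul_left_comm,
    mul_right_inj' hne]

lemma expVec_mem_creationGraph (q g : OneParticle d) : (expVec g, crea q g) ∈ creationGraph q := by
  rw [mem_creationGraph]
  intro g'
  rw [inner_expVec_crea, inner_expVec]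

/-- Totality makes the relation single valued. This is what guarantees that the graph of `creation
q` is the whole of `creationGraph q`. -/
lemma creationGraph_isGraph (q : OneParticle d) :
    ∀ x : Fock d × Fock d, x ∈ creationGraph q → x.1 = 0 → x.2 = 0 := by
  rintro ⟨ψ, χ⟩ hx (rfl : ψ = 0)
  refine eq_of_forall_inner_expVec fun g => ?_
  rw [mem_creationGraph.1 hx g, inner_zero_right, mul_zero]

lemma dense_creation_domain (q : OneParticle d) :
    Dense ((creation q).domain : Set (Fock d)) := by
  refine denseRange_expSum.mono ?_
  rintro _ ⟨c, rfl⟩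
  simp only [expSum, Finsupp.linearCombination_apply, Finsupp.sum]
  refine Submodule.sum_mem _ fun g _ => Submodule.smul_mem _ _ ?_
  exact ⟨_, expVec_mem_creationGraph q g, rfl⟩

lemma inner_expVec_rescale {r : ℝ} (hr : 0 ≤ r) (hr1 : r ≤ 1) (g : OneParticle d) (x : Fock d) :
    ⟪expVec g, rescale d r x⟫_ℂ = ⟪expVec ((r : ℂ) • g), x⟫_ℂ := by
  refine denseRange_expSum.induction_on x (isClosed_eq (by fun_prop) (by fun_prop)) fun c => ?_
  simp only [expSum, Finsupp.linearCombination_apply, Finsupp.sum, map_sum, map_smul, inner_sum,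
    inner_smul_right, rescale_expVec hr hr1, inner_expVec, inner_smul_left, Complex.conj_ofReal]

lemma inner_rescale {r : ℝ} (hr : 0 ≤ r) (hr1 : r ≤ 1) (y x : Fock d) :
    ⟪rescale d r y, x⟫_ℂ = ⟪y, rescale d r x⟫_ℂ := by
  refine denseRange_expSum.induction_on y (isClosed_eq (by fun_prop) (by fun_prop)) fun c => ?_
  simp only [expSum, Finsupp.linearCombination_apply, Finsupp.sum, map_sum, map_smul, sum_inner,
    inner_smul_left, rescale_expVec hr hr1, inner_expVec_rescale hr hr1]

lemma rescale_crea {r : ℝ} (hr : 0 ≤ r) (hr1 : r ≤ 1) (q g : OneParticle d) :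
    rescale d r (crea q g) = (r : ℂ) • crea q ((r : ℂ) • g) := by
  refine eq_of_forall_inner_expVec fun g' => ?_
  rw [inner_expVec_rescale hr hr1, inner_smul_right, inner_expVec_crea, inner_expVec_crea,
    inner_smul_left, inner_smul_left, inner_smul_right, Complex.conj_ofReal, mul_assoc]

/-- `χ = c(q) ψ`, tested on exponential vectors. -/
def IsAnn (q : OneParticle d) (ψ χ : Fock d) : Prop :=
  ∀ g, ⟪crea q g, ψ⟫_ℂ = ⟪expVec g, χ⟫_ℂ

/-! ### Identities for the regularised operators B = r^N c(q). -/

section Lowering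

variable {q : OneParticle d} {r : ℝ} {B : Fock d →L[ℂ] Fock d}

/-- With B† = c†(q) r^N this is r^N c†(q) = r c†(q) r^N. Only the weak definition of the graph is
used, so it is valid on the maximal domain, before any core property is known. -/
lemma rescale_eq_adjoint_lowering (hr : 0 ≤ r) (hr1 : r ≤ 1)
    (hB : ∀ g, B (expVec g) = ⟪q, g⟫_ℂ • expVec ((r : ℂ) • g)) {φ η : Fock d}
    (h : (φ, η) ∈ creationGraph q) : rescale d r η = (r : ℂ) • B.adjoint φ := by
  refine eq_of_forall_inner_expVec fun g => ?_
  rw [inner_expVec_rescale hr hr1, mem_creationGraph.1 h, inner_smul_right,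
    ContinuousLinearMap.adjoint_inner_right, hB, inner_smul_left, inner_smul_left, inner_conj_symm,
    Complex.conj_ofReal, mul_assoc]

lemma adjoint_lowering_expVec (hr : 0 < r) (hr1 : r ≤ 1)
    (hB : ∀ g, B (expVec g) = ⟪q, g⟫_ℂ • expVec ((r : ℂ) • g)) (g : OneParticle d) :
    B.adjoint (expVec g) = crea q ((r : ℂ) • g) := by
  have h := rescale_eq_adjoint_lowering hr.le hr1 hB (expVec_mem_creationGraph q g)
  rw [rescale_crea hr.le hr1] at h
  exact (smul_right_injective _ (Complex.ofReal_ne_zero.2 hr.ne') h).symm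

/-- Since B† E(g) = c†(q) E(r g), testing on exponential vectors alone suffices to identify Bψ with
r^N χ. -/
lemma IsAnn.lowering_eq (hr : 0 < r) (hr1 : r ≤ 1)
    (hB : ∀ g, B (expVec g) = ⟪q, g⟫_ℂ • expVec ((r : ℂ) • g)) {ψ χ : Fock d}
    (h : IsAnn q ψ χ) : B ψ = rescale d r χ := by
  refine eq_of_forall_inner_expVec fun g => ?_
  rw [← ContinuousLinearMap.adjoint_inner_left, adjoint_lowering_expVec hr hr1 hB, h,
    inner_expVec_rescale hr.le hr1]

lemma adjoint_lowering_mem (hr : 0 ≤ r) (hr1 : r ≤ 1)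
    (hB : ∀ g, B (expVec g) = ⟪q, g⟫_ℂ • expVec ((r : ℂ) • g)) (ψ : Fock d) :
    (rescale d r ψ, B.adjoint ψ) ∈ creationGraph q := by
  rw [mem_creationGraph]
  intro g
  rw [ContinuousLinearMap.adjoint_inner_right, hB, inner_smul_left, inner_conj_symm,
    inner_expVec_rescale hr hr1]

/-- The canonical commutation relations for the regularised operators. -/
lemma norm_sq_adjoint_lowering (hr : 0 < r) (hr1 : r ≤ 1)
    (hB : ∀ g, B (expVec g) = ⟪q, g⟫_ℂ • expVec ((r : ℂ) • g)) (ψ : Fock d) :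
    ‖B.adjoint ψ‖ ^ 2 = r ^ 2 * ‖B ψ‖ ^ 2 + ‖q‖ ^ 2 * ‖rescale d r ψ‖ ^ 2 := by
  -- The operator form of the identity: moving r^N past c†(q) and c(q) costs the factor r² in front
  -- of B†B, while the commutator leaves ‖q‖² r^{2N}. It is verified on exponential vectors with
  -- `inner_crea_crea`.
  have h1 : B ∘L B.adjoint = ((r ^ 2 : ℝ) : ℂ) • (B.adjoint ∘L B) +
      ((‖q‖ ^ 2 : ℝ) : ℂ) • (rescale d r ∘L rescale d r) := by
    ext x
    refine denseRange_expSum.induction_on x (isClosed_eq (by fun_prop) (by fun_prop)) fun c => ?_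
    refine eq_of_forall_inner_expVec fun g => ?_
    simp only [expSum, Finsupp.linearCombination_apply, Finsupp.sum, map_sum, map_smul, inner_sum,
      inner_smul_right]
    refine Finset.sum_congr rfl fun f _ => ?_
    congr 1
    simp only [ContinuousLinearMap.comp_apply, add_apply,
      smul_apply, inner_add_right, inner_smul_right]
    rw [← ContinuousLinearMap.adjoint_inner_left, adjoint_lowering_expVec hr hr1 hB,
      adjoint_lowering_expVec hr hr1 hB, inner_crea_crea, ContinuousLinearMap.adjoint_inner_right,
      hB, hB, rescale_expVec hr.le hr1, inner_expVec_rescale hr.le hr1]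
    simp only [inner_smul_left, inner_smul_right, inner_expVec, inner_conj_symm,
      Complex.conj_ofReal]
    push_cast
    ring
  have h2 : ⟪ψ, (B ∘L B.adjoint) ψ⟫_ℂ = ((‖B.adjoint ψ‖ ^ 2 : ℝ) : ℂ) := by
    rw [ContinuousLinearMap.comp_apply, ← ContinuousLinearMap.adjoint_inner_left,
      inner_self_eq_ofReal]
  rw [h1] at h2
  simp only [ContinuousLinearMap.comp_apply, add_apply,
      smul_apply, inner_add_right, inner_smul_right,
      ContinuousLinearMap.adjoint_inner_right] at h2
  rw [← inner_rescale hr.le hr1, inner_self_eq_ofReal, inner_self_eq_ofReal] at h2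
  exact_mod_cast h2.symm

end Lowering

/-! ### The limit r → 1: core property and domains. -/

lemma eventually_mem_Ioo_nhdsLT_one : ∀ᶠ r : ℝ in 𝓝[<] 1, 0 < r ∧ r < 1 := by
  filter_upwards [self_mem_nhdsWithin, mem_nhdsWithin_of_mem_nhds
    (lt_mem_nhds (zero_lt_one (α := ℝ)))] with r h1 h2
  exact ⟨h2, h1⟩

lemma tendsto_ofReal_nhdsLT_one : Tendsto (fun r : ℝ => (r : ℂ)) (𝓝[<] 1) (𝓝 1) := by
  have h := Complex.continuous_ofReal.tendsto 1
  rw [Complex.ofReal_one] at h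
  exact h.mono_left nhdsWithin_le_nhds

/-- The span of the exponential vectors is a core of the creation operators. -/
lemma IsAnn.inner_eq {q : OneParticle d} {ψ χ φ η : Fock d} (h : IsAnn q ψ χ)
    (hφ : (φ, η) ∈ creationGraph q) : ⟪η, ψ⟫_ℂ = ⟪φ, χ⟫_ℂ := by
  have h1 : Tendsto (fun r => ⟪rescale d r η, ψ⟫_ℂ) (𝓝[<] 1) (𝓝 ⟪η, ψ⟫_ℂ) :=
    (tendsto_rescale η).inner tendsto_const_nhds
  have h2 : Tendsto (fun r : ℝ => (r : ℂ) * ⟪φ, rescale d r χ⟫_ℂ) (𝓝[<] 1)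
      (𝓝 (1 * ⟪φ, χ⟫_ℂ)) :=
    tendsto_ofReal_nhdsLT_one.mul (tendsto_const_nhds.inner (tendsto_rescale χ))
  rw [one_mul] at h2
  refine tendsto_nhds_unique (h1.congr' ?_) h2
  filter_upwards [eventually_mem_Ioo_nhdsLT_one] with r hr
  obtain ⟨B, hB⟩ := exists_lowering q hr.1.le hr.2
  rw [rescale_eq_adjoint_lowering hr.1.le hr.2.le hB hφ, inner_smul_left, Complex.conj_ofReal,
    ContinuousLinearMap.adjoint_inner_left, h.lowering_eq hr.1 hr.2.le hB]

/-- The domain of the annihilation operator is contained in that of the creation operator, and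
`‖c†(q) ψ‖² = ‖c(q) ψ‖² + ‖q‖² ‖ψ‖²`. -/
lemma IsAnn.exists_creation {q : OneParticle d} {ψ χ : Fock d} (h : IsAnn q ψ χ) :
    ∃ η, (ψ, η) ∈ creationGraph q ∧ ‖η‖ ^ 2 = ‖χ‖ ^ 2 + ‖q‖ ^ 2 * ‖ψ‖ ^ 2 := by
  set M := √(‖χ‖ ^ 2 + ‖q‖ ^ 2 * ‖ψ‖ ^ 2) with hM
  -- Candidate for φ ↦ ⟨c†(q)ψ, φ⟩ on the exponential span. With ψ replaced by r^N ψ it is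
  -- represented by B†ψ, whose norm is at most M by the commutation relation, uniformly in r; the
  -- limit r → 1 keeps the bound.
  have hF : ∀ c : OneParticle d →₀ ℂ, ‖Finsupp.linearCombination ℂ
      (fun g : OneParticle d => ⟪q, g⟫_ℂ * ⟪ψ, expVec g⟫_ℂ) c‖ ≤ M * ‖expSum d c‖ := by
    intro c
    have h1 : Tendsto (fun r => ‖Finsupp.linearCombination ℂ
      (fun g : OneParticle d => ⟪q, g⟫_ℂ * ⟪rescale d r ψ, expVec g⟫_ℂ) c‖) (𝓝[<] 1)
      (𝓝 ‖Finsupp.linearCombination ℂ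
      (fun g : OneParticle d => ⟪q, g⟫_ℂ * ⟪ψ, expVec g⟫_ℂ) c‖) := by
      simp only [Finsupp.linearCombination_apply, Finsupp.sum]
      refine (tendsto_finsetSum _ fun g _ => Tendsto.const_smul (Tendsto.const_mul _ ?_) _).norm
      exact (tendsto_rescale ψ).inner tendsto_const_nhds
    refine le_of_tendsto h1 ?_
    filter_upwards [eventually_mem_Ioo_nhdsLT_one] with r hr
    obtain ⟨B, hB⟩ := exists_lowering q hr.1.le hr.2
    have h2 : Finsupp.linearCombination ℂ
      (fun g : OneParticle d => ⟪q, g⟫_ℂ * ⟪rescale d r ψ, expVec g⟫_ℂ) c =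
        ⟪B.adjoint ψ, expSum d c⟫_ℂ := by
      have h3 := mem_creationGraph.1 (adjoint_lowering_mem hr.1.le hr.2.le hB ψ)
      have h4 : ∀ g, ⟪q, g⟫_ℂ * ⟪rescale d r ψ, expVec g⟫_ℂ = ⟪B.adjoint ψ, expVec g⟫_ℂ := by
        intro g
        rw [← inner_conj_symm (B.adjoint ψ), h3 g, map_mul, inner_conj_symm, inner_conj_symm]
      simp only [expSum, Finsupp.linearCombination_apply, Finsupp.sum, inner_sum,
        inner_smul_right, h4, smul_eq_mul]
    rw [h2]
    refine (norm_inner_le_norm _ _).trans ?_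
    gcongr
    rw [hM]
    refine Real.le_sqrt_of_sq_le ?_
    rw [norm_sq_adjoint_lowering hr.1 hr.2.le hB, h.lowering_eq hr.1 hr.2.le hB]
    have h5 := norm_rescale_le hr.1.le hr.2.le χ
    have h6 := norm_rescale_le hr.1.le hr.2.le ψ
    have h7 : r ^ 2 ≤ 1 := pow_le_one₀ hr.1.le hr.2.le
    gcongr
    calc r ^ 2 * ‖rescale d r χ‖ ^ 2 ≤ 1 * ‖χ‖ ^ 2 := by gcongr
      _ = _ := one_mul _
  obtain ⟨L, hL, -⟩ := exists_clm_expVec _ M hF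
  -- The Riesz representative of the extended functional is the required value c†(q)ψ.
  set η := (InnerProductSpace.toDual ℂ (Fock d)).symm L with hη
  have hmem : (ψ, η) ∈ creationGraph q := by
    rw [mem_creationGraph]
    intro g
    rw [← inner_conj_symm, hη, InnerProductSpace.toDual_symm_apply, hL, map_mul, inner_conj_symm,
      inner_conj_symm]
  refine ⟨η, hmem, ?_⟩
  -- The bound M only gives an inequality. The exact norm follows from r^N η = r B†ψ by passing to
  -- the limit on both sides.
  have h1 : Tendsto (fun r => ‖rescale d r η‖ ^ 2) (𝓝[<] 1) (𝓝 (‖η‖ ^ 2)) :=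
    (tendsto_rescale η).norm.pow 2
  have hid : Tendsto (fun r : ℝ => r) (𝓝[<] 1) (𝓝 1) := tendsto_id.mono_left nhdsWithin_le_nhds
  have h2 : Tendsto (fun r : ℝ => r ^ 2 * (r ^ 2 * ‖rescale d r χ‖ ^ 2 +
      ‖q‖ ^ 2 * ‖rescale d r ψ‖ ^ 2)) (𝓝[<] 1)
      (𝓝 (1 ^ 2 * (1 ^ 2 * ‖χ‖ ^ 2 + ‖q‖ ^ 2 * ‖ψ‖ ^ 2))) :=
    (hid.pow 2).mul (((hid.pow 2).mul ((tendsto_rescale χ).norm.pow 2)).add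
      (((tendsto_rescale ψ).norm.pow 2).const_mul _))
  rw [one_pow, one_mul, one_mul] at h2
  refine tendsto_nhds_unique (h1.congr' ?_) h2
  filter_upwards [eventually_mem_Ioo_nhdsLT_one] with r hr
  obtain ⟨B, hB⟩ := exists_lowering q hr.1.le hr.2
  rw [rescale_eq_adjoint_lowering hr.1.le hr.2.le hB hmem, norm_smul, mul_pow, Complex.norm_real,
    Real.norm_of_nonneg hr.1.le, norm_sq_adjoint_lowering hr.1 hr.2.le hB,
    h.lowering_eq hr.1 hr.2.le hB]

lemma creation_apply_of_mem {q : OneParticle d} {ψ η : Fock d} (h : (ψ, η) ∈ creationGraph q) :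
    ∃ hψ : ψ ∈ (creation q).domain, creation q ⟨ψ, hψ⟩ = η := by
  have h1 : (ψ, η) ∈ (creation q).graph := by
    rwa [creation, Submodule.toLinearPMap_graph_eq _ (creationGraph_isGraph q)]
  obtain ⟨y, rfl, h3⟩ := (LinearPMap.mem_graph_iff _).1 h1
  exact ⟨y.2, h3⟩

lemma mem_creationGraph_apply {q : OneParticle d} (x : (creation q).domain) :
    ((x : Fock d), creation q x) ∈ creationGraph q :=
  Submodule.mem_graph_toLinearPMap (creationGraph_isGraph q) x

/-- The adjoint is taken of the operator on its maximal domain, so testing on exponential vectors is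
not enough by itself; `IsAnn.inner_eq` extends the relation to every vector of that domain. -/
lemma IsAnn.annihilation_apply {q : OneParticle d} {ψ χ : Fock d} (h : IsAnn q ψ χ) :
    ∃ hψ : ψ ∈ (annihilation q).domain, annihilation q ⟨ψ, hψ⟩ = χ := by
  have h1 : ∀ x : (creation q).domain, ⟪χ, (x : Fock d)⟫_ℂ = ⟪ψ, creation q x⟫_ℂ := by
    intro x
    rw [← inner_conj_symm, ← h.inner_eq (mem_creationGraph_apply x), inner_conj_symm]
  have h2 : ψ ∈ (annihilation q).domain :=
    LinearPMap.mem_adjoint_domain_of_exists _ ⟨χ, h1⟩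
  exact ⟨h2, LinearPMap.adjoint_apply_eq (dense_creation_domain q) ⟨ψ, h2⟩ h1⟩

lemma IsAnn.opApply_annihilation {q : OneParticle d} {ψ χ : Fock d} (h : IsAnn q ψ χ) :
    opApply (annihilation q) ψ = χ := by
  obtain ⟨h1, h2⟩ := h.annihilation_apply
  rw [opApply, dif_pos h1, h2]

/-- `c(q) + c†(q)` on the domain of the annihilation operator. -/
lemma IsAnn.add_apply {q : OneParticle d} {ψ χ η : Fock d} (h : IsAnn q ψ χ)
    (hη : (ψ, η) ∈ creationGraph q) :
    ∃ hψ : ψ ∈ (creation q + annihilation q).domain,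
      (creation q + annihilation q) ⟨ψ, hψ⟩ = η + χ := by
  obtain ⟨h1, h2⟩ := h.annihilation_apply
  obtain ⟨h3, h4⟩ := creation_apply_of_mem hη
  refine ⟨⟨h3, h1⟩, ?_⟩
  rw [LinearPMap.add_apply, ← h2, ← h4]

end Operators

section Tensor

variable {H : Type*} [NormedAddCommGroup H] [InnerProductSpace ℂ H] {d : ℕ}

/-! ### The tensor product of system and fields -/

/-- The elementary tensor `u ⊗ φ` in the completed tensor product. -/
def tens (u : H) (φ : Fock d) : SysFock H d := toSysFock H d (u ⊗ₜ[ℂ] φ)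

lemma tensorLeft_apply (u : H) (φ : Fock d) : tensorLeft u φ = tens u φ := rfl

lemma tensorRight_apply (u : H) (φ : Fock d) : tensorRight φ u = tens u φ := rfl

lemma tensorCoherent_eq (u : H) (f : OneParticle d) : tensorCoherent u f = tens u (coherent f) := rfl

lemma inner_tens (u v : H) (φ ψ : Fock d) :
    ⟪tens u φ, tens v ψ⟫_ℂ = ⟪u, v⟫_ℂ * ⟪φ, ψ⟫_ℂ := by
  rw [tens, tens, LinearIsometry.inner_map_map, TensorProduct.inner_tmul]

lemma norm_tens (u : H) (φ : Fock d) : ‖tens u φ‖ = ‖u‖ * ‖φ‖ := by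
  rw [tens, LinearIsometry.norm_map, TensorProduct.norm_tmul]

lemma tens_smul_right (c : ℂ) (u : H) (φ : Fock d) : tens u (c • φ) = c • tens u φ :=
  map_smul (tensorLeft u) c φ

lemma denseRange_toSysFock : DenseRange (toSysFock H d) := UniformSpace.Completion.denseRange_coe

lemma eq_of_forall_inner_tens {Φ Ψ : SysFock H d}
    (h : ∀ u φ, ⟪tens u φ, Φ⟫_ℂ = ⟪tens u φ, Ψ⟫_ℂ) : Φ = Ψ := by
  have h1 : ∀ x : SysFock H d, ⟪x, Φ⟫_ℂ = ⟪x, Ψ⟫_ℂ := by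
    intro x
    refine denseRange_toSysFock.induction_on x (isClosed_eq (by fun_prop) (by fun_prop)) fun y => ?_
    induction y using TensorProduct.induction_on with
    | zero => simp
    | tmul u φ => exact h u φ
    | add a b ha hb => rw [map_add, inner_add_left, inner_add_left, ha, hb]
  exact ext_inner_left ℂ h1

lemma eq_of_forall_inner_tens_expVec {Φ Ψ : SysFock H d}
    (h : ∀ u g, ⟪tens u (expVec g), Φ⟫_ℂ = ⟪tens u (expVec g), Ψ⟫_ℂ) : Φ = Ψ := by
  refine eq_of_forall_inner_tens fun u φ => ?_
  have h1 : (tensorLeft u).adjoint Φ = (tensorLeft u).adjoint Ψ := by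
    refine eq_of_forall_inner_expVec fun g => ?_
    rw [ContinuousLinearMap.adjoint_inner_right, ContinuousLinearMap.adjoint_inner_right]
    exact h u g
  rw [← tensorLeft_apply, ← ContinuousLinearMap.adjoint_inner_right, h1,
    ContinuousLinearMap.adjoint_inner_right]

variable [CompleteSpace H]

lemma topologicalClosure_span_tens_expVec :
    (Submodule.span ℂ {x : SysFock H d | ∃ u g, x = tens u (expVec g)}).topologicalClosure = ⊤ := by
  rw [Submodule.topologicalClosure_eq_top_iff, Submodule.eq_bot_iff]
  intro Ψ hΨ
  refine eq_of_forall_inner_tens_expVec fun u g => ?_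
  rw [inner_zero_right]
  exact (Submodule.mem_orthogonal _ _).1 hΨ _ (Submodule.subset_span ⟨u, g, rfl⟩)

/-- Continuous linear maps on the completed tensor product which agree on the vectors `u ⊗ E(g)`
are equal. -/
lemma clm_ext_tens_expVec {Y : Type*} [NormedAddCommGroup Y] [NormedSpace ℂ Y]
    {A B : SysFock H d →L[ℂ] Y} (h : ∀ u g, A (tens u (expVec g)) = B (tens u (expVec g))) :
    A = B := by
  refine ContinuousLinearMap.ext_on (s := {x : SysFock H d | ∃ u g, x = tens u (expVec g)}) ?_ ?_
  · exact Submodule.dense_iff_topologicalClosure_eq_top.2 topologicalClosure_span_tens_expVec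
  · rintro _ ⟨u, g, rfl⟩
    exact h u g

lemma adjoint_tensorRight_tens (v : H) (ψ φ : Fock d) :
    (tensorRight ψ).adjoint (tens v φ) = ⟪ψ, φ⟫_ℂ • v := by
  refine ext_inner_left ℂ fun χ => ?_
  rw [ContinuousLinearMap.adjoint_inner_right, tensorRight_apply, inner_tens, inner_smul_right,
    mul_comm]

/-- Parseval's identity for the slices of a vector of the tensor product. -/
lemma hasSum_norm_sq_slice {ι : Type*} (b : HilbertBasis ι ℂ H) (Ψ : SysFock H d) :
    HasSum (fun i => ‖(tensorLeft (b i)).adjoint Ψ‖ ^ 2) (‖Ψ‖ ^ 2) := by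
  classical
  set V : ι → Fock d →ₗᵢ[ℂ] SysFock H d := fun i =>
    ⟨(tensorLeft (b i)).toLinearMap, fun φ => by
      change ‖tens (b i) φ‖ = ‖φ‖
      rw [norm_tens, b.orthonormal.1 i, one_mul]⟩ with hV
  have hVa : ∀ i φ, V i φ = tens (b i) φ := fun i φ => rfl
  have hO : OrthogonalFamily ℂ (fun _ : ι => Fock d) V := by
    intro i j hij φ ψ
    rw [hVa, hVa, inner_tens, b.orthonormal.2 hij, zero_mul]
  -- The subspaces b_i ⊗ Γ are orthogonal and total. The i-th coordinate of Ψ in this Hilbert sum is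
  -- its slice along b_i, so Parseval's identity applies.
  have hS : IsHilbertSum ℂ (fun _ : ι => Fock d) V := by
    refine IsHilbertSum.mk hO ?_
    rw [top_le_iff, Submodule.topologicalClosure_eq_top_iff, Submodule.eq_bot_iff]
    intro Φ hΦ
    refine eq_of_forall_inner_tens fun u φ => ?_
    have h1 : (tensorRight φ).adjoint Φ = 0 := by
      refine b.repr.injective (Subtype.ext (funext fun i => ?_))
      rw [HilbertBasis.repr_apply_apply, ContinuousLinearMap.adjoint_inner_right, map_zero]
      exact (Submodule.mem_orthogonal _ _).1 hΦ _ (Submodule.mem_iSup_of_mem i ⟨φ, rfl⟩)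
    rw [← tensorRight_apply, ← ContinuousLinearMap.adjoint_inner_right, h1, inner_zero_right,
      inner_zero_right]
  have h2 : ∀ i, hS.linearIsometryEquiv Ψ i = (tensorLeft (b i)).adjoint Ψ := by
    intro i
    refine ext_inner_left ℂ fun φ => ?_
    rw [ContinuousLinearMap.adjoint_inner_right]
    refine (lp.inner_single_left (𝕜 := ℂ) (G := fun _ : ι => Fock d) i φ _).symm.trans ?_
    rw [← hS.linearIsometryEquiv.symm.inner_map_map, LinearIsometryEquiv.symm_apply_apply,
      hS.linearIsometryEquiv_symm_apply_single]
    rfl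
  have h3 := lp.hasSum_inner (𝕜 := ℂ) (hS.linearIsometryEquiv Ψ) (hS.linearIsometryEquiv Ψ)
  rw [LinearIsometryEquiv.inner_map_map] at h3
  simp_rw [h2, inner_self_eq_ofReal] at h3
  exact Complex.hasSum_ofReal.1 h3

/-! ### Amplification of system operators -/

/-- For a unitary factor the amplification is isometric on the algebraic tensor product. A bounded
operator is a combination of four unitaries, which bounds R ⊗ 1 and lets it extend to the
completion. -/
lemma exists_ampl (R : H →L[ℂ] H) :
    ∃ A : SysFock H d →L[ℂ] SysFock H d, ∀ u φ, A (tens u φ) = tens (R u) φ := by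
  obtain ⟨V, c, hR, -⟩ := CStarAlgebra.exists_sum_four_unitary R
  set f : H ⊗[ℂ] Fock d →ₗ[ℂ] SysFock H d :=
    ∑ i, c i • (toSysFock H d).toLinearMap ∘ₗ (TensorProduct.mapIsometry
      (Unitary.linearIsometryEquiv (V i)).toLinearIsometry LinearIsometry.id).toLinearMap with hf
  have hbd : ∀ x, ‖f x‖ ≤ (∑ i, ‖c i‖) * ‖toSysFock H d x‖ := by
    intro x
    rw [hf, LinearMap.sum_apply, Finset.sum_mul]
    refine norm_sum_le_of_le _ fun i _ => ?_
    rw [LinearMap.smul_apply, norm_smul, LinearMap.comp_apply]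
    refine le_of_eq ?_
    congr 1
    change ‖toSysFock H d (TensorProduct.mapIsometry _ _ x)‖ = _
    rw [LinearIsometry.norm_map, LinearIsometry.norm_map, LinearIsometry.norm_map]
  refine ⟨f.extendOfNorm (toSysFock H d).toLinearMap, fun u φ => ?_⟩
  have h := LinearMap.extendOfNorm_eq (f := f) (e := (toSysFock H d).toLinearMap)
    denseRange_toSysFock ⟨_, hbd⟩ (u ⊗ₜ φ)
  refine h.trans ?_
  rw [hf, LinearMap.sum_apply, hR, sum_apply, ← tensorRight_apply, map_sum]
  refine Finset.sum_congr rfl fun i _ => ?_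
  exact (map_smul (tensorRight φ) (c i) ((V i : H →L[ℂ] H) u)).symm

/-- The operator `R ⊗ 1`. -/
def ampl (d : ℕ) (R : H →L[ℂ] H) : SysFock H d →L[ℂ] SysFock H d := (exists_ampl R).choose

lemma ampl_tens (R : H →L[ℂ] H) (u : H) (φ : Fock d) : ampl d R (tens u φ) = tens (R u) φ :=
  (exists_ampl R).choose_spec u φ

lemma adjoint_tensorRight_ampl (R : H →L[ℂ] H) (φ : Fock d) (Ψ : SysFock H d) :
    (tensorRight φ).adjoint (ampl d R Ψ) = R ((tensorRight φ).adjoint Ψ) := by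
  have h : (tensorRight φ).adjoint ∘L ampl d R = R ∘L (tensorRight φ).adjoint := by
    refine clm_ext_tens_expVec fun u g => ?_
    rw [ContinuousLinearMap.comp_apply, ContinuousLinearMap.comp_apply, ampl_tens,
      adjoint_tensorRight_tens, adjoint_tensorRight_tens, map_smul]
  exact DFunLike.congr_fun h Ψ

end Tensor

/-! ### An integral Gronwall lemma and the change of order of integration on a triangle -/

/-- Gronwall's lemma with an integrable coefficient. -/
lemma nonpos_of_le_integral_mul {l z : ℝ → ℝ} {T : ℝ}
    (hl : IntervalIntegrable l volume 0 T) (hl0 : ∀ t, 0 ≤ l t) (hz0 : ∀ t, 0 ≤ z t)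
    (hlz : IntervalIntegrable (fun t => l t * z t) volume 0 T)
    (h : ∀ t ∈ Set.Icc 0 T, z t ≤ ∫ s in (0 : ℝ)..t, l s * z s) :
    ∀ t ∈ Set.Icc 0 T, z t ≤ 0 := by
  set w : ℝ → ℝ := fun t => ∫ s in (0 : ℝ)..t, l s * z s with hw
  rcases lt_or_ge T 0 with hT | hT
  · intro t ht
    exact absurd (ht.1.trans ht.2) (not_le.2 hT)
  have hsub : ∀ {a b : ℝ}, a ∈ Set.Icc 0 T → b ∈ Set.Icc 0 T → Set.uIcc a b ⊆ Set.uIcc 0 T := by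
    intro a b ha hb
    rw [Set.uIcc_of_le hT]
    exact Set.uIcc_subset_Icc ha hb
  have h0 : (0 : ℝ) ∈ Set.Icc 0 T := ⟨le_rfl, hT⟩
  have hwc : ContinuousOn w (Set.Icc 0 T) := by
    have := intervalIntegral.continuousOn_primitive_interval' hlz Set.left_mem_uIcc
    rwa [Set.uIcc_of_le hT] at this
  have hLc : ContinuousOn (fun t => ∫ s in (0 : ℝ)..t, l s) (Set.Icc 0 T) := by
    have := intervalIntegral.continuousOn_primitive_interval' hl Set.left_mem_uIcc
    rwa [Set.uIcc_of_le hT] at this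
  -- Continuous induction for the increasing primitive w. If w vanishes at x, choose t > x with ∫ₓᵗ
  -- l ≤ 1/2; then w(t) ≤ (∫ₓᵗ l) w(t) ≤ w(t)/2 forces w(t) = 0.
  have hkey : Set.Icc 0 T ⊆ {t | w t = 0} := by
    refine IsClosed.Icc_subset_of_forall_exists_gt ?_ ?_ ?_
    · rw [Set.inter_comm]
      exact hwc.preimage_isClosed_of_isClosed isClosed_Icc isClosed_singleton
    · exact intervalIntegral.integral_same
    · rintro x ⟨hx0, hx⟩ y hy
      have hxI : x ∈ Set.Icc 0 T := ⟨hx.1, hx.2.le⟩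
      have h1 : Tendsto (fun t => ∫ s in (0 : ℝ)..t, l s) (𝓝[Set.Icc 0 T] x)
          (𝓝 (∫ s in (0 : ℝ)..x, l s)) := hLc x hxI
      have h2 : ∀ᶠ t in 𝓝[>] x, (∫ s in (0 : ℝ)..t, l s) < (∫ s in (0 : ℝ)..x, l s) + 1 / 2 := by
        refine (h1.mono_left ?_).eventually_lt_const (by linarith)
        rw [← nhdsWithin_Ioc_eq_nhdsGT hx.2]
        exact nhdsWithin_mono _ fun t ht => ⟨hx.1.trans ht.1.le, ht.2⟩
      obtain ⟨t, ht1, ht2⟩ := (h2.and (Ioc_mem_nhdsGT (lt_min hy hx.2))).exists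
      have htI : t ∈ Set.Icc 0 T := ⟨hx.1.trans ht2.1.le, ht2.2.trans (min_le_right _ _)⟩
      refine ⟨t, ?_, ht2.1, ht2.2.trans (min_le_left _ _)⟩
      have h3 : w t = ∫ s in x..t, l s * z s := by
        have := intervalIntegral.integral_add_adjacent_intervals
          (hlz.mono_set (hsub h0 hxI)) (hlz.mono_set (hsub hxI htI))
        change w x + _ = w t at this
        rw [← this, hx0, zero_add]
      have h4 : ∀ s ∈ Set.Icc x t, z s ≤ w t := by
        intro s hs
        have hsI : s ∈ Set.Icc 0 T := ⟨hx.1.trans hs.1, hs.2.trans htI.2⟩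
        refine (h s hsI).trans ?_
        refine intervalIntegral.integral_mono_interval le_rfl hsI.1 hs.2 ?_
          (hlz.mono_set (hsub h0 htI))
        exact Eventually.of_forall fun r => mul_nonneg (hl0 r) (hz0 r)
      have h5 : w t ≤ (∫ s in x..t, l s) * w t := by
        rw [← intervalIntegral.integral_mul_const]
        refine h3.le.trans ?_
        refine intervalIntegral.integral_mono_on ht2.1.le (hlz.mono_set (hsub hxI htI))
          ((hl.mono_set (hsub hxI htI)).mul_const _) fun s hs => ?_
        exact mul_le_mul_of_nonneg_left (h4 s hs) (hl0 s)
      have h6 : ∫ s in x..t, l s ≤ 1 / 2 := by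
        have := intervalIntegral.integral_add_adjacent_intervals
          (hl.mono_set (hsub h0 hxI)) (hl.mono_set (hsub hxI htI))
        linarith
      have h7 : 0 ≤ w t := (hz0 x).trans (h4 x ⟨le_rfl, ht2.1.le⟩)
      change w t = 0
      nlinarith
  intro t ht
  exact (h t ht).trans (hkey ht).le

lemma integral_triangle_swap {X : Type*} [NormedAddCommGroup X] [NormedSpace ℝ X]
    {F : ℝ → ℝ → X} {T : ℝ} (hT : 0 ≤ T)
    (hF : Integrable (Function.uncurry F)
      ((volume.restrict (Set.Ioc 0 T)).prod (volume.restrict (Set.Ioc 0 T)))) :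
    ∫ s in (0 : ℝ)..T, ∫ r in s..T, F s r = ∫ r in (0 : ℝ)..T, ∫ s in (0 : ℝ)..r, F s r := by
  have hG : Integrable (Function.uncurry fun s r => (Set.Ioi s).indicator (F s) r)
      ((volume.restrict (Set.Ioc 0 T)).prod (volume.restrict (Set.Ioc 0 T))) := by
    have hm : MeasurableSet {p : ℝ × ℝ | p.1 < p.2} := measurableSet_lt measurable_fst measurable_snd
    refine (hF.indicator hm).congr (Eventually.of_forall fun p => ?_)
    by_cases hp : p.1 < p.2
    · rw [Set.indicator_of_mem (by exact hp)]
      exact (Set.indicator_of_mem (s := Set.Ioi p.1) hp _).symm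
    · rw [Set.indicator_of_notMem (by exact hp)]
      exact (Set.indicator_of_notMem (s := Set.Ioi p.1) hp _).symm
  have hswap := integral_integral_swap hG
  rw [intervalIntegral.integral_of_le hT, intervalIntegral.integral_of_le hT]
  convert hswap using 1
  · refine setIntegral_congr_fun measurableSet_Ioc fun s hs => ?_
    rw [setIntegral_indicator measurableSet_Ioi, intervalIntegral.integral_of_le hs.2]
    congr 2
    ext r
    simp only [Set.mem_Ioc, Set.mem_inter_iff, Set.mem_Ioi]
    constructor
    · rintro ⟨h1, h2⟩
      exact ⟨⟨hs.1.trans h1, h2⟩, h1⟩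
    · rintro ⟨⟨-, h2⟩, h1⟩
      exact ⟨h1, h2⟩
  · refine setIntegral_congr_fun measurableSet_Ioc fun r hr => ?_
    have h1 : ∀ s, (Set.Ioi s).indicator (F s) r = (Set.Iio r).indicator (fun s => F s r) s := by
      intro s
      by_cases h : s < r
      · rw [Set.indicator_of_mem (s := Set.Ioi s) h, Set.indicator_of_mem (s := Set.Iio r) h]
      · rw [Set.indicator_of_notMem (s := Set.Ioi s) h, Set.indicator_of_notMem (s := Set.Iio r) h]
    simp_rw [h1]
    rw [setIntegral_indicator measurableSet_Iio, intervalIntegral.integral_of_le hr.1.le,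
      integral_Ioc_eq_integral_Ioo]
    congr 2
    ext s
    simp only [Set.mem_Ioo, Set.mem_inter_iff, Set.mem_Iio, Set.mem_Ioc]
    constructor
    · rintro ⟨h1, h2⟩
      exact ⟨⟨h1, (h2.trans_le hr.2).le⟩, h2⟩
    · rintro ⟨⟨h2, -⟩, h1⟩
      exact ⟨h2, h1⟩

/-! ### Components of one-particle vectors and restrictions to time sets -/

section OneParticle

variable {d : ℕ}

lemma ae_forall_channel {P : Label d → Prop} (h : ∀ᵐ x ∂(labelMeasure d), P x) :
    ∀ᵐ s : ℝ, ∀ k : Fin d, P (s, k) := by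
  have h1 := Measure.ae_ae_of_ae_prod h
  filter_upwards [h1] with s hs
  exact Measure.ae_count_iff.1 hs

lemma eLpNorm_channel_le (p : OneParticle d) (k : Fin d) :
    eLpNorm (fun s : ℝ => p (s, k)) 2 volume ≤ eLpNorm p 2 (labelMeasure d) := by
  rw [eLpNorm_eq_lintegral_rpow_enorm_toReal (by norm_num) (by norm_num),
    eLpNorm_eq_lintegral_rpow_enorm_toReal (by norm_num) (by norm_num)]
  refine ENNReal.rpow_le_rpow ?_ (by norm_num)
  have hm : Measurable fun x : Label d => ‖p x‖ₑ ^ (2 : ENNReal).toReal :=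
    ((Lp.stronglyMeasurable p).enorm).pow_const _
  have h1 : ∫⁻ x, ‖p x‖ₑ ^ (2 : ENNReal).toReal ∂(labelMeasure d) =
      ∫⁻ s, ∫⁻ k, ‖p (s, k)‖ₑ ^ (2 : ENNReal).toReal ∂Measure.count := lintegral_prod _ hm.aemeasurable
  rw [h1]
  refine lintegral_mono fun s => ?_
  rw [lintegral_count]
  exact ENNReal.le_tsum k

lemma memLp_channel (p : OneParticle d) (k : Fin d) : MemLp (fun s : ℝ => p (s, k)) 2 volume := by
  refine ⟨((Lp.stronglyMeasurable p).comp_measurable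
    (measurable_id.prodMk measurable_const)).aestronglyMeasurable, ?_⟩
  exact (eLpNorm_channel_le p k).trans_lt (Lp.memLp p).2

lemma intervalIntegrable_channel (p : OneParticle d) (k : Fin d) (a b : ℝ) :
    IntervalIntegrable (fun s : ℝ => p (s, k)) volume a b :=
  (((memLp_channel p k).locallyIntegrable (by norm_num)).integrableOn_isCompact
    isCompact_uIcc).intervalIntegrable

lemma intervalIntegrable_conj_channel (p : OneParticle d) (k : Fin d) (a b : ℝ) :
    IntervalIntegrable (fun s : ℝ => conj (p (s, k))) volume a b :=
  (((memLp_channel p k).star.locallyIntegrable (by norm_num)).integrableOn_isCompact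
    isCompact_uIcc).intervalIntegrable

/-- Cauchy–Schwarz on [0, T]. The linear dependence on ‖p‖ is what later makes the output
annihilation vectors bounded in the mode. -/
lemma integral_norm_channel_le (p : OneParticle d) (k : Fin d) {T : ℝ} (hT : 0 ≤ T) :
    ∫ s in (0 : ℝ)..T, ‖p (s, k)‖ ≤ √T * ‖p‖ := by
  rw [intervalIntegral.integral_of_le hT]
  set ν := (volume : Measure ℝ).restrict (Set.Ioc 0 T) with hν
  have hm : AEStronglyMeasurable (fun s : ℝ => p (s, k)) ν := (memLp_channel p k).1.restrict
  have h1 := eLpNorm_le_eLpNorm_mul_rpow_measure_univ (μ := ν) (p := 1) (q := 2) (by norm_num) hm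
  have h2 : eLpNorm (fun s : ℝ => p (s, k)) 2 ν ≤ eLpNorm p 2 (labelMeasure d) :=
    (eLpNorm_mono_measure _ Measure.restrict_le_self).trans (eLpNorm_channel_le p k)
  have h3 : ν Set.univ = ENNReal.ofReal T := by
    rw [hν, Measure.restrict_apply_univ, Real.volume_Ioc, sub_zero]
  have h4 : eLpNorm (fun s : ℝ => p (s, k)) 1 ν ≤ ENNReal.ofReal (√T * ‖p‖) := by
    refine h1.trans ?_
    rw [h3, mul_comm √T, ENNReal.ofReal_mul (norm_nonneg _), Lp.norm_def,
      ENNReal.ofReal_toReal (Lp.memLp p).2.ne]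
    refine mul_le_mul' h2 ?_
    rw [Real.sqrt_eq_rpow, ← ENNReal.ofReal_rpow_of_nonneg hT (by norm_num)]
    norm_num
  rw [eLpNorm_one_eq_lintegral_enorm] at h4
  rw [integral_norm_eq_lintegral_enorm hm]
  exact ENNReal.toReal_le_of_le_ofReal (by positivity) h4

variable {A : Set ℝ} (hA : MeasurableSet A)

lemma coeFn_restrict (f : OneParticle d) :
    restrict A hA f =ᵐ[labelMeasure d] Set.indicator (Prod.fst ⁻¹' A : Set (Label d)) f :=
  ((Lp.memLp f).indicator (measurable_fst hA)).coeFn_toLp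

lemma restrict_add (f g : OneParticle d) :
    restrict A hA (f + g) = restrict A hA f + restrict A hA g := by
  refine Lp.ext ?_
  filter_upwards [coeFn_restrict hA f, coeFn_restrict hA g, coeFn_restrict hA (f + g),
    Lp.coeFn_add f g, Lp.coeFn_add (restrict A hA f) (restrict A hA g)] with x h1 h2 h3 h4 h5
  rw [h3, h5, Pi.add_apply, h1, h2]
  by_cases h : x ∈ (Prod.fst ⁻¹' A : Set (Label d))
  · rw [Set.indicator_of_mem h, Set.indicator_of_mem h, Set.indicator_of_mem h, h4, Pi.add_apply]
  · rw [Set.indicator_of_notMem h, Set.indicator_of_notMem h, Set.indicator_of_notMem h, add_zero]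

lemma restrict_restrict_self (f : OneParticle d) :
    restrict A hA (restrict A hA f) = restrict A hA f := by
  refine Lp.ext ?_
  filter_upwards [coeFn_restrict hA f, coeFn_restrict hA (restrict A hA f)] with x h1 h2
  rw [h2]
  by_cases h : x ∈ (Prod.fst ⁻¹' A : Set (Label d))
  · rw [Set.indicator_of_mem h]
  · rw [Set.indicator_of_notMem h, h1, Set.indicator_of_notMem h]

lemma restrict_add_restrict_compl (f : OneParticle d) :
    restrict A hA f + restrict Aᶜ hA.compl f = f := by
  refine Lp.ext ?_
  filter_upwards [coeFn_restrict hA f, coeFn_restrict hA.compl f,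
    Lp.coeFn_add (restrict A hA f) (restrict Aᶜ hA.compl f)] with x h1 h2 h3
  rw [h3, Pi.add_apply, h1, h2, Set.preimage_compl]
  exact congrFun (Set.indicator_self_add_compl _ _) x

lemma restrict_restrict_compl (f : OneParticle d) :
    restrict A hA (restrict Aᶜ hA.compl f) = 0 := by
  refine Lp.ext ?_
  filter_upwards [coeFn_restrict hA (restrict Aᶜ hA.compl f), coeFn_restrict hA.compl f,
    Lp.coeFn_zero ℂ 2 (labelMeasure d)] with x h1 h2 h3
  rw [h1, h3]
  by_cases h : x ∈ (Prod.fst ⁻¹' A : Set (Label d))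
  · rw [Set.indicator_of_mem h, h2,
      Set.indicator_of_notMem (show x ∉ (Prod.fst ⁻¹' Aᶜ : Set (Label d)) from fun h' => h' h)]
    rfl
  · rw [Set.indicator_of_notMem h]
    rfl

lemma restrict_compl_restrict (f : OneParticle d) :
    restrict Aᶜ hA.compl (restrict A hA f) = 0 := by
  have h := restrict_add_restrict_compl hA (restrict A hA f)
  rwa [restrict_restrict_self, add_eq_left] at h

lemma inner_restrict_compl (f g : OneParticle d) :
    ⟪restrict A hA f, restrict Aᶜ hA.compl g⟫_ℂ = 0 := by
  rw [L2.inner_def]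
  refine integral_eq_zero_of_ae ?_
  filter_upwards [coeFn_restrict hA f, coeFn_restrict hA.compl g] with x h1 h2
  rw [h1, h2, Pi.zero_apply]
  by_cases h : x ∈ (Prod.fst ⁻¹' A : Set (Label d))
  · rw [Set.indicator_of_notMem (s := Prod.fst ⁻¹' Aᶜ) (fun h' => h' h), inner_zero_right]
  · rw [Set.indicator_of_notMem h, inner_zero_left]

lemma inner_compl_restrict (f g : OneParticle d) :
    ⟪restrict Aᶜ hA.compl f, restrict A hA g⟫_ℂ = 0 := by
  rw [← inner_conj_symm, inner_restrict_compl, map_zero]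

lemma inner_eq_restrict_add (f g : OneParticle d) :
    ⟪f, g⟫_ℂ = ⟪restrict A hA f, restrict A hA g⟫_ℂ +
      ⟪restrict Aᶜ hA.compl f, restrict Aᶜ hA.compl g⟫_ℂ := by
  conv_lhs => rw [← restrict_add_restrict_compl hA f, ← restrict_add_restrict_compl hA g]
  rw [inner_add_left, inner_add_right, inner_add_right, inner_restrict_compl, inner_compl_restrict,
    add_zero, zero_add]

end OneParticle

set_option linter.unusedSectionVars false

section Dynamics

variable {H : Type*} [NormedAddCommGroup H] [InnerProductSpace ℂ H] [CompleteSpace H] {d : ℕ}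

/-! ### Slices along field vectors -/

/-- The adjoint of `v ↦ v ⊗ φ`. -/
def slice (φ : Fock d) : SysFock H d →L[ℂ] H := (tensorRight φ).adjoint

lemma inner_slice (u : H) (φ : Fock d) (Ψ : SysFock H d) :
    ⟪u, slice φ Ψ⟫_ℂ = ⟪tens u φ, Ψ⟫_ℂ := by
  rw [slice, ContinuousLinearMap.adjoint_inner_right, tensorRight_apply]

lemma slice_tens (ψ : Fock d) (v : H) (φ : Fock d) : slice ψ (tens v φ) = ⟪ψ, φ⟫_ℂ • v :=
  adjoint_tensorRight_tens v ψ φ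

lemma slice_ampl (φ : Fock d) (A : H →L[ℂ] H) (Ψ : SysFock H d) :
    slice φ (ampl d A Ψ) = A (slice φ Ψ) := adjoint_tensorRight_ampl A φ Ψ

lemma tens_sub_right (u : H) (φ ψ : Fock d) : tens u (φ - ψ) = tens u φ - tens u ψ :=
  map_sub (tensorLeft u) φ ψ

lemma slice_sub (φ ψ : Fock d) (Ψ : SysFock H d) : slice (φ - ψ) Ψ = slice φ Ψ - slice ψ Ψ := by
  refine ext_inner_left ℂ fun u => ?_
  rw [inner_sub_right, inner_slice, inner_slice, inner_slice, tens_sub_right, inner_sub_left]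

lemma slice_smul (c : ℂ) (φ : Fock d) (Ψ : SysFock H d) :
    slice (c • φ) Ψ = conj c • slice φ Ψ := by
  refine ext_inner_left ℂ fun u => ?_
  rw [inner_smul_right, inner_slice, inner_slice, tens_smul_right, inner_smul_left]

lemma norm_slice_le (φ : Fock d) (Ψ : SysFock H d) : ‖slice φ Ψ‖ ≤ ‖φ‖ * ‖Ψ‖ := by
  have h1 : ‖tensorRight (H := H) φ‖ ≤ ‖φ‖ :=
    ContinuousLinearMap.opNorm_le_bound _ (norm_nonneg _) fun v => by
      rw [tensorRight_apply, norm_tens, mul_comm]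
  refine (ContinuousLinearMap.le_opNorm _ _).trans ?_
  rw [slice, LinearIsometryEquiv.norm_map]
  gcongr

/-! ### The generator of the evolution of the slices -/

/-- The operator `∑ₖ conj (gₖ(s)) Rₖ - ∑ₖ fₖ(s) Rₖ† + K`. -/
def gen (R : Fin d → H →L[ℂ] H) (K : H →L[ℂ] H) (g f : OneParticle d) (s : ℝ) : H →L[ℂ] H :=
  ∑ k, conj (g (s, k)) • R k - ∑ k, f (s, k) • (R k).adjoint + K

lemma gen_apply (R : Fin d → H →L[ℂ] H) (K : H →L[ℂ] H) (g f : OneParticle d) (s : ℝ) (x : H) :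
    gen R K g f s x =
      ∑ k, conj (g (s, k)) • R k x - ∑ k, f (s, k) • (R k).adjoint x + K x := by
  simp [gen]

/-- A bound for the norm of `gen`. -/
def genBound (R : Fin d → H →L[ℂ] H) (K : H →L[ℂ] H) (g f : OneParticle d) (s : ℝ) : ℝ :=
  ∑ k, ‖g (s, k)‖ * ‖R k‖ + ∑ k, ‖f (s, k)‖ * ‖R k‖ + ‖K‖

lemma genBound_nonneg (R : Fin d → H →L[ℂ] H) (K : H →L[ℂ] H) (g f : OneParticle d) (s : ℝ) :
    0 ≤ genBound R K g f s := by
  unfold genBound; positivity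

lemma norm_gen_apply_le (R : Fin d → H →L[ℂ] H) (K : H →L[ℂ] H) (g f : OneParticle d) (s : ℝ)
    (x : H) : ‖gen R K g f s x‖ ≤ genBound R K g f s * ‖x‖ := by
  refine (ContinuousLinearMap.le_opNorm _ _).trans ?_
  gcongr
  refine (norm_add_le _ _).trans (add_le_add_left ((norm_sub_le _ _).trans
    (add_le_add (norm_sum_le_of_le _ fun k _ => ?_) (norm_sum_le_of_le _ fun k _ => ?_))) _)
  · rw [norm_smul, RCLike.norm_conj]
  · rw [norm_smul, LinearIsometryEquiv.norm_map]

lemma intervalIntegrable_fun_sum {ι X : Type*} [NormedAddCommGroup X] (s : Finset ι)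
    {F : ι → ℝ → X} {a b : ℝ} (h : ∀ i ∈ s, IntervalIntegrable (F i) volume a b) :
    IntervalIntegrable (fun t => ∑ i ∈ s, F i t) volume a b := by
  have h1 := IntervalIntegrable.sum s h
  rwa [Finset.sum_fn] at h1

lemma intervalIntegrable_genBound (R : Fin d → H →L[ℂ] H) (K : H →L[ℂ] H) (g f : OneParticle d)
    (a b : ℝ) : IntervalIntegrable (genBound R K g f) volume a b := by
  refine IntervalIntegrable.add (IntervalIntegrable.add ?_ ?_) intervalIntegrable_const
  · exact intervalIntegrable_fun_sum _ fun k _ =>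
      (intervalIntegrable_channel g k a b).norm.mul_const _
  · exact intervalIntegrable_fun_sum _ fun k _ =>
      (intervalIntegrable_channel f k a b).norm.mul_const _

lemma intervalIntegrable_gen (R : Fin d → H →L[ℂ] H) (K : H →L[ℂ] H) (g f : OneParticle d)
    {a b : ℝ} {x : ℝ → H} (hx : ContinuousOn x (Set.uIcc a b)) :
    IntervalIntegrable (fun s => gen R K g f s (x s)) volume a b := by
  simp_rw [gen_apply]
  refine IntervalIntegrable.add (IntervalIntegrable.sub ?_ ?_) ?_
  · exact intervalIntegrable_fun_sum _ fun k _ =>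
      (intervalIntegrable_conj_channel g k a b).smul_continuousOn ((R k).continuous.comp_continuousOn hx)
  · exact intervalIntegrable_fun_sum _ fun k _ =>
      (intervalIntegrable_channel f k a b).smul_continuousOn
        ((R k).adjoint.continuous.comp_continuousOn hx)
  · exact (K.continuous.comp_continuousOn hx).intervalIntegrable

/-- Split A_b y_b = A_b (y_b - y_a) + A_b y_a: contractivity controls the first term and strong
continuity the second. -/
lemma continuousOn_clm_apply {α X Y : Type*} [TopologicalSpace α] [NormedAddCommGroup X]
    [NormedSpace ℂ X] [NormedAddCommGroup Y] [NormedSpace ℂ Y] {A : α → X →L[ℂ] Y} {y : α → X}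
    {S : Set α} (hA : ∀ a ∈ S, ∀ x, ‖A a x‖ ≤ ‖x‖) (hc : ∀ x, ContinuousOn (fun a => A a x) S)
    (hy : ContinuousOn y S) : ContinuousOn (fun a => A a (y a)) S := by
  intro a ha
  have h1 : Tendsto (fun b => A b (y b - y a)) (𝓝[S] a) (𝓝 0) := by
    have h2 : Tendsto (fun b => ‖y b - y a‖) (𝓝[S] a) (𝓝 0) :=
      tendsto_iff_norm_sub_tendsto_zero.1 (hy a ha)
    refine squeeze_zero_norm' ?_ h2
    filter_upwards [self_mem_nhdsWithin] with b hb
    exact hA b hb _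
  have h3 := h1.add (hc (y a) a ha)
  rw [zero_add] at h3
  refine h3.congr fun b => ?_
  rw [map_sub, sub_add_cancel]

variable {H₀ : H →L[ℂ] H} {R : Fin d → H →L[ℂ] H} {U : ℝ → SysFock H d →L[ℂ] SysFock H d}

lemma IsHPEvolution.adjoint_apply_apply (hU : IsHPEvolution H₀ R U) {t : ℝ} (ht : 0 ≤ t)
    (Ψ : SysFock H d) : (U t).adjoint (U t Ψ) = Ψ :=
  DFunLike.congr_fun (Unitary.mem_iff.1 (hU.mem_unitary t ht)).1 Ψ

lemma IsHPEvolution.apply_adjoint_apply (hU : IsHPEvolution H₀ R U) {t : ℝ} (ht : 0 ≤ t)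
    (Ψ : SysFock H d) : U t ((U t).adjoint Ψ) = Ψ :=
  DFunLike.congr_fun (Unitary.mem_iff.1 (hU.mem_unitary t ht)).2 Ψ

lemma IsHPEvolution.norm_apply (hU : IsHPEvolution H₀ R U) {t : ℝ} (ht : 0 ≤ t)
    (Ψ : SysFock H d) : ‖U t Ψ‖ = ‖Ψ‖ := by
  have h : ⟪U t Ψ, U t Ψ⟫_ℂ = ⟪Ψ, Ψ⟫_ℂ := by
    rw [← ContinuousLinearMap.adjoint_inner_right, hU.adjoint_apply_apply ht]
  rw [inner_self_eq_ofReal, inner_self_eq_ofReal] at h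
  exact (sq_eq_sq₀ (norm_nonneg _) (norm_nonneg _)).1 (Complex.ofReal_injective h)

lemma IsHPEvolution.norm_adjoint_apply (hU : IsHPEvolution H₀ R U) {t : ℝ} (ht : 0 ≤ t)
    (Ψ : SysFock H d) : ‖(U t).adjoint Ψ‖ = ‖Ψ‖ := by
  rw [← hU.norm_apply ht, hU.apply_adjoint_apply ht]

lemma IsHPEvolution.continuousOn_comp (hU : IsHPEvolution H₀ R U) {y : ℝ → SysFock H d}
    (hy : ContinuousOn y (Set.Ici 0)) : ContinuousOn (fun t => U t (y t)) (Set.Ici 0) :=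
  continuousOn_clm_apply (fun _ ht Ψ => (hU.norm_apply ht Ψ).le) hU.continuousOn hy

lemma IsHPEvolution.continuousOn_comp_prod (hU : IsHPEvolution H₀ R U) {y : ℝ → SysFock H d}
    (hy : ContinuousOn y (Set.Ici 0)) :
    ContinuousOn (fun p : ℝ × ℝ => U p.2 (y p.1)) (Set.Ici 0 ×ˢ Set.Ici 0) :=
  continuousOn_clm_apply (A := fun p : ℝ × ℝ => U p.2) (y := fun p => y p.1)
    (fun _ hp Ψ => (hU.norm_apply hp.2 Ψ).le)
    (fun Ψ => (hU.continuousOn Ψ).comp continuousOn_snd fun _ hp => hp.2)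
    (hy.comp continuousOn_fst fun _ hp => hp.1)

/-- Strong continuity of a family does not pass to adjoints in general. Here unitarity gives ‖U_t†Ψ
- U_s†Ψ‖ = ‖Ψ - U_t U_s†Ψ‖. -/
lemma IsHPEvolution.continuousOn_adjoint_comp (hU : IsHPEvolution H₀ R U) {z : ℝ → SysFock H d}
    (hz : ContinuousOn z (Set.Ici 0)) :
    ContinuousOn (fun t => (U t).adjoint (z t)) (Set.Ici 0) := by
  refine continuousOn_clm_apply (fun _ ht Ψ => (hU.norm_adjoint_apply ht Ψ).le) (fun Ψ => ?_) hz
  intro s hs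
  rw [ContinuousWithinAt, tendsto_iff_norm_sub_tendsto_zero]
  have h1 : Tendsto (fun t => ‖Ψ - U t ((U s).adjoint Ψ)‖) (𝓝[Set.Ici 0] s) (𝓝 0) := by
    have h2 := ((tendsto_const_nhds (x := Ψ)).sub
      (hU.continuousOn ((U s).adjoint Ψ) s hs)).norm
    beta_reduce at h2
    rwa [hU.apply_adjoint_apply hs, sub_self, norm_zero] at h2
  refine h1.congr' ?_
  filter_upwards [self_mem_nhdsWithin] with t ht
  rw [← hU.norm_adjoint_apply ht, map_sub, hU.adjoint_apply_apply ht]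

lemma IsHPEvolution.continuousOn_slice (hU : IsHPEvolution H₀ R U) (φ : Fock d)
    {y : ℝ → SysFock H d} (hy : ContinuousOn y (Set.Ici 0)) {a b : ℝ} (ha : 0 ≤ a) (hb : 0 ≤ b) :
    ContinuousOn (fun t => slice φ (U t (y t))) (Set.uIcc a b) :=
  ((slice φ).continuous.comp_continuousOn (hU.continuousOn_comp hy)).mono fun _ ht =>
    (le_min ha hb).trans ht.1

/-- The Hudson–Parthasarathy equation for the slices along exponential vectors. -/
lemma IsHPEvolution.slice_expVec (hU : IsHPEvolution H₀ R U) {t : ℝ} (ht : 0 ≤ t) (v : H)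
    (g f : OneParticle d) :
    slice (expVec g) (U t (tens v (expVec f))) = slice (expVec g) (tens v (expVec f)) +
      ∫ s in (0 : ℝ)..t,
        gen R (driftOp H₀ R) g f s (slice (expVec g) (U s (tens v (expVec f)))) := by
  refine ext_inner_left ℂ fun u => ?_
  have hint := intervalIntegrable_gen R (driftOp H₀ R) g f (hU.continuousOn_slice (expVec g)
    (y := fun _ => tens v (expVec f)) continuousOn_const le_rfl ht)
  have h1 := (innerSL ℂ u).intervalIntegral_comp_comm hint
  simp only [innerSL_apply_apply] at h1
  rw [inner_add_right, ← h1, inner_slice, inner_slice]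
  set c : ℂ := ((Real.exp (‖g‖ ^ 2 / 2) : ℝ) : ℂ) * ((Real.exp (‖f‖ ^ 2 / 2) : ℝ) : ℂ) with hc
  have h2 : ∀ (w : H) (A : SysFock H d →L[ℂ] SysFock H d),
      ⟪tens w (expVec g), A (tens v (expVec f))⟫_ℂ =
        c * ⟪tensorCoherent w g, A (tensorCoherent v f)⟫_ℂ := by
    intro w A
    rw [expVec, expVec, tens_smul_right, tens_smul_right, map_smul, inner_smul_left,
      inner_smul_right, Complex.conj_ofReal, tensorCoherent_eq, tensorCoherent_eq, hc, mul_assoc]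
  have h3 := h2 u (ContinuousLinearMap.id ℂ _)
  simp only [ContinuousLinearMap.id_apply] at h3
  rw [h2, h3, hU.equation t ht u v g f, mul_add, ← intervalIntegral.integral_const_mul]
  congr 1
  refine intervalIntegral.integral_congr fun s _ => ?_
  rw [gen_apply, inner_add_right, inner_sub_right, inner_sum, inner_sum, mul_add, mul_sub,
    Finset.mul_sum, Finset.mul_sum]
  congr 1
  · congr 1
    · refine Finset.sum_congr rfl fun k _ => ?_
      rw [inner_smul_right, ← ContinuousLinearMap.adjoint_inner_left (R k), inner_slice, h2]
      ring
    · refine Finset.sum_congr rfl fun k _ => ?_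
      rw [inner_smul_right, ContinuousLinearMap.adjoint_inner_right, inner_slice, h2]
      ring
  · rw [← ContinuousLinearMap.adjoint_inner_left (driftOp H₀ R), inner_slice, h2]

/-! ### Vectors which are exponential in the future -/

/-- The closed span of the vectors `v ⊗ E(f')` with `f' = f` outside of the time interval
`(0, s)`. -/
def futureSpace (H : Type*) [NormedAddCommGroup H] [InnerProductSpace ℂ H] (s : ℝ)
    (f : OneParticle d) : Submodule ℂ (SysFock H d) :=
  (Submodule.span ℂ {x : SysFock H d | ∃ (v : H) (f' : OneParticle d),
    restrict (Set.Ioo 0 s)ᶜ measurableSet_Ioo.compl f' =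
      restrict (Set.Ioo 0 s)ᶜ measurableSet_Ioo.compl f ∧ x = tens v (expVec f')}).topologicalClosure

lemma tens_expVec_mem_futureSpace (s : ℝ) (v : H) {f' f : OneParticle d}
    (h : restrict (Set.Ioo 0 s)ᶜ measurableSet_Ioo.compl f' =
      restrict (Set.Ioo 0 s)ᶜ measurableSet_Ioo.compl f) :
    tens v (expVec f') ∈ futureSpace H s f :=
  Submodule.le_topologicalClosure _ (Submodule.subset_span ⟨v, f', h, rfl⟩)

lemma futureSpace_le {s : ℝ} {f : OneParticle d} {N : Submodule ℂ (SysFock H d)}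
    (hN : IsClosed (N : Set (SysFock H d)))
    (h : ∀ (v : H) (f' : OneParticle d), restrict (Set.Ioo 0 s)ᶜ measurableSet_Ioo.compl f' =
      restrict (Set.Ioo 0 s)ᶜ measurableSet_Ioo.compl f → tens v (expVec f') ∈ N) :
    futureSpace H s f ≤ N := by
  refine Submodule.topologicalClosure_minimal _ (Submodule.span_le.2 ?_) hN
  rintro _ ⟨v, f', hf, rfl⟩
  exact h v f' hf

lemma isClosed_futureSpace (s : ℝ) (f : OneParticle d) :
    IsClosed (futureSpace H s f : Set (SysFock H d)) := Submodule.isClosed_topologicalClosure _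

lemma map_mem_futureSpace {s : ℝ} {f : OneParticle d} {A : SysFock H d →L[ℂ] SysFock H d}
    (h : ∀ (v : H) (f' : OneParticle d), restrict (Set.Ioo 0 s)ᶜ measurableSet_Ioo.compl f' =
      restrict (Set.Ioo 0 s)ᶜ measurableSet_Ioo.compl f →
      A (tens v (expVec f')) ∈ futureSpace H s f) {Ψ : SysFock H d}
    (hΨ : Ψ ∈ futureSpace H s f) : A Ψ ∈ futureSpace H s f :=
  futureSpace_le (N := (futureSpace H s f).comap A.toLinearMap)
    ((isClosed_futureSpace s f).preimage A.continuous) h hΨ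

lemma ampl_mem_futureSpace {s : ℝ} {f : OneParticle d} (A : H →L[ℂ] H) {Ψ : SysFock H d}
    (hΨ : Ψ ∈ futureSpace H s f) : ampl d A Ψ ∈ futureSpace H s f :=
  map_mem_futureSpace (fun v f' hf => by
    rw [ampl_tens]; exact tens_expVec_mem_futureSpace s _ hf) hΨ

/-- Adaptedness of an operator, in terms of exponential vectors. -/
def IsAdapted (s : ℝ) (A : SysFock H d →L[ℂ] SysFock H d) : Prop :=
  ∀ (u v : H) (g f : OneParticle d),
    ⟪tens u (expVec g), A (tens v (expVec f))⟫_ℂ =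
      ⟪tens u (expVec (restrict (Set.Ioo 0 s) measurableSet_Ioo g)),
        A (tens v (expVec (restrict (Set.Ioo 0 s) measurableSet_Ioo f)))⟫_ℂ *
      Complex.exp ⟪restrict (Set.Ioo 0 s)ᶜ measurableSet_Ioo.compl g,
        restrict (Set.Ioo 0 s)ᶜ measurableSet_Ioo.compl f⟫_ℂ

/-- Only the normalisation changes: ‖p‖² splits into its parts inside and outside (0, t), and the
outer Gaussian factors cancel those in the inner product of the outer coherent vectors. -/
lemma IsHPEvolution.isAdapted (hU : IsHPEvolution H₀ R U) {t : ℝ} (ht : 0 ≤ t) :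
    IsAdapted t (U t) := by
  intro u v g f
  have h := hU.adapted t ht u v g f
  have hn : ∀ p : OneParticle d, ‖p‖ ^ 2 = ‖restrict (Set.Ioo 0 t) measurableSet_Ioo p‖ ^ 2 +
      ‖restrict (Set.Ioo 0 t)ᶜ measurableSet_Ioo.compl p‖ ^ 2 := by
    intro p
    have h1 := inner_eq_restrict_add (measurableSet_Ioo : MeasurableSet (Set.Ioo 0 t)) p p
    simp only [inner_self_eq_ofReal] at h1
    exact_mod_cast h1
  rw [inner_coherent] at h
  simp only [tensorCoherent_eq] at h
  simp only [expVec, tens_smul_right, map_smul, inner_smul_left, inner_smul_right,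
    Complex.conj_ofReal]
  rw [h, hn g, hn f]
  simp only [Complex.ofReal_exp]
  have key : Complex.exp (((‖restrict (Set.Ioo 0 t) measurableSet_Ioo f‖ ^ 2 +
      ‖restrict (Set.Ioo 0 t)ᶜ measurableSet_Ioo.compl f‖ ^ 2) / 2 : ℝ) : ℂ) *
      Complex.exp (((‖restrict (Set.Ioo 0 t) measurableSet_Ioo g‖ ^ 2 +
      ‖restrict (Set.Ioo 0 t)ᶜ measurableSet_Ioo.compl g‖ ^ 2) / 2 : ℝ) : ℂ) *
      Complex.exp (-(‖restrict (Set.Ioo 0 t)ᶜ measurableSet_Ioo.compl g‖ ^ 2 / 2) -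
        ‖restrict (Set.Ioo 0 t)ᶜ measurableSet_Ioo.compl f‖ ^ 2 / 2) =
      Complex.exp ((‖restrict (Set.Ioo 0 t) measurableSet_Ioo f‖ ^ 2 / 2 : ℝ) : ℂ) *
      Complex.exp ((‖restrict (Set.Ioo 0 t) measurableSet_Ioo g‖ ^ 2 / 2 : ℝ) : ℂ) := by
    rw [← Complex.exp_add, ← Complex.exp_add, ← Complex.exp_add]
    congr 1
    push_cast
    ring
  linear_combination (⟪tens u (coherent (restrict (Set.Ioo 0 t) measurableSet_Ioo g)),
        U t (tens v (coherent (restrict (Set.Ioo 0 t) measurableSet_Ioo f)))⟫_ℂ *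
      Complex.exp ⟪restrict (Set.Ioo 0 t)ᶜ measurableSet_Ioo.compl g,
        restrict (Set.Ioo 0 t)ᶜ measurableSet_Ioo.compl f⟫_ℂ) * key

lemma IsAdapted.adjoint {s : ℝ} {A : SysFock H d →L[ℂ] SysFock H d} (hA : IsAdapted s A) :
    IsAdapted s A.adjoint := by
  intro u v g f
  rw [ContinuousLinearMap.adjoint_inner_right, ContinuousLinearMap.adjoint_inner_right,
    ← inner_conj_symm, hA, map_mul, inner_conj_symm, ← Complex.exp_conj, inner_conj_symm]

/-- Membership is tested through the orthogonal projection onto the future space. That projection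
sends u ⊗ E(g) to a multiple of u ⊗ E(g₁ + f_c), with g₁ the part of g inside (0, s) and f_c the
part of f outside; adaptedness gives both vectors the same matrix elements with the image of A. -/
lemma IsAdapted.mem_futureSpace {s : ℝ} {f : OneParticle d} {A : SysFock H d →L[ℂ] SysFock H d}
    (hA : IsAdapted s A) {Ψ : SysFock H d} (hΨ : Ψ ∈ futureSpace H s f) :
    A Ψ ∈ futureSpace H s f := by
  have : CompleteSpace (futureSpace H s f) := (isClosed_futureSpace s f).completeSpace_coe
  refine map_mem_futureSpace (fun v f' hf => ?_) hΨ
  rw [← Submodule.starProjection_eq_self_iff]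
  refine eq_of_forall_inner_tens_expVec fun u g => ?_
  set I : Set ℝ := Set.Ioo 0 s with hI
  have hIm : MeasurableSet I := measurableSet_Ioo
  set g₁ := restrict I hIm g
  set fc := restrict Iᶜ hIm.compl f with hfc
  -- The constant is forced by orthogonality of the difference to every w ⊗ E(p) with p = f outside
  -- (0, s): it replaces the outer factor exp⟨f_c, f_c⟩ by exp⟨f_c, g⟩, up to conjugation.
  set c : ℂ := Complex.exp (⟪fc, restrict Iᶜ hIm.compl g⟫_ℂ - ⟪fc, fc⟫_ℂ) with hc
  have hr1 : restrict I hIm (g₁ + fc) = g₁ := by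
    rw [restrict_add, restrict_restrict_self, restrict_restrict_compl, add_zero]
  have hr2 : restrict Iᶜ hIm.compl (g₁ + fc) = fc := by
    rw [restrict_add, restrict_compl_restrict, zero_add, hfc, restrict_restrict_self hIm.compl]
  have hmem : c • tens u (expVec (g₁ + fc)) ∈ futureSpace H s f :=
    Submodule.smul_mem _ _ (tens_expVec_mem_futureSpace s u hr2)
  have hproj : c • tens u (expVec (g₁ + fc)) =
      (futureSpace H s f).starProjection (tens u (expVec g)) := by
    refine Submodule.eq_starProjection_of_mem_orthogonal hmem ?_ |>.symm
    rw [Submodule.mem_orthogonal]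
    intro y hy
    have h := futureSpace_le (N := (innerSL ℂ (tens u (expVec g) -
      c • tens u (expVec (g₁ + fc)))).ker) (ContinuousLinearMap.isClosed_ker _)
      (fun w p hp => ?_) hy
    · rw [← inner_conj_symm]
      have h' : ⟪tens u (expVec g) - c • tens u (expVec (g₁ + fc)), y⟫_ℂ = 0 := h
      rw [h', map_zero]
    · rw [LinearMap.mem_ker]
      change ⟪tens u (expVec g) - c • tens u (expVec (g₁ + fc)), tens w (expVec p)⟫_ℂ = 0
      have hp' : restrict Iᶜ hIm.compl p = fc := hp
      rw [← inner_conj_symm, inner_sub_right, inner_smul_right, inner_tens, inner_tens,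
        inner_expVec, inner_expVec, inner_eq_restrict_add hIm p g,
        inner_eq_restrict_add hIm p (g₁ + fc), hr1, hr2, hp', hc, mul_left_comm, ← Complex.exp_add]
      have : ⟪fc, restrict Iᶜ hIm.compl g⟫_ℂ - ⟪fc, fc⟫_ℂ + (⟪restrict I hIm p, g₁⟫_ℂ + ⟪fc, fc⟫_ℂ)
          = ⟪restrict I hIm p, g₁⟫_ℂ + ⟪fc, restrict Iᶜ hIm.compl g⟫_ℂ := by ring
      rw [this, sub_self, map_zero]
  rw [← Submodule.inner_starProjection_left_eq_right, ← hproj, inner_smul_left, hA u v (g₁ + fc) f',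
    hr1, hr2, hA u v g f', hf, hc, ← Complex.exp_conj, mul_left_comm, ← Complex.exp_add]
  congr 2
  rw [map_sub, inner_conj_symm, inner_conj_symm]
  ring

end Dynamics

section Duhamel

variable {H : Type*} [NormedAddCommGroup H] [InnerProductSpace ℂ H] [CompleteSpace H] {d : ℕ}
  {H₀ : H →L[ℂ] H} {R : Fin d → H →L[ℂ] H} {U : ℝ → SysFock H d →L[ℂ] SysFock H d}

/-! ### The Duhamel formula for the annihilation operators -/

/-- The equation for the slices holds from time `s` on for all vectors in `futureSpace H s f`. -/
lemma IsHPEvolution.slice_of_mem (hU : IsHPEvolution H₀ R U) {s t : ℝ} (hs : 0 ≤ s) (hst : s ≤ t)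
    (g f : OneParticle d) {Ψ : SysFock H d} (hΨ : Ψ ∈ futureSpace H s f) :
    slice (expVec g) (U t Ψ) = slice (expVec g) (U s Ψ) +
      ∫ r in s..t, gen R (driftOp H₀ R) g f r (slice (expVec g) (U r Ψ)) := by
  have ht : 0 ≤ t := hs.trans hst
  have hint : ∀ (Φ : SysFock H d) (p : OneParticle d) {a b : ℝ}, 0 ≤ a → 0 ≤ b →
      IntervalIntegrable (fun r => gen R (driftOp H₀ R) g p r (slice (expVec g) (U r Φ)))
        volume a b := fun Φ p a b ha hb =>
    intervalIntegrable_gen R (driftOp H₀ R) g p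
      (hU.continuousOn_slice (expVec g) (y := fun _ => Φ) continuousOn_const ha hb)
  set I : SysFock H d →L[ℂ] H := LinearMap.mkContinuous
    { toFun := fun Φ => ∫ r in s..t, gen R (driftOp H₀ R) g f r (slice (expVec g) (U r Φ))
      map_add' := fun Φ Φ' => by
        simp only [map_add]
        exact intervalIntegral.integral_add (hint Φ f hs ht) (hint Φ' f hs ht)
      map_smul' := fun c Φ => by
        simp only [map_smul, RingHom.id_apply]
        exact intervalIntegral.integral_smul c _ }
    ((∫ r in s..t, genBound R (driftOp H₀ R) g f r) * ‖expVec g‖) (fun Φ => by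
      rw [mul_assoc, ← intervalIntegral.integral_mul_const]
      refine intervalIntegral.norm_integral_le_of_norm_le hst (Eventually.of_forall fun r hr => ?_)
        ((intervalIntegrable_genBound R (driftOp H₀ R) g f s t).mul_const _)
      refine (norm_gen_apply_le R _ g f r _).trans ?_
      refine mul_le_mul_of_nonneg_left ?_ (genBound_nonneg R _ g f r)
      refine (norm_slice_le _ _).trans ?_
      rw [hU.norm_apply (hs.trans hr.1.le)]) with hI
  have hIa : ∀ Φ, I Φ = ∫ r in s..t, gen R (driftOp H₀ R) g f r (slice (expVec g) (U r Φ)) :=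
    fun Φ => rfl
  -- All three terms are bounded linear in the vector, so the identity defines a closed subspace and
  -- need only be checked on the vectors v ⊗ E(f') spanning the future space.
  have hker := futureSpace_le (s := s) (f := f)
    (N := (slice (expVec g) ∘L U t - slice (expVec g) ∘L U s - I).ker)
    (ContinuousLinearMap.isClosed_ker _) (fun v f' hf => ?_) hΨ
  · rw [LinearMap.mem_ker] at hker
    have h1 : slice (expVec g) (U t Ψ) - slice (expVec g) (U s Ψ) - I Ψ = 0 := hker
    rw [← hIa]
    rw [sub_sub, sub_eq_zero] at h1
    exact h1
  · rw [LinearMap.mem_ker]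
    change slice (expVec g) (U t _) - slice (expVec g) (U s _) - I _ = 0
    rw [hIa, hU.slice_expVec ht v g f', hU.slice_expVec hs v g f', add_sub_add_left_eq_sub,
      intervalIntegral.integral_interval_sub_left (hint _ _ le_rfl ht) (hint _ _ le_rfl hs),
      sub_eq_zero]
    -- After time s the functions f' and f agree almost everywhere, hence so do the generators they
    -- determine.
    refine intervalIntegral.integral_congr_ae ?_
    have h1 := ae_forall_channel (coeFn_restrict (measurableSet_Ioo.compl :
      MeasurableSet (Set.Ioo 0 s)ᶜ) f)
    have h2 := ae_forall_channel (coeFn_restrict (measurableSet_Ioo.compl :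
      MeasurableSet (Set.Ioo 0 s)ᶜ) f')
    filter_upwards [h1, h2] with r h3 h4 hr
    rw [Set.uIoc_of_le hst] at hr
    have h5 : ∀ k, f' (r, k) = f (r, k) := by
      intro k
      have hmem : ((r, k) : Label d) ∈ (Prod.fst ⁻¹' (Set.Ioo 0 s)ᶜ : Set (Label d)) :=
        fun h => absurd h.2 (not_lt.2 hr.1.le)
      have h6 := h3 k
      have h7 := h4 k
      rw [Set.indicator_of_mem hmem] at h6 h7
      rw [← h6, ← h7, hf]
    simp only [gen_apply, h5]

/-- The vectors `U_s† R_k U_s (v ⊗ E(f))`. -/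
def heisenberg (R : Fin d → H →L[ℂ] H) (U : ℝ → SysFock H d →L[ℂ] SysFock H d) (k : Fin d)
    (Ψ : SysFock H d) (s : ℝ) : SysFock H d := (U s).adjoint (ampl d (R k) (U s Ψ))

lemma IsHPEvolution.continuousOn_heisenberg (hU : IsHPEvolution H₀ R U) (k : Fin d)
    (Ψ : SysFock H d) : ContinuousOn (heisenberg R U k Ψ) (Set.Ici 0) :=
  hU.continuousOn_adjoint_comp ((ampl d (R k)).continuous.comp_continuousOn (hU.continuousOn Ψ))

lemma IsHPEvolution.norm_heisenberg_le (hU : IsHPEvolution H₀ R U) (k : Fin d)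
    (Ψ : SysFock H d) {s : ℝ} (hs : 0 ≤ s) :
    ‖heisenberg R U k Ψ s‖ ≤ ‖ampl d (R k)‖ * ‖Ψ‖ := by
  rw [heisenberg, hU.norm_adjoint_apply hs]
  refine (ContinuousLinearMap.le_opNorm _ _).trans ?_
  rw [hU.norm_apply hs]

lemma IsHPEvolution.heisenberg_mem (hU : IsHPEvolution H₀ R U) (k : Fin d) (v : H)
    (f : OneParticle d) {s : ℝ} (hs : 0 ≤ s) :
    heisenberg R U k (tens v (expVec f)) s ∈ futureSpace H s f :=
  (hU.isAdapted hs).adjoint.mem_futureSpace (ampl_mem_futureSpace _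
    ((hU.isAdapted hs).mem_futureSpace (tens_expVec_mem_futureSpace s v rfl)))

/-- The integral `∫₀ᵗ conj (q_k(s)) U_s† R_k U_s Ψ ds`. -/
def duhamel (R : Fin d → H →L[ℂ] H) (U : ℝ → SysFock H d →L[ℂ] SysFock H d) (q : OneParticle d)
    (k : Fin d) (Ψ : SysFock H d) (t : ℝ) : SysFock H d :=
  ∫ s in (0 : ℝ)..t, conj (q (s, k)) • heisenberg R U k Ψ s

lemma uIcc_subset_Ici {a b : ℝ} (ha : 0 ≤ a) (hb : 0 ≤ b) : Set.uIcc a b ⊆ Set.Ici 0 :=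
  fun _ ht => (le_min ha hb).trans ht.1

lemma IsHPEvolution.intervalIntegrable_duhamel (hU : IsHPEvolution H₀ R U) (q : OneParticle d)
    (k : Fin d) (Ψ : SysFock H d) {a b : ℝ} (ha : 0 ≤ a) (hb : 0 ≤ b) :
    IntervalIntegrable (fun s => conj (q (s, k)) • heisenberg R U k Ψ s) volume a b :=
  (intervalIntegrable_conj_channel q k a b).smul_continuousOn
    ((hU.continuousOn_heisenberg k Ψ).mono (uIcc_subset_Ici ha hb))

lemma IsHPEvolution.continuousOn_duhamel (hU : IsHPEvolution H₀ R U) (q : OneParticle d)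
    (k : Fin d) (Ψ : SysFock H d) : ContinuousOn (duhamel R U q k Ψ) (Set.Ici 0) := by
  intro t ht
  have h1 := intervalIntegral.continuousOn_primitive_interval' (μ := volume)
    (hU.intervalIntegrable_duhamel q k Ψ le_rfl (show (0 : ℝ) ≤ t + 1 from
      add_nonneg ht zero_le_one)) Set.left_mem_uIcc
  rw [Set.uIcc_of_le (add_nonneg ht zero_le_one)] at h1
  refine (h1 t ⟨ht, by linarith⟩).mono_of_mem_nhdsWithin ?_
  have h2 : Set.Iio (t + 1) ∈ 𝓝 t := Iio_mem_nhds (by linarith)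
  filter_upwards [self_mem_nhdsWithin, mem_nhdsWithin_of_mem_nhds h2] with r h3 h4
  exact ⟨h3, le_of_lt h4⟩

lemma IsHPEvolution.norm_duhamel_le (hU : IsHPEvolution H₀ R U) (q : OneParticle d)
    (k : Fin d) (Ψ : SysFock H d) {t : ℝ} (ht : 0 ≤ t) :
    ‖duhamel R U q k Ψ t‖ ≤ √t * ‖q‖ * (‖ampl d (R k)‖ * ‖Ψ‖) := by
  have h1 : ‖duhamel R U q k Ψ t‖ ≤
      ∫ s in (0 : ℝ)..t, ‖q (s, k)‖ * (‖ampl d (R k)‖ * ‖Ψ‖) := by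
    refine intervalIntegral.norm_integral_le_of_norm_le ht (Eventually.of_forall fun s hs => ?_)
      ((intervalIntegrable_channel q k 0 t).norm.mul_const _)
    rw [norm_smul, RCLike.norm_conj]
    exact mul_le_mul_of_nonneg_left (hU.norm_heisenberg_le k Ψ hs.1.le) (norm_nonneg _)
  rw [intervalIntegral.integral_mul_const] at h1
  exact h1.trans (mul_le_mul_of_nonneg_right (integral_norm_channel_le q k ht) (by positivity))

/-- The dominating function is a product of an integrable function of s and one of r, because the
vectors inside have norms bounded independently of s and r. This justifies exchanging the order of
integration on the triangle. -/
lemma IsHPEvolution.integrable_duhamel_prod (hU : IsHPEvolution H₀ R U) (q g f : OneParticle d)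
    (k : Fin d) (Ψ : SysFock H d) {t : ℝ} :
    Integrable (Function.uncurry fun s r => conj (q (s, k)) •
      gen R (driftOp H₀ R) g f r (slice (expVec g) (U r (heisenberg R U k Ψ s))))
      ((volume.restrict (Set.Ioc 0 t)).prod (volume.restrict (Set.Ioc 0 t))) := by
  set ν := (volume.restrict (Set.Ioc 0 t) : Measure ℝ) with hν
  have hmeas : ∀ (p : OneParticle d) (j : Fin d), StronglyMeasurable fun s : ℝ => p (s, j) :=
    fun p j => (Lp.stronglyMeasurable p).comp_measurable (measurable_id.prodMk measurable_const)
  have hx : AEStronglyMeasurable (fun p : ℝ × ℝ =>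
      slice (expVec g) (U p.2 (heisenberg R U k Ψ p.1))) (ν.prod ν) := by
    rw [hν, Measure.prod_restrict]
    refine ContinuousOn.aestronglyMeasurable ?_ (measurableSet_Ioc.prod measurableSet_Ioc)
    refine ((slice (expVec g)).continuous.comp_continuousOn
      (hU.continuousOn_comp_prod (hU.continuousOn_heisenberg k Ψ))).mono ?_
    exact Set.prod_mono (fun _ h => h.1.le) fun _ h => h.1.le
  have hq : Integrable (fun s => ‖q (s, k)‖) ν :=
    ((memLp_channel q k).restrict _).norm.integrable (by norm_num)
  have hb : Integrable (genBound R (driftOp H₀ R) g f) ν := by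
    rcases le_or_gt 0 t with ht | ht
    · exact (intervalIntegrable_iff_integrableOn_Ioc_of_le ht).1
        (intervalIntegrable_genBound R (driftOp H₀ R) g f 0 t)
    · rw [hν, Set.Ioc_eq_empty (not_lt.2 ht.le), Measure.restrict_empty]
      exact integrable_zero_measure
  refine ((hq.mul_prod hb).mul_const (‖expVec g‖ * (‖ampl d (R k)‖ * ‖Ψ‖))).mono' ?_ ?_
  · have e : (Function.uncurry fun s r => conj (q (s, k)) •
        gen R (driftOp H₀ R) g f r (slice (expVec g) (U r (heisenberg R U k Ψ s)))) =
        fun p : ℝ × ℝ => conj (q (p.1, k)) •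
          (∑ j, conj (g (p.2, j)) • R j (slice (expVec g) (U p.2 (heisenberg R U k Ψ p.1))) -
          ∑ j, f (p.2, j) • (R j).adjoint (slice (expVec g) (U p.2 (heisenberg R U k Ψ p.1))) +
          driftOp H₀ R (slice (expVec g) (U p.2 (heisenberg R U k Ψ p.1)))) := by
      funext p
      rw [← gen_apply]
      rfl
    rw [e]
    have hfst : ∀ (p : OneParticle d) (j : Fin d),
        AEStronglyMeasurable (fun x : ℝ × ℝ => p (x.1, j)) (ν.prod ν) := fun p j =>
      ((hmeas p j).comp_measurable measurable_fst).aestronglyMeasurable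
    have hsnd : ∀ (p : OneParticle d) (j : Fin d),
        AEStronglyMeasurable (fun x : ℝ × ℝ => p (x.2, j)) (ν.prod ν) := fun p j =>
      ((hmeas p j).comp_measurable measurable_snd).aestronglyMeasurable
    refine AEStronglyMeasurable.smul (hfst q k).star (AEStronglyMeasurable.add
      (AEStronglyMeasurable.sub ?_ ?_) ?_)
    · exact Finset.aestronglyMeasurable_fun_sum _ fun j _ => AEStronglyMeasurable.smul
        (hsnd g j).star ((R j).continuous.comp_aestronglyMeasurable hx)
    · exact Finset.aestronglyMeasurable_fun_sum _ fun j _ => AEStronglyMeasurable.smul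
        (hsnd f j) ((R j).adjoint.continuous.comp_aestronglyMeasurable hx)
    · exact (driftOp H₀ R).continuous.comp_aestronglyMeasurable hx
  · rw [hν, Measure.prod_restrict, ae_restrict_iff' (measurableSet_Ioc.prod measurableSet_Ioc)]
    refine Eventually.of_forall fun p hp => ?_
    change ‖conj (q (p.1, k)) • _‖ ≤ _
    rw [norm_smul, RCLike.norm_conj, mul_assoc]
    refine mul_le_mul_of_nonneg_left ?_ (norm_nonneg _)
    refine (norm_gen_apply_le R _ g f p.2 _).trans ?_
    refine mul_le_mul_of_nonneg_left ?_ (genBound_nonneg R _ g f p.2)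
    refine (norm_slice_le _ _).trans (mul_le_mul_of_nonneg_left ?_ (norm_nonneg _))
    rw [hU.norm_apply hp.2.1.le]
    exact hU.norm_heisenberg_le k Ψ hp.1.1.le

/-- The equation satisfied by the slices of the Duhamel integral. -/
lemma IsHPEvolution.slice_duhamel (hU : IsHPEvolution H₀ R U) (q g f : OneParticle d) (v : H)
    (k : Fin d) {t : ℝ} (ht : 0 ≤ t) :
    slice (expVec g) (U t (duhamel R U q k (tens v (expVec f)) t)) =
      (∫ s in (0 : ℝ)..t, conj (q (s, k)) •
        R k (slice (expVec g) (U s (tens v (expVec f))))) +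
      ∫ r in (0 : ℝ)..t, gen R (driftOp H₀ R) g f r
        (slice (expVec g) (U r (duhamel R U q k (tens v (expVec f)) r))) := by
  set Ψ := tens v (expVec f) with hΨ
  have hclm : ∀ (A : SysFock H d →L[ℂ] H) {r : ℝ}, 0 ≤ r → A (duhamel R U q k Ψ r) =
      ∫ s in (0 : ℝ)..r, conj (q (s, k)) • A (heisenberg R U k Ψ s) := by
    intro A r hr
    rw [duhamel, ← A.intervalIntegral_comp_comm (hU.intervalIntegrable_duhamel q k Ψ le_rfl hr)]
    simp only [map_smul]
  have h1 := hclm (slice (expVec g) ∘L U t) ht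
  simp only [ContinuousLinearMap.comp_apply] at h1
  have hxc : ∀ r, 0 ≤ r → ContinuousOn (fun s => slice (expVec g) (U s Ψ)) (Set.uIcc 0 r) :=
    fun r hr => hU.continuousOn_slice (expVec g) (y := fun _ => Ψ) continuousOn_const le_rfl hr
  have hint1 : IntervalIntegrable (fun s => conj (q (s, k)) • R k (slice (expVec g) (U s Ψ)))
      volume 0 t := (intervalIntegrable_conj_channel q k 0 t).smul_continuousOn
        ((R k).continuous.comp_continuousOn (hxc t ht))
  -- The equation is restarted at time s from U_s† R_k U_s Ψ, which lies in the future space. At the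
  -- initial time the unitaries cancel and leave R_k applied to a slice, the source term.
  have h2 : ∀ s ∈ Set.uIcc 0 t, conj (q (s, k)) • slice (expVec g) (U t (heisenberg R U k Ψ s)) =
      conj (q (s, k)) • R k (slice (expVec g) (U s Ψ)) + ∫ r in s..t, conj (q (s, k)) •
        gen R (driftOp H₀ R) g f r (slice (expVec g) (U r (heisenberg R U k Ψ s))) := by
    intro s hs
    rw [Set.uIcc_of_le ht] at hs
    rw [hU.slice_of_mem hs.1 hs.2 g f (hU.heisenberg_mem k v f hs.1), smul_add,
      intervalIntegral.integral_smul, ← hΨ]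
    congr 2
    rw [heisenberg, hU.apply_adjoint_apply hs.1, slice_ampl]
  have hprod := hU.integrable_duhamel_prod q g f k Ψ (t := t)
  have hint2 : IntervalIntegrable (fun s => ∫ r in s..t, conj (q (s, k)) •
        gen R (driftOp H₀ R) g f r (slice (expVec g) (U r (heisenberg R U k Ψ s)))) volume 0 t := by
    have h3 : IntervalIntegrable (fun s => conj (q (s, k)) •
        slice (expVec g) (U t (heisenberg R U k Ψ s))) volume 0 t := by
      refine (intervalIntegrable_conj_channel q k 0 t).smul_continuousOn ?_
      exact ((slice (expVec g)).continuous.comp (U t).continuous).comp_continuousOn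
        ((hU.continuousOn_heisenberg k Ψ).mono (uIcc_subset_Ici le_rfl ht))
    refine (h3.sub hint1).congr fun s hs => ?_
    have := h2 s (Set.uIoc_subset_uIcc hs)
    change _ - _ = _
    rw [this, add_sub_cancel_left]
  rw [h1, intervalIntegral.integral_congr h2, intervalIntegral.integral_add hint1 hint2,
    integral_triangle_swap ht hprod]
  congr 1
  refine intervalIntegral.integral_congr fun r hr => ?_
  rw [Set.uIcc_of_le ht] at hr
  -- After the exchange of integrals, the inner integral over s in (0, r) is a bounded operator
  -- applied to the Duhamel vector at time r.
  have h4 := hclm (gen R (driftOp H₀ R) g f r ∘L slice (expVec g) ∘L U r) hr.1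
  simp only [ContinuousLinearMap.comp_apply] at h4
  exact h4.symm

end Duhamel

/-! ### The annihilation operators on the output vectors. -/

section OutputAnnihilation

variable {H : Type*} [NormedAddCommGroup H] [InnerProductSpace ℂ H] [CompleteSpace H] {d : ℕ}
  {H₀ : H →L[ℂ] H} {R : Fin d → H →L[ℂ] H} {U : ℝ → SysFock H d →L[ℂ] SysFock H d}

lemma continuous_slice (Φ : SysFock H d) : Continuous fun φ : Fock d => slice φ Φ := by
  rw [continuous_iff_continuousAt]
  intro φ
  rw [ContinuousAt, tendsto_iff_norm_sub_tendsto_zero]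
  have h : Tendsto (fun ψ : Fock d => ‖ψ - φ‖ * ‖Φ‖) (𝓝 φ) (𝓝 0) := by
    have := (tendsto_iff_norm_sub_tendsto_zero.1 (tendsto_id (x := 𝓝 φ))).mul_const ‖Φ‖
    rwa [zero_mul] at this
  refine squeeze_zero (fun _ => norm_nonneg _) (fun ψ => ?_) h
  rw [← slice_sub]
  exact norm_slice_le _ _

/-- The generator depends on g only through the terms conj(g_k) R_k. A shift of g therefore adds a
source, the same as in the equation for the Duhamel integral. -/
lemma gen_add_smul (K : H →L[ℂ] H) (g q f : OneParticle d) (c : ℂ) :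
    ∀ᵐ s : ℝ, ∀ x, gen R K (g + c • q) f s x =
      gen R K g f s x + conj c • ∑ k, conj (q (s, k)) • R k x := by
  filter_upwards [ae_forall_channel (Lp.coeFn_add g (c • q)),
    ae_forall_channel (Lp.coeFn_smul c q)] with s h1 h2 x
  have h3 : ∀ k, conj ((g + c • q : OneParticle d) (s, k)) =
      conj (g (s, k)) + conj c * conj (q (s, k)) := by
    intro k
    rw [h1 k, Pi.add_apply, h2 k, Pi.smul_apply, smul_eq_mul, map_add, map_mul]
  simp only [gen_apply, h3, add_smul, Finset.sum_add_distrib, Finset.smul_sum, mul_smul]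
  abel

/-- The difference quotients of the exponential vectors. -/
def expQuot (q g : OneParticle d) (n : ℕ) : Fock d :=
  ((((n : ℝ) + 1 : ℝ) : ℂ)) • (expVec (g + ((1 / ((n : ℝ) + 1) : ℝ) : ℂ) • q) - expVec g)

lemma tendsto_one_div_add_atTop_complex :
    Tendsto (fun n : ℕ => ((1 / ((n : ℝ) + 1) : ℝ) : ℂ)) atTop (𝓝 0) := by
  have h := (Complex.continuous_ofReal.tendsto 0).comp
    (tendsto_one_div_add_atTop_nhds_zero_nat (𝕜 := ℝ))
  simpa [Function.comp_def] using h

lemma tendsto_expQuot (q g : OneParticle d) : Tendsto (expQuot q g) atTop (𝓝 (crea q g)) := by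
  have h1 := hasDerivAt_iff_tendsto_slope_zero.1 (hasDerivAt_expVec q g)
  have h2 : Tendsto (fun n : ℕ => ((1 / ((n : ℝ) + 1) : ℝ) : ℂ)) atTop (𝓝[≠] 0) := by
    refine tendsto_nhdsWithin_iff.2 ⟨tendsto_one_div_add_atTop_complex,
      Eventually.of_forall fun n => ?_⟩
    rw [Set.mem_compl_iff, Set.mem_singleton_iff, Complex.ofReal_eq_zero]
    positivity
  refine (h1.comp h2).congr fun n => ?_
  rw [Function.comp_apply, expQuot, ← Complex.ofReal_inv, one_div, inv_inv, zero_add, zero_smul,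
    add_zero]

/-- Subtract the slice equations at g + δq and at g and multiply by n + 1 = 1/δ. The change of the
generator contributes a source evaluated at the shifted exponential vector. -/
lemma IsHPEvolution.slice_expQuot (hU : IsHPEvolution H₀ R U) {t : ℝ} (ht : 0 ≤ t) (v : H)
    (q g f : OneParticle d) (n : ℕ) :
    slice (expQuot q g n) (U t (tens v (expVec f))) = slice (expQuot q g n) (tens v (expVec f)) +
      ∫ s in (0 : ℝ)..t,
        (gen R (driftOp H₀ R) g f s (slice (expQuot q g n) (U s (tens v (expVec f)))) +
        ∑ k, conj (q (s, k)) • R k (slice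
          (expVec (g + ((1 / ((n : ℝ) + 1) : ℝ) : ℂ) • q)) (U s (tens v (expVec f))))) := by
  set Ψ := tens v (expVec f) with hΨ
  set δ : ℂ := ((1 / ((n : ℝ) + 1) : ℝ) : ℂ) with hδ
  set c : ℂ := (((n : ℝ) + 1 : ℝ) : ℂ) with hc
  have hcδ : c * δ = 1 := by
    rw [hc, hδ, ← Complex.ofReal_mul, mul_one_div_cancel (by positivity), Complex.ofReal_one]
  have hs : ∀ Φ : SysFock H d, slice (expQuot q g n) Φ =
      c • (slice (expVec (g + δ • q)) Φ - slice (expVec g) Φ) := by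
    intro Φ
    rw [expQuot, slice_smul, slice_sub, Complex.conj_ofReal]
  have hint : ∀ g' : OneParticle d, IntervalIntegrable (fun s => gen R (driftOp H₀ R) g' f s
      (slice (expVec g') (U s Ψ))) volume 0 t := fun g' => intervalIntegrable_gen R _ g' f
    (hU.continuousOn_slice (expVec g') (y := fun _ => Ψ) continuousOn_const le_rfl ht)
  rw [hs, hs, hΨ, hU.slice_expVec ht v g f, hU.slice_expVec ht v (g + δ • q) f, ← hΨ,
    add_sub_add_comm, smul_add, ← intervalIntegral.integral_sub (hint _) (hint _),
    ← intervalIntegral.integral_smul]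
  congr 1
  refine intervalIntegral.integral_congr_ae ?_
  filter_upwards [gen_add_smul (R := R) (driftOp H₀ R) g q f δ] with s h1 _
  rw [h1, hs, map_smul, map_sub, add_sub_right_comm, smul_add, smul_smul]
  congr 1
  have : c * conj δ = 1 := by rw [hδ, Complex.conj_ofReal, ← hδ, hcδ]
  rw [this, one_smul]

/-- The differentiated Hudson–Parthasarathy equation. -/
lemma IsHPEvolution.slice_crea (hU : IsHPEvolution H₀ R U) {t : ℝ} (ht : 0 ≤ t) (v : H)
    (q g f : OneParticle d) :
    slice (crea q g) (U t (tens v (expVec f))) = slice (crea q g) (tens v (expVec f)) +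
      ∫ s in (0 : ℝ)..t,
        (gen R (driftOp H₀ R) g f s (slice (crea q g) (U s (tens v (expVec f)))) +
        ∑ k, conj (q (s, k)) • R k (slice (expVec g) (U s (tens v (expVec f))))) := by
  set Ψ := tens v (expVec f) with hΨ
  have hE : Tendsto (fun n : ℕ => expVec (g + ((1 / ((n : ℝ) + 1) : ℝ) : ℂ) • q)) atTop
      (𝓝 (expVec g)) := by
    have h1 : Continuous fun z : ℂ => expVec (g + z • q) := continuous_expVec.comp (by fun_prop)
    have h2 := (h1.tendsto 0).comp tendsto_one_div_add_atTop_complex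
    simpa [Function.comp_def] using h2
  have hlim : ∀ Φ : SysFock H d, Tendsto (fun n => slice (expQuot q g n) Φ) atTop
      (𝓝 (slice (crea q g) Φ)) := fun Φ =>
    ((continuous_slice Φ).tendsto _).comp (tendsto_expQuot q g)
  have hlimE : ∀ Φ : SysFock H d, Tendsto (fun n : ℕ => slice
      (expVec (g + ((1 / ((n : ℝ) + 1) : ℝ) : ℂ) • q)) Φ) atTop (𝓝 (slice (expVec g) Φ)) :=
    fun Φ => ((continuous_slice Φ).tendsto _).comp hE
  obtain ⟨C₁, hC₁⟩ := (Metric.isBounded_range_of_tendsto _ (tendsto_expQuot q g)).exists_norm_le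
  obtain ⟨C₂, hC₂⟩ := (Metric.isBounded_range_of_tendsto _ hE).exists_norm_le
  have hxc : ∀ φ, ContinuousOn (fun s => slice φ (U s Ψ)) (Set.uIcc 0 t) :=
    fun φ => hU.continuousOn_slice φ (y := fun _ => Ψ) continuousOn_const le_rfl ht
  refine tendsto_nhds_unique (hlim (U t Ψ)) ?_
  rw [tendsto_congr fun n => hU.slice_expQuot ht v q g f n]
  refine (hlim Ψ).add ?_
  -- The domination uses unitarity and the bounds C₁, C₂ of the two convergent sequences of field
  -- vectors; only the one-particle functions depend on s, and these are integrable.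
  refine intervalIntegral.tendsto_integral_filter_of_dominated_convergence
    (fun s => genBound R (driftOp H₀ R) g f s * (C₁ * ‖Ψ‖) +
      ∑ k, ‖q (s, k)‖ * (‖R k‖ * (C₂ * ‖Ψ‖))) ?_ ?_ ?_ ?_
  · refine Eventually.of_forall fun n => ?_
    rw [Set.uIoc_of_le ht]
    refine ((intervalIntegrable_iff_integrableOn_Ioc_of_le ht).1 (IntervalIntegrable.add
      (intervalIntegrable_gen R _ g f (hxc _)) (intervalIntegrable_fun_sum _ fun k _ =>
        (intervalIntegrable_conj_channel q k 0 t).smul_continuousOn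
        ((R k).continuous.comp_continuousOn (hxc _))))).1
  · refine Eventually.of_forall fun n => Eventually.of_forall fun s hs => ?_
    rw [Set.uIoc_of_le ht] at hs
    have hb : ∀ (φ : Fock d) (C : ℝ), ‖φ‖ ≤ C → ‖slice φ (U s Ψ)‖ ≤ C * ‖Ψ‖ := by
      intro φ C hφ
      refine (norm_slice_le _ _).trans ?_
      rw [hU.norm_apply hs.1.le]
      gcongr
    refine (norm_add_le _ _).trans (add_le_add ?_ (norm_sum_le_of_le _ fun k _ => ?_))
    · refine (norm_gen_apply_le R _ g f s _).trans ?_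
      exact mul_le_mul_of_nonneg_left (hb _ _ (hC₁ _ (Set.mem_range_self n)))
        (genBound_nonneg R _ g f s)
    · rw [norm_smul, RCLike.norm_conj]
      refine mul_le_mul_of_nonneg_left ?_ (norm_nonneg _)
      refine (ContinuousLinearMap.le_opNorm _ _).trans ?_
      exact mul_le_mul_of_nonneg_left (hb _ _ (hC₂ _ (Set.mem_range_self n))) (norm_nonneg _)
  · exact ((intervalIntegrable_genBound R _ g f 0 t).mul_const _).add
      (intervalIntegrable_fun_sum _ fun k _ => (intervalIntegrable_channel q k 0 t).norm.mul_const _)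
  · refine Eventually.of_forall fun s _ => Tendsto.add ?_ (tendsto_finsetSum _ fun k _ =>
      Tendsto.const_smul ?_ _)
    · exact ((gen R (driftOp H₀ R) g f s).continuous.tendsto _).comp (hlim (U s Ψ))
    · exact ((R k).continuous.tendsto _).comp (hlimE (U s Ψ))

/-- The output vector `c(q) U_t (v ⊗ E(f))`. -/
def outputAnn (R : Fin d → H →L[ℂ] H) (U : ℝ → SysFock H d →L[ℂ] SysFock H d)
    (q f : OneParticle d) (Ψ : SysFock H d) (t : ℝ) : SysFock H d :=
  ⟪q, f⟫_ℂ • U t Ψ + ∑ k, U t (duhamel R U q k Ψ t)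

/-- The Duhamel formula for `c(q) U_t (v ⊗ E(f))`. -/
lemma IsHPEvolution.slice_crea_eq (hU : IsHPEvolution H₀ R U) {t : ℝ} (ht : 0 ≤ t) (v : H)
    (q g f : OneParticle d) :
    slice (crea q g) (U t (tens v (expVec f))) =
      slice (expVec g) (outputAnn R U q f (tens v (expVec f)) t) := by
  set Ψ := tens v (expVec f) with hΨ
  -- The difference of the two sides. The sources and the initial values cancel, so ζ solves the
  -- homogeneous equation from zero and Gronwall's lemma gives ζ = 0.
  set ζ : ℝ → H := fun s =>
    slice (crea q g) (U s Ψ) - slice (expVec g) (outputAnn R U q f Ψ s) with hζ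
  have hxc : ∀ φ {r : ℝ}, 0 ≤ r → ContinuousOn (fun s => slice φ (U s Ψ)) (Set.uIcc 0 r) :=
    fun φ r hr => hU.continuousOn_slice φ (y := fun _ => Ψ) continuousOn_const le_rfl hr
  have hpc : ∀ k {r : ℝ}, 0 ≤ r → ContinuousOn (fun s => slice (expVec g)
      (U s (duhamel R U q k Ψ s))) (Set.uIcc 0 r) :=
    fun k r hr => hU.continuousOn_slice _ (hU.continuousOn_duhamel q k Ψ) le_rfl hr
  have hχ : ∀ s, slice (expVec g) (outputAnn R U q f Ψ s) = ⟪q, f⟫_ℂ • slice (expVec g) (U s Ψ) +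
      ∑ k, slice (expVec g) (U s (duhamel R U q k Ψ s)) := by
    intro s
    rw [outputAnn, map_add, map_smul, map_sum]
  have hζc : ∀ {r : ℝ}, 0 ≤ r → ContinuousOn ζ (Set.uIcc 0 r) := by
    intro r hr
    simp only [hζ, hχ]
    exact (hxc _ hr).sub (((hxc _ hr).const_smul _).add
      (continuousOn_finsetSum _ fun k _ => hpc k hr))
  have hζeq : ∀ r, 0 ≤ r → ζ r = ∫ s in (0 : ℝ)..r, gen R (driftOp H₀ R) g f s (ζ s) := by
    intro r hr
    have i1 := intervalIntegrable_gen R (driftOp H₀ R) g f (hxc (crea q g) hr)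
    have i2 := intervalIntegrable_gen R (driftOp H₀ R) g f (hxc (expVec g) hr)
    have i3 := fun k => intervalIntegrable_gen R (driftOp H₀ R) g f (hpc k hr)
    have i4 : ∀ k, IntervalIntegrable (fun s => conj (q (s, k)) • R k (slice (expVec g) (U s Ψ)))
        volume 0 r := fun k => (intervalIntegrable_conj_channel q k 0 r).smul_continuousOn
        ((R k).continuous.comp_continuousOn (hxc _ hr))
    have e1 : slice (crea q g) Ψ = ⟪q, f⟫_ℂ • slice (expVec g) Ψ := by
      rw [hΨ, slice_tens, slice_tens, inner_crea_expVec, inner_expVec, mul_smul]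
    have e2 : ∀ s, gen R (driftOp H₀ R) g f s (ζ s) =
        gen R (driftOp H₀ R) g f s (slice (crea q g) (U s Ψ)) -
        (⟪q, f⟫_ℂ • gen R (driftOp H₀ R) g f s (slice (expVec g) (U s Ψ)) +
        ∑ k, gen R (driftOp H₀ R) g f s (slice (expVec g) (U s (duhamel R U q k Ψ s)))) := by
      intro s
      simp only [hζ, hχ, map_sub, map_add, map_smul, map_sum]
    simp_rw [e2]
    have i2' : IntervalIntegrable (fun s => ⟪q, f⟫_ℂ • gen R (driftOp H₀ R) g f s
        (slice (expVec g) (U s Ψ))) volume 0 r := i2.smul _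
    have i3' : IntervalIntegrable (fun s => ∑ k, gen R (driftOp H₀ R) g f s
        (slice (expVec g) (U s (duhamel R U q k Ψ s)))) volume 0 r :=
      intervalIntegrable_fun_sum _ fun k _ => i3 k
    rw [intervalIntegral.integral_sub i1 (i2'.add i3'), intervalIntegral.integral_add i2' i3',
      intervalIntegral.integral_smul, intervalIntegral.integral_finsetSum fun k _ => i3 k]
    simp only [hζ]
    rw [hχ, hΨ, hU.slice_crea hr, hU.slice_expVec hr, ← hΨ, e1,
      intervalIntegral.integral_add i1 (intervalIntegrable_fun_sum _ fun k _ => i4 k),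
      intervalIntegral.integral_finsetSum fun k _ => i4 k,
      Finset.sum_congr rfl fun k _ => hU.slice_duhamel q g f v k hr, Finset.sum_add_distrib,
      smul_add, ← hΨ]
    abel
  have hle : ∀ r ∈ Set.Icc 0 t, ‖ζ r‖ ≤
      ∫ s in (0 : ℝ)..r, genBound R (driftOp H₀ R) g f s * ‖ζ s‖ := by
    intro r hr
    conv_lhs => rw [hζeq r hr.1]
    refine intervalIntegral.norm_integral_le_of_norm_le hr.1
      (Eventually.of_forall fun s _ => norm_gen_apply_le R _ g f s _) ?_
    exact (intervalIntegrable_genBound R _ g f 0 r).mul_continuousOn (hζc hr.1).norm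
  have h0 := nonpos_of_le_integral_mul (z := fun s => ‖ζ s‖)
    (intervalIntegrable_genBound R (driftOp H₀ R) g f 0 t) (genBound_nonneg R _ g f)
    (fun s => norm_nonneg _)
    ((intervalIntegrable_genBound R _ g f 0 t).mul_continuousOn (hζc ht).norm) hle t ⟨ht, le_rfl⟩
  exact sub_eq_zero.1 (norm_le_zero_iff.1 h0)

/-- The vectors `U_T (v ⊗ e(f))` are in the domain of the annihilation operators of the field,
with bounds that are uniform in the mode. -/
lemma IsHPEvolution.exists_output_annihilation (hU : IsHPEvolution H₀ R U) {T : ℝ} (hT : 0 ≤ T)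
    (f : OneParticle d) : ∃ C : ℝ, 0 ≤ C ∧ ∀ (v : H) (q : OneParticle d), ∃ χ : SysFock H d,
      ‖χ‖ ≤ C * ‖q‖ * ‖v‖ ∧ ∀ (u : H) (g : OneParticle d),
        ⟪tens u (crea q g), U T (tens v (coherent f))⟫_ℂ = ⟪tens u (expVec g), χ⟫_ℂ := by
  -- The first term comes from |⟨q, f⟩| ≤ ‖q‖ ‖f‖, the sum from Cauchy–Schwarz in time for the
  -- Duhamel integrals.
  refine ⟨(‖f‖ + ∑ k, √T * ‖ampl d (R k)‖) * ‖coherent f‖, by positivity, fun v q => ?_⟩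
  set c : ℂ := ((Real.exp (-(‖f‖ ^ 2 / 2)) : ℝ) : ℂ) with hc
  have hn : ‖c‖ * ‖tens v (expVec f)‖ = ‖v‖ * ‖coherent f‖ := by
    rw [← norm_smul, ← tens_smul_right, ← norm_tens, coherent_eq]
  refine ⟨c • outputAnn R U q f (tens v (expVec f)) T, ?_, fun u g => ?_⟩
  · have h1 : ‖outputAnn R U q f (tens v (expVec f)) T‖ ≤
        ‖q‖ * ‖f‖ * ‖tens v (expVec f)‖ +
          ∑ k, √T * ‖q‖ * (‖ampl d (R k)‖ * ‖tens v (expVec f)‖) := by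
      rw [outputAnn]
      refine (norm_add_le _ _).trans (add_le_add ?_ (norm_sum_le_of_le _ fun k _ => ?_))
      · rw [norm_smul, hU.norm_apply hT]
        gcongr
        exact norm_inner_le_norm _ _
      · rw [hU.norm_apply hT]
        exact hU.norm_duhamel_le q k _ hT
    rw [norm_smul]
    refine (mul_le_mul_of_nonneg_left h1 (norm_nonneg _)).trans (le_of_eq ?_)
    rw [mul_add, Finset.mul_sum]
    have h2 : ∀ k, ‖c‖ * (√T * ‖q‖ * (‖ampl d (R k)‖ * ‖tens v (expVec f)‖)) =
        √T * ‖ampl d (R k)‖ * (‖q‖ * (‖v‖ * ‖coherent f‖)) := by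
      intro k
      rw [← hn]; ring
    simp_rw [h2]
    rw [← Finset.sum_mul]
    have h3 : ‖c‖ * (‖q‖ * ‖f‖ * ‖tens v (expVec f)‖) = ‖f‖ * (‖q‖ * (‖v‖ * ‖coherent f‖)) := by
      rw [← hn]; ring
    rw [h3]
    ring
  · rw [coherent_eq, tens_smul_right, map_smul, inner_smul_right, inner_smul_right, ← inner_slice,
      ← inner_slice, hU.slice_crea_eq hT]

end OutputAnnihilation

/-! ### Hilbert–Schmidt norms -/

section HilbertSchmidt

variable {E F : Type*} [NormedAddCommGroup E] [InnerProductSpace ℂ E]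
  [NormedAddCommGroup F] [InnerProductSpace ℂ F]

lemma enorm_sq_eq_ofReal {G : Type*} [SeminormedAddCommGroup G] (x : G) :
    ‖x‖ₑ ^ 2 = ENNReal.ofReal (‖x‖ ^ 2) := by
  rw [← ofReal_norm, ENNReal.ofReal_pow (norm_nonneg x)]

lemma tsum_enorm_sq_eq {G : Type*} [SeminormedAddCommGroup G] {ι : Type*} {f : ι → G} {r : ℝ}
    (h : HasSum (fun i => ‖f i‖ ^ 2) r) : ∑' i, ‖f i‖ₑ ^ 2 = ENNReal.ofReal r := by
  simp_rw [enorm_sq_eq_ofReal]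
  rw [← h.tsum_eq, ENNReal.ofReal_tsum_of_nonneg (fun i => by positivity) h.summable]

lemma hasSum_norm_sq_of_tsum {G : Type*} [SeminormedAddCommGroup G] {ι : Type*} {f : ι → G}
    {r : ℝ} (hr : 0 ≤ r) (h : ∑' i, ‖f i‖ₑ ^ 2 = ENNReal.ofReal r) :
    HasSum (fun i => ‖f i‖ ^ 2) r := by
  have h1 : ∀ i, (‖f i‖ₑ ^ 2).toReal = ‖f i‖ ^ 2 := fun i => by
    rw [enorm_sq_eq_ofReal, ENNReal.toReal_ofReal (by positivity)]
  have h2 := ENNReal.hasSum_toReal (f := fun i => ‖f i‖ₑ ^ 2) (by rw [h]; exact ENNReal.ofReal_ne_top)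
  simp_rw [h1] at h2
  rwa [← funext h1, ← ENNReal.tsum_toReal_eq (fun i => by
    rw [enorm_sq_eq_ofReal]; exact ENNReal.ofReal_ne_top), h, ENNReal.toReal_ofReal hr,
    funext h1] at h2

lemma hasSum_norm_sq_inner {ι : Type*} (b : HilbertBasis ι ℂ E) (x : E) :
    HasSum (fun i => ‖⟪b i, x⟫_ℂ‖ ^ 2) (‖x‖ ^ 2) := by
  have h := b.hasSum_inner_mul_inner x x
  have h1 : ∀ i, ⟪x, b i⟫_ℂ * ⟪b i, x⟫_ℂ = ((‖⟪b i, x⟫_ℂ‖ ^ 2 : ℝ) : ℂ) := fun i => by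
    rw [← inner_conj_symm, Complex.ofReal_pow]
    exact Complex.conj_mul' _
  rw [funext h1, inner_self_eq_ofReal] at h
  exact Complex.hasSum_ofReal.1 h

lemma tsum_enorm_sq_inner {ι : Type*} (b : HilbertBasis ι ℂ E) (x : E) :
    ∑' i, ‖⟪b i, x⟫_ℂ‖ₑ ^ 2 = ‖x‖ₑ ^ 2 := by
  rw [tsum_enorm_sq_eq (hasSum_norm_sq_inner b x), enorm_sq_eq_ofReal]

lemma enorm_inner_symm (x y : E) : ‖⟪x, y⟫_ℂ‖ₑ = ‖⟪y, x⟫_ℂ‖ₑ := by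
  rw [← ofReal_norm, ← ofReal_norm, norm_inner_symm]

/-- An operator and its adjoint have the same Hilbert–Schmidt norm. -/
lemma tsum_enorm_sq_adjoint [CompleteSpace E] [CompleteSpace F] {ι κ : Type*}
    (b : HilbertBasis ι ℂ E) (c : HilbertBasis κ ℂ F) (A : E →L[ℂ] F) :
    ∑' i, ‖A (b i)‖ₑ ^ 2 = ∑' j, ‖A.adjoint (c j)‖ₑ ^ 2 := by
  simp_rw [← tsum_enorm_sq_inner c, ← tsum_enorm_sq_inner b]
  rw [ENNReal.tsum_comm]
  refine tsum_congr fun j => tsum_congr fun i => ?_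
  rw [ContinuousLinearMap.adjoint_inner_right, enorm_inner_symm]

lemma tsum_enorm_sq_inner_le {κ : Type*} (χ : κ → E) (x : E) :
    ∑' k, ‖⟪χ k, x⟫_ℂ‖ₑ ^ 2 ≤ (∑' k, ‖χ k‖ₑ ^ 2) * ‖x‖ₑ ^ 2 := by
  rw [← ENNReal.tsum_mul_right]
  refine ENNReal.tsum_le_tsum fun k => ?_
  rw [← mul_pow]
  gcongr
  rw [← ofReal_norm, ← ofReal_norm, ← ofReal_norm,
    ← ENNReal.ofReal_mul (norm_nonneg _)]
  exact ENNReal.ofReal_le_ofReal (norm_inner_le_norm _ _)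

/-- The operator norm is bounded by the Hilbert–Schmidt norm. -/
lemma enorm_apply_sq_le [CompleteSpace E] [CompleteSpace F] {ι : Type*}
    (b : HilbertBasis ι ℂ E) (A : E →L[ℂ] F) (y : F) :
    ‖A.adjoint y‖ₑ ^ 2 ≤ (∑' i, ‖A (b i)‖ₑ ^ 2) * ‖y‖ₑ ^ 2 := by
  rw [← tsum_enorm_sq_inner b]
  simp_rw [ContinuousLinearMap.adjoint_inner_right]
  exact tsum_enorm_sq_inner_le _ _

lemma continuous_tsum_norm_sq_inner {κ : Type*} {χ : κ → E} (hχ : Summable fun k => ‖χ k‖ ^ 2) :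
    Continuous fun x : E => ∑' k, ‖⟪χ k, x⟫_ℂ‖ ^ 2 := by
  refine continuous_iff_continuousAt.2 fun x => ?_
  refine tendsto_tsum_of_dominated_convergence (bound := fun k => ‖χ k‖ ^ 2 * (‖x‖ + 1) ^ 2)
    (hχ.mul_right _) (fun k => ?_) ?_
  · exact Continuous.tendsto (f := fun x => ‖⟪χ k, x⟫_ℂ‖ ^ 2)
      ((continuous_const.inner continuous_id).norm.pow 2) x
  · have h1 : ∀ᶠ y in 𝓝 x, ‖y‖ < ‖x‖ + 1 :=
      (continuous_norm.tendsto x).eventually (gt_mem_nhds (lt_add_one _))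
    filter_upwards [h1] with y hy k
    rw [Real.norm_of_nonneg (by positivity), ← mul_pow]
    gcongr
    exact (norm_inner_le_norm _ _).trans (by gcongr)

end HilbertSchmidt

/-! ### Mixtures and their square roots -/

section Mixture

variable {d : ℕ}

/-- If the vectors of a mixture are in the domain of an annihilation operator, with summable squared
norms, then the range of the square root of the density operator is also in this domain. -/
lemma exists_isAnn_sqrt {κ ι : Type*} (b : HilbertBasis ι ℂ (Fock d)) {φ χ : κ → Fock d}
    {s : Fock d →L[ℂ] Fock d}
    (hs : s.adjoint = s) (hφ : ∀ ψ, ‖s ψ‖ₑ ^ 2 = ∑' k, ‖⟪φ k, ψ⟫_ℂ‖ₑ ^ 2) {q : OneParticle d}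
    (hχ : ∀ k, IsAnn q (φ k) (χ k)) (hfin : ∑' k, ‖χ k‖ₑ ^ 2 ≠ ⊤) :
    ∃ D : Fock d →L[ℂ] Fock d, (∀ ψ, IsAnn q (s ψ) (D ψ)) ∧
      ∑' i, ‖D (b i)‖ₑ ^ 2 = ∑' k, ‖χ k‖ₑ ^ 2 := by
  set M := ∑' k, ‖χ k‖ₑ ^ 2 with hM
  have hsum : Summable fun k => ‖χ k‖ ^ 2 :=
    (hasSum_norm_sq_of_tsum ENNReal.toReal_nonneg (ENNReal.ofReal_toReal hfin).symm).summable
  have hφc : ∀ c : OneParticle d →₀ ℂ, ∀ k,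
      ⟪φ k, Finsupp.linearCombination ℂ (crea q) c⟫_ℂ = ⟪χ k, expSum d c⟫_ℂ := by
    intro c k
    rw [expSum, Finsupp.linearCombination_apply, Finsupp.linearCombination_apply, Finsupp.sum,
      Finsupp.sum, inner_sum, inner_sum]
    refine Finset.sum_congr rfl fun g _ => ?_
    rw [inner_smul_right, inner_smul_right, ← inner_conj_symm, hχ k g, inner_conj_symm]
  have hF : ∀ c : OneParticle d →₀ ℂ,
      Finsupp.linearCombination ℂ (fun g => s (crea q g)) c =
        s (Finsupp.linearCombination ℂ (crea q) c) := by
    intro c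
    rw [Finsupp.linearCombination_apply, Finsupp.linearCombination_apply, Finsupp.sum,
      Finsupp.sum, map_sum]
    simp_rw [map_smul]
  have hF2 : ∀ c : OneParticle d →₀ ℂ,
      ‖Finsupp.linearCombination ℂ (fun g => s (crea q g)) c‖ₑ ^ 2 =
        ∑' k, ‖⟪χ k, expSum d c⟫_ℂ‖ₑ ^ 2 := by
    intro c
    rw [hF, hφ]
    simp_rw [hφc]
  -- B is the bounded extension of E(g) ↦ s c†(q) E(g). Its bound comes from ‖s c†(q)φ‖² = ∑ |⟨χ_k,
  -- φ⟩|² on the exponential span, and its adjoint is the required c(q) s.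
  obtain ⟨B, hB, -⟩ := exists_clm_expVec (fun g => s (crea q g)) (√M.toReal) (fun c => by
    rw [← sq_le_sq₀ (norm_nonneg _) (by positivity), mul_pow, Real.sq_sqrt ENNReal.toReal_nonneg]
    rw [← ENNReal.ofReal_le_ofReal_iff (by positivity), ← enorm_sq_eq_ofReal, hF2,
      ENNReal.ofReal_mul ENNReal.toReal_nonneg, ENNReal.ofReal_toReal hfin, ← enorm_sq_eq_ofReal]
    exact tsum_enorm_sq_inner_le _ _)
  have hB2 : ∀ x, ‖B x‖ ^ 2 = ∑' k, ‖⟪χ k, x⟫_ℂ‖ ^ 2 := by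
    intro x
    refine denseRange_expSum.induction_on (p := fun x => ‖B x‖ ^ 2 = ∑' k, ‖⟪χ k, x⟫_ℂ‖ ^ 2) x
      (isClosed_eq (B.continuous.norm.pow 2) (continuous_tsum_norm_sq_inner hsum)) fun c => ?_
    have h1 : B (expSum d c) = Finsupp.linearCombination ℂ (fun g => s (crea q g)) c := by
      rw [expSum, Finsupp.linearCombination_apply, Finsupp.linearCombination_apply, Finsupp.sum,
        Finsupp.sum, map_sum]
      simp_rw [map_smul, hB]
    rw [h1]
    have h2 := hF2 c
    rw [enorm_sq_eq_ofReal] at h2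
    exact (hasSum_norm_sq_of_tsum (by positivity) h2.symm).tsum_eq.symm
  have hB3 : ∀ x, ‖B x‖ₑ ^ 2 = ∑' k, ‖⟪χ k, x⟫_ℂ‖ₑ ^ 2 := by
    intro x
    have h1 : Summable fun k => ‖⟪χ k, x⟫_ℂ‖ ^ 2 := by
      refine Summable.of_nonneg_of_le (fun k => by positivity) (fun k => ?_)
        (hsum.mul_right (‖x‖ ^ 2))
      rw [← mul_pow]
      gcongr
      exact norm_inner_le_norm _ _
    rw [enorm_sq_eq_ofReal, hB2, tsum_enorm_sq_eq h1.hasSum]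
  refine ⟨B.adjoint, fun ψ g => ?_, ?_⟩
  · rw [ContinuousLinearMap.adjoint_inner_right, hB, ← hs, ContinuousLinearMap.adjoint_inner_right,
      hs]
  · rw [← tsum_enorm_sq_adjoint b b]
    simp_rw [hB3]
    rw [ENNReal.tsum_comm]
    refine tsum_congr fun k => ?_
    rw [← tsum_enorm_sq_inner b]
    exact tsum_congr fun i => by rw [enorm_inner_symm]

end Mixture

/-! ### The reduced field state -/

section ReducedState

variable {H : Type*} [NormedAddCommGroup H] [InnerProductSpace ℂ H] [CompleteSpace H] {d : ℕ}

lemma adjoint_sqrt (A : H →L[ℂ] H) : (CFC.sqrt A).adjoint = CFC.sqrt A := by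
  have h := (ContinuousLinearMap.nonneg_iff_isPositive _).1 (CFC.sqrt_nonneg A)
  exact h.isSelfAdjoint

lemma sqrt_comp_sqrt {A : H →L[ℂ] H} (hA : A.IsPositive) : CFC.sqrt A ∘L CFC.sqrt A = A :=
  CFC.sqrt_mul_sqrt_self A ((ContinuousLinearMap.nonneg_iff_isPositive _).2 hA)

lemma inner_apply_eq_norm_sqrt {A : H →L[ℂ] H} (hA : A.IsPositive) (x : H) :
    ⟪x, A x⟫_ℂ = ((‖CFC.sqrt A x‖ ^ 2 : ℝ) : ℂ) := by
  have h : ⟪x, A x⟫_ℂ = ⟪x, (CFC.sqrt A ∘L CFC.sqrt A) x⟫_ℂ := by rw [sqrt_comp_sqrt hA]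
  rw [h, ContinuousLinearMap.comp_apply, ← inner_self_eq_ofReal]
  conv_lhs => rw [← adjoint_sqrt A, ContinuousLinearMap.adjoint_inner_right]
  rw [adjoint_sqrt]

lemma IsState.tsum_sqrt {ρ : H →L[ℂ] H} (hρ : IsState ρ) :
    ∑' k, ‖CFC.sqrt ρ (basis H k)‖ₑ ^ 2 = 1 := by
  have h := hρ.hasSum_trace
  simp_rw [inner_apply_eq_norm_sqrt hρ.isPositive] at h
  have h2 : HasSum (fun k => ‖CFC.sqrt ρ (basis H k)‖ ^ 2) 1 :=
    Complex.hasSum_ofReal.1 (by simpa using h)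
  rw [tsum_enorm_sq_eq h2, ENNReal.ofReal_one]

/-- The slices `(b_i ⊗ 1)† V (√ρ b_k ⊗ e(f))` which decompose the reduced field state. -/
def fieldVec (ρ : H →L[ℂ] H) (f : OneParticle d) (V : SysFock H d →L[ℂ] SysFock H d)
    (p : basisIndex H × basisIndex H) : Fock d :=
  (tensorLeft (basis H p.1)).adjoint (V (tens (CFC.sqrt ρ (basis H p.2)) (coherent f)))

lemma tsum_slice (Ψ : SysFock H d) :
    ∑' i, ‖(tensorLeft (basis H i)).adjoint Ψ‖ₑ ^ 2 = ‖Ψ‖ₑ ^ 2 := by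
  rw [tsum_enorm_sq_eq (hasSum_norm_sq_slice (basis H) Ψ), enorm_sq_eq_ofReal]

lemma norm_coherent (f : OneParticle d) : ‖coherent f‖ = 1 := by
  have h := inner_self_eq_ofReal (coherent f)
  rw [inner_coherent, inner_self_eq_ofReal, ← Complex.exp_add] at h
  have h1 : -((‖f‖ : ℂ) ^ 2 / 2) - (‖f‖ : ℂ) ^ 2 / 2 + ((‖f‖ ^ 2 : ℝ) : ℂ) = 0 := by
    push_cast; ring
  rw [h1, Complex.exp_zero, ← Complex.ofReal_one] at h
  exact (pow_eq_one_iff_of_nonneg (norm_nonneg _) two_ne_zero).1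
    (Complex.ofReal_injective h).symm

lemma tsum_fieldVec {ρ : H →L[ℂ] H} (hρ : IsState ρ) (f : OneParticle d)
    {V : SysFock H d →L[ℂ] SysFock H d} (hV : ∀ Ψ, ‖V Ψ‖ = ‖Ψ‖) :
    ∑' p, ‖fieldVec ρ f V p‖ₑ ^ 2 = 1 := by
  rw [ENNReal.tsum_prod', ENNReal.tsum_comm, ← hρ.tsum_sqrt]
  refine tsum_congr fun k => ?_
  simp only [fieldVec]
  rw [tsum_slice, ← ofReal_norm, hV, norm_tens, norm_coherent, mul_one,
    ofReal_norm]

/-- The partial trace is ∑ S_i S_i†, and ‖S_i S_i†‖ is at most the squared Hilbert–Schmidt norm of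
S_i. These add up to 1, so the series converges in operator norm and its infinite sum is not a
default value. -/
lemma hasSum_inner_reducedFieldState {ρ : H →L[ℂ] H} (hρ : IsState ρ) (f : OneParticle d)
    {V : SysFock H d →L[ℂ] SysFock H d} (hV : ∀ Ψ, ‖V Ψ‖ = ‖Ψ‖) (ψ : Fock d) :
    ∃ r : ℝ, 0 ≤ r ∧ ⟪ψ, reducedFieldState ρ f V ψ⟫_ℂ = (r : ℂ) ∧
      ENNReal.ofReal r = ∑' p, ‖⟪fieldVec ρ f V p, ψ⟫_ℂ‖ₑ ^ 2 := by
  set S : basisIndex H → H →L[ℂ] Fock d := fun i =>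
    (tensorLeft (basis H i)).adjoint ∘L V ∘L tensorRight (coherent f) ∘L CFC.sqrt ρ with hS
  have hSk : ∀ i k, S i (basis H k) = fieldVec ρ f V (i, k) := fun i k => rfl
  have hA : ∀ i, (tensorLeft (basis H i)).adjoint ∘L totalState ρ f V ∘L tensorLeft (basis H i) =
      S i ∘L (S i).adjoint := by
    intro i
    simp only [hS, totalState, ContinuousLinearMap.adjoint_comp, adjoint_sqrt,
      ContinuousLinearMap.adjoint_adjoint]
    conv_lhs => rw [← sqrt_comp_sqrt hρ.isPositive]
    simp only [ContinuousLinearMap.comp_assoc]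
  have hfin : ∑' i, ∑' k, ‖S i (basis H k)‖ₑ ^ 2 = 1 := by
    rw [← tsum_fieldVec hρ f hV, ENNReal.tsum_prod']
    rfl
  set m : basisIndex H → ℝ := fun i => (∑' k, ‖S i (basis H k)‖ₑ ^ 2).toReal with hm
  have hne : ∀ i, ∑' k, ‖S i (basis H k)‖ₑ ^ 2 ≠ ⊤ := fun i =>
    ENNReal.ne_top_of_tsum_ne_top (by rw [hfin]; exact ENNReal.one_ne_top) i
  have hms : Summable m := ENNReal.summable_toReal (by rw [hfin]; exact ENNReal.one_ne_top)
  have hSadj : ∀ i y, ‖(S i).adjoint y‖ ^ 2 ≤ m i * ‖y‖ ^ 2 := by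
    intro i y
    rw [← ENNReal.ofReal_le_ofReal_iff (by positivity), ← enorm_sq_eq_ofReal,
      ENNReal.ofReal_mul ENNReal.toReal_nonneg, ENNReal.ofReal_toReal (hne i),
      ← enorm_sq_eq_ofReal]
    exact enorm_apply_sq_le (basis H) (S i) y
  have hSn : ∀ i, ‖S i ∘L (S i).adjoint‖ ≤ m i := by
    intro i
    have h1 : ‖(S i).adjoint‖ ≤ √(m i) := by
      refine ContinuousLinearMap.opNorm_le_bound _ (Real.sqrt_nonneg _) fun y => ?_
      rw [← sq_le_sq₀ (norm_nonneg _) (by positivity), mul_pow,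
        Real.sq_sqrt ENNReal.toReal_nonneg]
      exact hSadj i y
    refine (ContinuousLinearMap.opNorm_comp_le _ _).trans ?_
    rw [← LinearIsometryEquiv.norm_map ContinuousLinearMap.adjoint (S i)]
    refine (mul_le_mul h1 h1 (norm_nonneg _) (Real.sqrt_nonneg _)).trans_eq ?_
    exact Real.mul_self_sqrt ENNReal.toReal_nonneg
  have hsum : Summable fun i => S i ∘L (S i).adjoint := Summable.of_norm_bounded hms hSn
  have hϱ : HasSum (fun i => S i ∘L (S i).adjoint) (reducedFieldState ρ f V) := by
    rw [reducedFieldState, partialTrace]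
    simp_rw [hA]
    exact hsum.hasSum
  have h1 : HasSum (fun i => ⟪ψ, (S i ∘L (S i).adjoint) ψ⟫_ℂ) ⟪ψ, reducedFieldState ρ f V ψ⟫_ℂ := by
    have := hϱ.mapL (innerSL ℂ ψ ∘L ContinuousLinearMap.apply ℂ (Fock d) ψ)
    exact this
  have h2 : ∀ i, ⟪ψ, (S i ∘L (S i).adjoint) ψ⟫_ℂ = ((‖(S i).adjoint ψ‖ ^ 2 : ℝ) : ℂ) := by
    intro i
    rw [ContinuousLinearMap.comp_apply, ← inner_self_eq_ofReal,
      ContinuousLinearMap.adjoint_inner_left]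
  have h3 : Summable fun i => ‖(S i).adjoint ψ‖ ^ 2 :=
    Summable.of_nonneg_of_le (fun i => by positivity) (fun i => hSadj i ψ) (hms.mul_right _)
  refine ⟨∑' i, ‖(S i).adjoint ψ‖ ^ 2, tsum_nonneg fun i => by positivity, ?_, ?_⟩
  · rw [funext h2] at h1
    exact h1.unique (Complex.hasSum_ofReal.2 h3.hasSum)
  · rw [← tsum_enorm_sq_eq h3.hasSum, ENNReal.tsum_prod']
    refine tsum_congr fun i => ?_
    rw [← tsum_enorm_sq_inner (basis H)]
    refine tsum_congr fun k => ?_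
    rw [ContinuousLinearMap.adjoint_inner_right, hSk]

lemma isPositive_reducedFieldState {ρ : H →L[ℂ] H} (hρ : IsState ρ) (f : OneParticle d)
    {V : SysFock H d →L[ℂ] SysFock H d} (hV : ∀ Ψ, ‖V Ψ‖ = ‖Ψ‖) :
    (reducedFieldState ρ f V).IsPositive := by
  refine (ContinuousLinearMap.isPositive_iff_complex _).2 fun ψ => ?_
  obtain ⟨r, hr, h, -⟩ := hasSum_inner_reducedFieldState hρ f hV ψ
  rw [← inner_conj_symm, h, Complex.conj_ofReal]
  exact ⟨by simp, by simpa using hr⟩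

lemma enorm_sqrt_reducedFieldState {ρ : H →L[ℂ] H} (hρ : IsState ρ) (f : OneParticle d)
    {V : SysFock H d →L[ℂ] SysFock H d} (hV : ∀ Ψ, ‖V Ψ‖ = ‖Ψ‖) (ψ : Fock d) :
    ‖CFC.sqrt (reducedFieldState ρ f V) ψ‖ₑ ^ 2 = ∑' p, ‖⟪fieldVec ρ f V p, ψ⟫_ℂ‖ₑ ^ 2 := by
  obtain ⟨r, hr, h, h2⟩ := hasSum_inner_reducedFieldState hρ f hV ψ
  rw [inner_apply_eq_norm_sqrt (isPositive_reducedFieldState hρ f hV)] at h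
  rw [← h2, ← Complex.ofReal_injective h, enorm_sq_eq_ofReal]

lemma tsum_sqrt_reducedFieldState {ρ : H →L[ℂ] H} (hρ : IsState ρ) (f : OneParticle d)
    {V : SysFock H d →L[ℂ] SysFock H d} (hV : ∀ Ψ, ‖V Ψ‖ = ‖Ψ‖) :
    ∑' i, ‖CFC.sqrt (reducedFieldState ρ f V) (basis (Fock d) i)‖ₑ ^ 2 = 1 := by
  simp_rw [enorm_sqrt_reducedFieldState hρ f hV]
  rw [ENNReal.tsum_comm, ← tsum_fieldVec hρ f hV]
  refine tsum_congr fun p => ?_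
  rw [← tsum_enorm_sq_inner (basis (Fock d))]
  exact tsum_congr fun i => by rw [enorm_inner_symm]

/-- The annihilation operators have finite second moments in the output state. -/
lemma IsHPEvolution.exists_isAnn_reducedFieldState {H₀ : H →L[ℂ] H} {R : Fin d → H →L[ℂ] H}
    {U : ℝ → SysFock H d →L[ℂ] SysFock H d} (hU : IsHPEvolution H₀ R U) {T : ℝ} (hT : 0 ≤ T)
    {ρ : H →L[ℂ] H} (hρ : IsState ρ) (f : OneParticle d) :
    ∃ C : ℝ, 0 ≤ C ∧ ∀ q, ∃ D : Fock d →L[ℂ] Fock d,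
      (∀ ψ, IsAnn q (CFC.sqrt (reducedFieldState ρ f (U T)) ψ) (D ψ)) ∧
      ∑' i, ‖D (basis (Fock d) i)‖ₑ ^ 2 ≤ ENNReal.ofReal ((C * ‖q‖) ^ 2) := by
  obtain ⟨C, hC, h⟩ := hU.exists_output_annihilation hT f
  refine ⟨C, hC, fun q => ?_⟩
  choose χ hχn hχ using fun v => h v q
  have hsum : ∑' p : basisIndex H × basisIndex H, ‖(tensorLeft (basis H p.1)).adjoint
      (χ (CFC.sqrt ρ (basis H p.2)))‖ₑ ^ 2 ≤ ENNReal.ofReal ((C * ‖q‖) ^ 2) := by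
    rw [ENNReal.tsum_prod', ENNReal.tsum_comm]
    simp only [tsum_slice]
    rw [← mul_one (ENNReal.ofReal _), ← hρ.tsum_sqrt, ← ENNReal.tsum_mul_left]
    refine ENNReal.tsum_le_tsum fun k => ?_
    rw [enorm_sq_eq_ofReal, enorm_sq_eq_ofReal, ← ENNReal.ofReal_mul (by positivity), ← mul_pow]
    refine ENNReal.ofReal_le_ofReal ?_
    have := hχn (CFC.sqrt ρ (basis H k))
    gcongr
  have hs := enorm_sqrt_reducedFieldState hρ f (V := U T) fun Ψ => hU.norm_apply hT Ψ
  have ha := adjoint_sqrt (reducedFieldState ρ f (U T))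
  -- Slicing along a system vector does not touch the field factor, so it carries weak annihilation
  -- relations from ℋ ⊗ Γ to Γ.
  have hχ' : ∀ p : basisIndex H × basisIndex H, IsAnn q (fieldVec ρ f (U T) p)
      ((tensorLeft (basis H p.1)).adjoint (χ (CFC.sqrt ρ (basis H p.2)))) := by
    intro p g
    rw [fieldVec, ContinuousLinearMap.adjoint_inner_right,
      ContinuousLinearMap.adjoint_inner_right]
    exact hχ _ _ g
  generalize CFC.sqrt (reducedFieldState ρ f (U T)) = s at hs ha ⊢
  obtain ⟨D, hD, hD2⟩ := exists_isAnn_sqrt (basis (Fock d)) ha hs hχ'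
    (ne_top_of_le_ne_top ENNReal.ofReal_ne_top hsum)
  exact ⟨D, hD, hD2.trans_le hsum⟩

end ReducedState

/-! ### One-particle vectors of the first channel -/

section FirstChannel

variable {d : ℕ} [NeZero d] {c c' : ℝ → ℂ} {s t T : ℝ}

/-- The function defining `firstChannel` is square integrable. -/
def IsFirstChannel (d : ℕ) [NeZero d] (c : ℝ → ℂ) (t : ℝ) : Prop :=
  MemLp (fun x : Label d => if x.2 = 0 ∧ x.1 ∈ Set.Icc 0 t then c x.1 else 0) 2 (labelMeasure d)

lemma isFirstChannel_of_bound (hc : Measurable c) {M : ℝ} (hb : ∀ s ∈ Set.Icc 0 t, ‖c s‖ ≤ M) :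
    IsFirstChannel d c t := by
  set S : Set (Label d) := Set.Icc 0 t ×ˢ {0} with hS
  have hSm : MeasurableSet S := measurableSet_Icc.prod (measurableSet_singleton 0)
  have h1 : (fun x : Label d => if x.2 = 0 ∧ x.1 ∈ Set.Icc 0 t then c x.1 else 0) =
      S.indicator fun x => c x.1 := by
    funext x
    by_cases h : x ∈ S
    · rw [Set.indicator_of_mem h, if_pos ⟨h.2, h.1⟩]
    · rw [Set.indicator_of_notMem h, if_neg fun h' => h ⟨h'.2, h'.1⟩]
  have h2 : labelMeasure d S ≠ ⊤ := by
    rw [labelMeasure, hS, Measure.prod_prod, Measure.count_singleton, mul_one, Real.volume_Icc]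
    exact ENNReal.ofReal_ne_top
  have : IsFiniteMeasure ((labelMeasure d).restrict S) := ⟨by
    rw [Measure.restrict_apply_univ]; exact h2.lt_top⟩
  rw [IsFirstChannel, h1, memLp_indicator_iff_restrict hSm]
  refine MemLp.of_bound (hc.comp measurable_fst).aestronglyMeasurable M ?_
  exact (ae_restrict_mem hSm).mono fun x hx => hb _ hx.1

lemma coeFn_firstChannel (hc : IsFirstChannel d c t) :
    firstChannel d c t =ᵐ[labelMeasure d]
      fun x : Label d => if x.2 = 0 ∧ x.1 ∈ Set.Icc 0 t then c x.1 else 0 := by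
  have h : firstChannel d c t = MemLp.toLp _ hc := dif_pos hc
  rw [h]
  exact MemLp.coeFn_toLp hc

lemma inner_firstChannel (hc : IsFirstChannel d c t) (ht : 0 ≤ t) (g : OneParticle d) :
    ⟪g, firstChannel d c t⟫_ℂ = ∫ s in (0 : ℝ)..t, conj (g (s, 0)) * c s := by
  have h1 := L2.integrable_inner (𝕜 := ℂ) g (firstChannel d c t)
  have h2 : (fun x => ⟪g x, firstChannel d c t x⟫_ℂ) =ᵐ[labelMeasure d] fun x =>
      if x.2 = 0 ∧ x.1 ∈ Set.Icc 0 t then conj (g x) * c x.1 else 0 := by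
    filter_upwards [coeFn_firstChannel hc] with x hx
    rw [hx]
    by_cases h : x.2 = 0 ∧ x.1 ∈ Set.Icc 0 t
    · rw [if_pos h, if_pos h, RCLike.inner_apply, mul_comm]
    · rw [if_neg h, if_neg h, inner_zero_right]
  rw [L2.inner_def, integral_congr_ae h2]
  refine (integral_prod _ (h1.congr h2)).trans ?_
  rw [intervalIntegral.integral_of_le ht,
    ← integral_Icc_eq_integral_Ioc, ← integral_indicator measurableSet_Icc]
  refine integral_congr_ae (Eventually.of_forall fun s => ?_)
  change ∫ k : Fin d, (if k = 0 ∧ s ∈ Set.Icc 0 t then conj (g (s, k)) * c s else 0)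
    ∂Measure.count = _
  rw [integral_count, Finset.sum_eq_single 0]
  · by_cases h : s ∈ Set.Icc 0 t
    · rw [Set.indicator_of_mem h, if_pos ⟨rfl, h⟩]
    · rw [Set.indicator_of_notMem h, if_neg fun h' => h h'.2]
  · intro k _ hk
    rw [if_neg fun h' => hk h'.1]
  · intro h
    exact absurd (Finset.mem_univ _) h

lemma IsFirstChannel.const_mul (hc : IsFirstChannel d c t) (a : ℂ) :
    IsFirstChannel d (fun s => a * c s) t := by
  have h := MemLp.const_mul hc a
  simp only [mul_ite, mul_zero] at h
  exact h

lemma IsFirstChannel.add (hc : IsFirstChannel d c t) (hc' : IsFirstChannel d c' t) :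
    IsFirstChannel d (fun s => c s + c' s) t := by
  have h := MemLp.add hc hc'
  refine h.ae_eq (Eventually.of_forall fun x => ?_)
  simp only [Pi.add_apply]
  by_cases hx : x.2 = 0 ∧ x.1 ∈ Set.Icc 0 t
  · rw [if_pos hx, if_pos hx, if_pos hx]
  · rw [if_neg hx, if_neg hx, if_neg hx, add_zero]

lemma firstChannel_const_mul (hc : IsFirstChannel d c t) (a : ℂ) :
    firstChannel d (fun s => a * c s) t = a • firstChannel d c t := by
  refine Lp.ext ?_
  filter_upwards [coeFn_firstChannel hc, coeFn_firstChannel (hc.const_mul a),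
    Lp.coeFn_smul a (firstChannel d c t)] with x h1 h2 h3
  rw [h2, h3, Pi.smul_apply, h1, smul_eq_mul, mul_ite, mul_zero]

lemma firstChannel_add (hc : IsFirstChannel d c t) (hc' : IsFirstChannel d c' t) :
    firstChannel d (fun s => c s + c' s) t = firstChannel d c t + firstChannel d c' t := by
  refine Lp.ext ?_
  filter_upwards [coeFn_firstChannel hc, coeFn_firstChannel hc', coeFn_firstChannel (hc.add hc'),
    Lp.coeFn_add (firstChannel d c t) (firstChannel d c' t)] with x h1 h2 h3 h4
  rw [h3, h4, Pi.add_apply, h1, h2]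
  split_ifs <;> simp

/-- A measurable function of modulus one on `[0,T]`. -/
structure IsPhase (c : ℝ → ℂ) (T : ℝ) : Prop where
  measurable : Measurable c
  norm_eq : ∀ s ∈ Set.Icc 0 T, ‖c s‖ = 1

lemma IsPhase.isFirstChannel (hc : IsPhase c T) (ht : t ≤ T) : IsFirstChannel d c t :=
  isFirstChannel_of_bound hc.measurable (M := 1) fun s hs => (hc.norm_eq s ⟨hs.1, hs.2.trans ht⟩).le

lemma IsPhase.inner_firstChannel_firstChannel (hc : IsPhase c T) (hs : 0 ≤ s) (hst : s ≤ t)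
    (ht : t ≤ T) : ⟪firstChannel d c s, firstChannel d c t⟫_ℂ = s := by
  rw [← inner_conj_symm, inner_firstChannel (hc.isFirstChannel (hst.trans ht)) hs]
  have h1 := ae_forall_channel (coeFn_firstChannel (d := d) (hc.isFirstChannel ht))
  have h2 : ∫ r in (0 : ℝ)..s, conj (firstChannel d c t (r, 0)) * c r =
      ∫ _ in (0 : ℝ)..s, (1 : ℂ) := by
    refine intervalIntegral.integral_congr_ae ?_
    filter_upwards [h1] with r hr hrs
    rw [Set.uIoc_of_le hs] at hrs
    have hr2 : r ∈ Set.Icc 0 t := ⟨hrs.1.le, hrs.2.trans hst⟩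
    rw [hr 0, if_pos ⟨rfl, hr2⟩]
    have := Complex.conj_mul' (c r)
    rw [this, hc.norm_eq r ⟨hr2.1, hr2.2.trans ht⟩]
    simp
  rw [h2]
  simp

lemma IsPhase.norm_firstChannel_sq (hc : IsPhase c T) (ht0 : 0 ≤ t) (ht : t ≤ T) :
    ‖firstChannel d c t‖ ^ 2 = t := by
  have h := hc.inner_firstChannel_firstChannel (d := d) ht0 le_rfl ht
  rw [inner_self_eq_ofReal] at h
  exact Complex.ofReal_injective h

lemma IsPhase.norm_firstChannel_sub_sq (hc : IsPhase c T) (hs : 0 ≤ s) (hst : s ≤ t)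
    (ht : t ≤ T) : ‖firstChannel d c t - firstChannel d c s‖ ^ 2 = t - s := by
  rw [norm_sub_rev, @norm_sub_sq ℂ, hc.norm_firstChannel_sq (hs.trans hst) ht,
    hc.norm_firstChannel_sq hs (hst.trans ht), hc.inner_firstChannel_firstChannel hs hst ht]
  have : RCLike.re (s : ℂ) = s := Complex.ofReal_re s
  rw [this]
  ring

/-- As |c| = 1, the squared increments are exactly |t - s|, so the curve is Hölder continuous of
exponent 1/2. -/
lemma IsPhase.continuousOn_firstChannel (hc : IsPhase c T) :
    ContinuousOn (fun t => firstChannel d c t) (Set.Icc 0 T) := by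
  have h1 : ∀ s ∈ Set.Icc 0 T, ∀ t ∈ Set.Icc 0 T,
      ‖firstChannel d c t - firstChannel d c s‖ ≤ √|t - s| := by
    intro s hs t ht
    rw [← Real.sqrt_sq (norm_nonneg _)]
    refine Real.sqrt_le_sqrt ?_
    rcases le_total s t with h | h
    · rw [hc.norm_firstChannel_sub_sq hs.1 h ht.2]
      exact le_abs_self _
    · rw [norm_sub_rev, hc.norm_firstChannel_sub_sq ht.1 h hs.2, abs_sub_comm]
      exact le_abs_self _
  intro s hs
  rw [ContinuousWithinAt, tendsto_iff_norm_sub_tendsto_zero]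
  have h2 : Tendsto (fun t => √|t - s|) (𝓝[Set.Icc 0 T] s) (𝓝 0) := by
    have : Continuous fun t => √|t - s| := by fun_prop
    simpa using (this.tendsto s).mono_left nhdsWithin_le_nhds
  refine squeeze_zero' (Eventually.of_forall fun t => norm_nonneg _) ?_ h2
  filter_upwards [self_mem_nhdsWithin] with t ht
  exact h1 s hs t ht

/-- Integration by parts for vectors of the first channel. -/
lemma IsPhase.firstChannel_mul (hc : IsPhase c T) (hT : 0 ≤ T) {k : ℝ → ℝ}
    (hk : Differentiable ℝ k) (hk' : Continuous (deriv k)) :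
    firstChannel d (fun s => (k s : ℂ) * c s) T =
      k T • firstChannel d c T - ∫ t in (0 : ℝ)..T, deriv k t • firstChannel d c t := by
  have hkc := hk.continuous
  obtain ⟨M, hM⟩ := (isCompact_Icc (a := (0 : ℝ)) (b := T)).exists_bound_of_continuousOn
    hkc.continuousOn
  have hmul : IsFirstChannel d (fun s => (k s : ℂ) * c s) T := by
    refine isFirstChannel_of_bound (M := M)
      ((Complex.measurable_ofReal.comp hkc.measurable).mul hc.measurable) fun s hs => ?_
    rw [norm_mul, hc.norm_eq s hs, mul_one, Complex.norm_real]
    exact hM s hs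
  have hint : IntervalIntegrable (fun t => deriv k t • firstChannel d c t) volume 0 T := by
    refine ContinuousOn.intervalIntegrable ?_
    rw [Set.uIcc_of_le hT]
    exact hk'.continuousOn.smul hc.continuousOn_firstChannel
  refine ext_inner_left ℂ fun g => ?_
  set G : ℝ → ℂ := fun s => conj (g (s, 0)) * c s with hG
  have hGi : IntegrableOn G (Set.Ioc 0 T) := by
    have h1 := (intervalIntegrable_iff_integrableOn_Ioc_of_le hT).1
      (intervalIntegrable_conj_channel g 0 0 T)
    refine Integrable.mul_bdd (c := 1) h1 hc.measurable.aestronglyMeasurable ?_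
    exact (ae_restrict_mem measurableSet_Ioc).mono fun s hs =>
      (hc.norm_eq s (Set.Ioc_subset_Icc_self hs)).le
  have hGI : IntervalIntegrable G volume 0 T :=
    (intervalIntegrable_iff_integrableOn_Ioc_of_le hT).2 hGi
  -- The curve t ↦ `firstChannel d c t` is not assumed differentiable, so parts are taken weakly:
  -- paired with g, the formula reduces to exchanging two integrals on the triangle and to ∫ₛᵀ k' =
  -- k(T) - k(s).
  have e1 : ⟪g, ∫ t in (0 : ℝ)..T, deriv k t • firstChannel d c t⟫_ℂ =
      ∫ t in (0 : ℝ)..T, ∫ s in (0 : ℝ)..t, ((deriv k t : ℝ) : ℂ) * G s := by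
    rw [← innerSL_apply_apply ℂ, ← ContinuousLinearMap.intervalIntegral_comp_comm _ hint]
    refine intervalIntegral.integral_congr fun t ht => ?_
    rw [Set.uIcc_of_le hT] at ht
    change ⟪g, deriv k t • firstChannel d c t⟫_ℂ = _
    rw [intervalIntegral.integral_const_mul, ← inner_firstChannel (hc.isFirstChannel ht.2) ht.1,
      inner_smul_right_eq_smul, Complex.real_smul]
  have e2 : ∫ t in (0 : ℝ)..T, ∫ s in (0 : ℝ)..t, ((deriv k t : ℝ) : ℂ) * G s =
      ∫ s in (0 : ℝ)..T, ∫ t in s..T, ((deriv k t : ℝ) : ℂ) * G s := by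
    refine (integral_triangle_swap (F := fun s t => ((deriv k t : ℝ) : ℂ) * G s) hT ?_).symm
    have h2 : Integrable (fun t => ((deriv k t : ℝ) : ℂ)) (volume.restrict (Set.Ioc 0 T)) :=
      ((Complex.continuous_ofReal.comp hk').continuousOn.integrableOn_compact
        isCompact_Icc).mono_set Set.Ioc_subset_Icc_self
    have h3 := hGi.integrable.mul_prod h2
    refine h3.congr (Eventually.of_forall fun p => ?_)
    exact mul_comm _ _
  have e3 : ∫ s in (0 : ℝ)..T, ∫ t in s..T, ((deriv k t : ℝ) : ℂ) * G s =
      ∫ s in (0 : ℝ)..T, ((k T : ℂ) * G s - (k s : ℂ) * G s) := by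
    refine intervalIntegral.integral_congr fun s _ => ?_
    rw [intervalIntegral.integral_mul_const, intervalIntegral.integral_ofReal,
      intervalIntegral.integral_deriv_eq_sub (fun x _ => hk x) (hk'.intervalIntegrable _ _)]
    push_cast
    ring
  have hkG : IntervalIntegrable (fun s => (k s : ℂ) * G s) volume 0 T :=
    hGI.continuousOn_mul (Complex.continuous_ofReal.comp hkc).continuousOn
  rw [inner_sub_right, e1, e2, e3, intervalIntegral.integral_sub (hGI.const_mul _) hkG,
    intervalIntegral.integral_const_mul, inner_smul_right_eq_smul, Complex.real_smul,
    inner_firstChannel (hc.isFirstChannel le_rfl) hT, inner_firstChannel hmul hT, sub_sub_cancel]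
  refine intervalIntegral.integral_congr fun s _ => ?_
  simp only [hG]
  ring

end FirstChannel

/-! ### Riemann sums -/

/-- The Riemann sums of a continuous function converge to its integral. -/
lemma tendsto_riemannSum {X : Type*} [NormedAddCommGroup X] [NormedSpace ℝ X] [CompleteSpace X]
    {F : ℝ → X} {T : ℝ} (hT : 0 ≤ T) (hF : ContinuousOn F (Set.Icc 0 T)) :
    Tendsto (fun n : ℕ => ∑ j ∈ Finset.range (n + 1),
      (T / (n + 1)) • F (j * (T / (n + 1)))) atTop (𝓝 (∫ t in (0 : ℝ)..T, F t)) := by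
  rw [Metric.tendsto_atTop]
  intro ε hε
  -- T + 1 instead of T keeps the quotient meaningful when T = 0; the factor 2 makes the final
  -- inequality strict.
  set ε' := ε / (2 * (T + 1)) with hε'
  have hε'0 : 0 < ε' := by positivity
  obtain ⟨δ, hδ, hδF⟩ := Metric.uniformContinuousOn_iff.1
    (isCompact_Icc.uniformContinuousOn_of_continuous hF) ε' hε'0
  obtain ⟨N, hN⟩ := exists_nat_gt (T / δ)
  refine ⟨N, fun n hn => ?_⟩
  have hn1 : (0 : ℝ) < (n : ℝ) + 1 := by positivity
  set p : ℝ := T / (n + 1) with hp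
  have hp0 : 0 ≤ p := by positivity
  have hpn : ((n + 1 : ℕ) : ℝ) * p = T := by
    rw [hp]; push_cast; field_simp
  have hpδ : p < δ := by
    rw [hp, div_lt_iff₀ hn1]
    rw [div_lt_iff₀ hδ] at hN
    have : (N : ℝ) ≤ n := by exact_mod_cast hn
    nlinarith
  set a : ℕ → ℝ := fun j => j * p with ha
  have haT : ∀ j ≤ n + 1, a j ∈ Set.Icc 0 T := by
    intro j hj
    refine ⟨by positivity, ?_⟩
    rw [← hpn]
    exact mul_le_mul_of_nonneg_right (by exact_mod_cast hj) hp0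
  have hastep : ∀ j, a (j + 1) - a j = p := fun j => by simp only [ha]; push_cast; ring
  have hle : ∀ j, a j ≤ a (j + 1) := fun j => by linarith [hastep j]
  have hii : ∀ j < n + 1, IntervalIntegrable F volume (a j) (a (j + 1)) := by
    intro j hj
    refine ContinuousOn.intervalIntegrable ?_
    rw [Set.uIcc_of_le (hle j)]
    exact hF.mono (Set.Icc_subset_Icc (haT j hj.le).1 (haT (j + 1) hj).2)
  have h1 : ∫ t in (0 : ℝ)..T, F t = ∑ j ∈ Finset.range (n + 1), ∫ t in a j..a (j + 1), F t := by
    rw [intervalIntegral.sum_integral_adjacent_intervals hii]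
    simp only [ha, hpn, Nat.cast_zero, zero_mul]
  have h2 : ∀ j ∈ Finset.range (n + 1),
      ‖p • F (a j) - ∫ t in a j..a (j + 1), F t‖ ≤ ε' * p := by
    intro j hj
    have hj' : j < n + 1 := Finset.mem_range.1 hj
    rw [← hastep j, ← intervalIntegral.integral_const, ← intervalIntegral.integral_sub
      (by simp) (hii j hj')]
    refine (intervalIntegral.norm_integral_le_of_norm_le_const (C := ε') fun t ht => ?_).trans ?_
    · rw [Set.uIoc_of_le (hle j)] at ht
      have h3 : t ∈ Set.Icc 0 T := ⟨(haT j hj'.le).1.trans ht.1.le, ht.2.trans (haT (j + 1) hj').2⟩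
      rw [← dist_eq_norm]
      refine (hδF _ (haT j hj'.le) _ h3 ?_).le
      rw [dist_comm, Real.dist_eq, abs_of_pos (by linarith [ht.1])]
      linarith [ht.2, hastep j]
    · rw [abs_of_nonneg (by linarith [hle j])]
  rw [dist_eq_norm, h1, ← Finset.sum_sub_distrib]
  refine (norm_sum_le_of_le _ h2).trans_lt ?_
  rw [Finset.sum_const, Finset.card_range, nsmul_eq_mul]
  have h4 : ((n + 1 : ℕ) : ℝ) * (ε' * p) = ε' * T := by rw [← hpn]; ring
  rw [h4, hε', div_mul_eq_mul_div, div_lt_iff₀ (by positivity)]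
  nlinarith

/-! ### Field operators on a vector -/

section FieldPair

variable {d : ℕ}

lemma IsAnn.unique {q : OneParticle d} {ψ χ χ' : Fock d} (h : IsAnn q ψ χ) (h' : IsAnn q ψ χ') :
    χ = χ' :=
  eq_of_forall_inner_expVec fun g => by rw [← h g, h' g]

lemma creationGraph_unique {q : OneParticle d} {ψ χ χ' : Fock d} (h : (ψ, χ) ∈ creationGraph q)
    (h' : (ψ, χ') ∈ creationGraph q) : χ = χ' := by
  rw [mem_creationGraph] at h h'
  exact eq_of_forall_inner_expVec fun g => by rw [h g, h' g]

lemma IsAnn.add {q q' : OneParticle d} {ψ χ χ' : Fock d} (h : IsAnn q ψ χ) (h' : IsAnn q' ψ χ') :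
    IsAnn (q + q') ψ (χ + χ') := by
  intro g
  rw [crea_add, inner_add_left, inner_add_right, h g, h' g]

lemma IsAnn.smul {q : OneParticle d} {ψ χ : Fock d} (h : IsAnn q ψ χ) (c : ℂ) :
    IsAnn (c • q) ψ (conj c • χ) := by
  intro g
  rw [crea_smul, inner_smul_left, inner_smul_right, h g]

/-- The vectors `a q = c(q) ξ` and `c q = c†(q) ξ`, with bounds. -/
structure IsFieldPair (ξ : Fock d) (a c : OneParticle d → Fock d) (C : ℝ) : Prop where
  ann : ∀ q, IsAnn q ξ (a q)
  cre : ∀ q, (ξ, c q) ∈ creationGraph q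
  norm_ann_le : ∀ q, ‖a q‖ ≤ C * ‖q‖
  norm_cre_sq : ∀ q, ‖c q‖ ^ 2 = ‖a q‖ ^ 2 + ‖q‖ ^ 2 * ‖ξ‖ ^ 2

lemma exists_isFieldPair {ξ : Fock d} {a : OneParticle d → Fock d} {C : ℝ}
    (h : ∀ q, IsAnn q ξ (a q)) (hC : ∀ q, ‖a q‖ ≤ C * ‖q‖) : ∃ c, IsFieldPair ξ a c C := by
  choose c hc hc2 using fun q => (h q).exists_creation
  exact ⟨c, h, hc, hC, hc2⟩

variable {ξ : Fock d} {a c : OneParticle d → Fock d} {C : ℝ}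

namespace IsFieldPair

lemma ann_add (h : IsFieldPair ξ a c C) (q q' : OneParticle d) : a (q + q') = a q + a q' :=
  (h.ann _).unique ((h.ann q).add (h.ann q'))

lemma ann_smul (h : IsFieldPair ξ a c C) (z : ℂ) (q : OneParticle d) : a (z • q) = conj z • a q :=
  (h.ann _).unique ((h.ann q).smul z)

lemma cre_add (h : IsFieldPair ξ a c C) (q q' : OneParticle d) : c (q + q') = c q + c q' := by
  refine creationGraph_unique (h.cre _) ?_
  have h1 := h.cre q
  have h2 := h.cre q'
  rw [mem_creationGraph] at h1 h2 ⊢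
  intro g
  rw [inner_add_right, inner_add_right, h1 g, h2 g, add_mul]

lemma cre_smul (h : IsFieldPair ξ a c C) (z : ℂ) (q : OneParticle d) : c (z • q) = z • c q := by
  refine creationGraph_unique (h.cre _) ?_
  have h1 := h.cre q
  rw [mem_creationGraph] at h1 ⊢
  intro g
  rw [inner_smul_right, inner_smul_right, h1 g, mul_assoc]

lemma norm_cre_le (h : IsFieldPair ξ a c C) (q : OneParticle d) :
    ‖c q‖ ≤ (C + ‖ξ‖) * ‖q‖ := by
  have h1 := h.norm_ann_le q
  have h2 : 0 ≤ C * ‖q‖ := (norm_nonneg _).trans h1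
  rw [add_mul, ← sq_le_sq₀ (norm_nonneg _) (by positivity), h.norm_cre_sq]
  have h3 : ‖a q‖ ^ 2 ≤ (C * ‖q‖) ^ 2 := by gcongr
  have h4 : 0 ≤ ‖ξ‖ * ‖q‖ := by positivity
  nlinarith

lemma norm_field_le (h : IsFieldPair ξ a c C) (q : OneParticle d) :
    ‖c q + a q‖ ≤ (2 * C + ‖ξ‖) * ‖q‖ := by
  refine (norm_add_le _ _).trans ?_
  linarith [h.norm_ann_le q, h.norm_cre_le q]

/-- The map `q ↦ (c†(q) + c(q)) ξ`. -/
def field (h : IsFieldPair ξ a c C) : OneParticle d →L[ℝ] Fock d :=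
  LinearMap.mkContinuous
    { toFun := fun q => c q + a q
      map_add' := fun q q' => by rw [h.ann_add, h.cre_add]; abel
      map_smul' := fun r q => by
        -- Only real scalars are admissible: the creation part is linear in q and the annihilation
        -- part antilinear.
        have h1 : r • q = (r : ℂ) • q := (Complex.coe_smul r q).symm
        rw [h1, h.ann_smul, h.cre_smul, Complex.conj_ofReal, ← smul_add, RingHom.id_apply]
        exact Complex.coe_smul r _ }
    (2 * C + ‖ξ‖) h.norm_field_le

lemma field_apply (h : IsFieldPair ξ a c C) (q : OneParticle d) : h.field q = c q + a q := rfl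

lemma add_apply (h : IsFieldPair ξ a c C) (q : OneParticle d) :
    ∃ hξ : ξ ∈ (creation q + annihilation q).domain,
      (creation q + annihilation q) ⟨ξ, hξ⟩ = h.field q :=
  (h.ann q).add_apply (h.cre q)

lemma inner_cre (h : IsFieldPair ξ a c C) (q : OneParticle d) : ⟪c q, ξ⟫_ℂ = ⟪ξ, a q⟫_ℂ :=
  (h.ann q).inner_eq (h.cre q)

end IsFieldPair

end FieldPair

/-! ### The stochastic integrals of the output process as multiplication operators -/

section StochIntegral

variable {d : ℕ} [NeZero d] {ϑ : ℝ} {h : ℝ → ℂ} {T : ℝ}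

/-- The approximation of the stochastic integral by Riemann sums in the formula by parts. -/
def stochSum {Ω : Type*} (k : ℝ → ℝ) (W : ℝ → Ω → ℝ) (T : ℝ) (n : ℕ) (ω : Ω) : ℝ :=
  k T * W T ω - ∑ j ∈ Finset.range (n + 1),
    (T / (n + 1)) * (deriv k (j * (T / (n + 1))) * W (j * (T / (n + 1))) ω)

lemma partition_mem (hT : 0 ≤ T) {n j : ℕ} (hj : j ∈ Finset.range (n + 1)) :
    (j : ℝ) * (T / (n + 1)) ∈ Set.Icc 0 T := by
  refine ⟨by positivity, ?_⟩
  have h1 : (j : ℝ) ≤ (n : ℝ) + 1 := by exact_mod_cast (Finset.mem_range.1 hj).le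
  rw [mul_div_assoc', div_le_iff₀ (by positivity), mul_comm]
  exact mul_le_mul_of_nonneg_left h1 hT

lemma Diagonalisation.tendsto_stochSum (D : Diagonalisation d ϑ h T) (hT : 0 ≤ T) {k : ℝ → ℝ}
    (hk' : Continuous (deriv k)) (ω : D.Ω) :
    Tendsto (fun n => stochSum k D.W T n ω) atTop (𝓝 (stochIntegral k D.W T ω)) := by
  rw [stochIntegral, D.zero, mul_zero, sub_zero]
  refine tendsto_const_nhds.sub ?_
  exact tendsto_riemannSum hT (hk'.continuousOn.mul (D.continuousOn ω))

lemma Diagonalisation.measurable_stochIntegral (D : Diagonalisation d ϑ h T) (hT : 0 ≤ T)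
    {k : ℝ → ℝ} (hk' : Continuous (deriv k)) : Measurable (stochIntegral k D.W T) := by
  refine measurable_of_tendsto_metrizable (f := fun n => stochSum k D.W T n) (fun n => ?_)
    (tendsto_pi_nhds.2 fun ω => D.tendsto_stochSum hT hk' ω)
  unfold stochSum
  refine ((D.measurable T ⟨hT, le_rfl⟩).const_mul _).sub
    (Finset.measurable_fun_sum _ fun j hj => ?_)
  exact ((D.measurable _ (partition_mem hT hj)).const_mul _).const_mul _

lemma isPhase_mul (hh : Measurable h) (hh1 : ∀ t ∈ Set.Icc 0 T, ‖h t‖ = 1) (ϑ : ℝ) :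
    IsPhase (fun s => Complex.exp (-(Complex.I * ϑ)) * h s) T := by
  refine ⟨hh.const_mul _, fun s hs => ?_⟩
  rw [norm_mul, hh1 s hs, mul_one, Complex.norm_exp]
  simp

lemma Diagonalisation.field_quadrature (D : Diagonalisation d ϑ h T) {ξ : Fock d}
    {a c : OneParticle d → Fock d} {C : ℝ} (hξ : IsFieldPair ξ a c C) {t : ℝ}
    (ht : t ∈ Set.Icc 0 T) :
    (D.J (hξ.field (firstChannel d (fun s => Complex.exp (-(Complex.I * ϑ)) * h s) t)) : D.Ω → ℂ)
      =ᵐ[D.Q] fun ω => (D.W t ω : ℂ) * D.J ξ ω := by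
  obtain ⟨h1, h2⟩ := hξ.add_apply
    (firstChannel d (fun s => Complex.exp (-(Complex.I * ϑ)) * h s) t)
  rw [← h2]
  exact D.diagonal t ht ⟨ξ, h1⟩

/-- The field operator of `q`, applied to `ξ`, is the multiplication by the random variable `x`. -/
def Diagonalisation.ActsAs (D : Diagonalisation d ϑ h T) {ξ : Fock d}
    {a c : OneParticle d → Fock d} {C : ℝ} (hξ : IsFieldPair ξ a c C) (q : OneParticle d)
    (x : D.Ω → ℝ) : Prop :=
  (D.J (hξ.field q) : D.Ω → ℂ) =ᵐ[D.Q] fun ω => (x ω : ℂ) * D.J ξ ω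

section ActsAs

variable {D : Diagonalisation d ϑ h T} {ξ : Fock d} {a c : OneParticle d → Fock d} {C : ℝ}
  {hξ : IsFieldPair ξ a c C} {q q' : OneParticle d} {x x' : D.Ω → ℝ}

lemma Diagonalisation.ActsAs.add (hx : D.ActsAs hξ q x) (hx' : D.ActsAs hξ q' x') :
    D.ActsAs hξ (q + q') (fun ω => x ω + x' ω) := by
  have h1 : D.J (hξ.field (q + q')) = D.J (hξ.field q) + D.J (hξ.field q') := by
    rw [map_add, map_add]
  rw [Diagonalisation.ActsAs, h1]
  filter_upwards [hx, hx', Lp.coeFn_add (D.J (hξ.field q)) (D.J (hξ.field q'))] with ω h2 h3 h4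
  rw [h4, Pi.add_apply, h2, h3, Complex.ofReal_add, add_mul]

lemma Diagonalisation.ActsAs.const_smul (hx : D.ActsAs hξ q x) (r : ℝ) :
    D.ActsAs hξ (r • q) (fun ω => r * x ω) := by
  have h1 : D.J (hξ.field (r • q)) = (r : ℂ) • D.J (hξ.field q) := by
    rw [map_smul, ← map_smul D.J]
    congr 1
  rw [Diagonalisation.ActsAs, h1]
  filter_upwards [hx, Lp.coeFn_smul (r : ℂ) (D.J (hξ.field q))] with ω h2 h3
  rw [h3, Pi.smul_apply, h2, smul_eq_mul, Complex.ofReal_mul, mul_assoc]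

lemma Diagonalisation.ActsAs.zero : D.ActsAs hξ 0 (fun _ => 0) := by
  have h1 : D.J (hξ.field 0) = 0 := by rw [map_zero, map_zero]
  rw [Diagonalisation.ActsAs, h1]
  filter_upwards [Lp.coeFn_zero ℂ 2 D.Q] with ω h2
  rw [h2, Pi.zero_apply, Complex.ofReal_zero, zero_mul]

lemma Diagonalisation.ActsAs.sum {ι : Type*} (s : Finset ι) {q : ι → OneParticle d}
    {x : ι → D.Ω → ℝ} (hx : ∀ i ∈ s, D.ActsAs hξ (q i) (x i)) :
    D.ActsAs hξ (∑ i ∈ s, q i) (fun ω => ∑ i ∈ s, x i ω) := by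
  classical
  induction s using Finset.induction_on with
  | empty => simpa using Diagonalisation.ActsAs.zero
  | insert i s hi ih =>
    simp only [Finset.sum_insert hi]
    exact (hx i (Finset.mem_insert_self i s)).add
      (ih fun j hj => hx j (Finset.mem_insert_of_mem hj))

end ActsAs

/-- The stochastic integral `∫ k dW` acts as the field operator of `k e^{-iϑ} h`. -/
lemma Diagonalisation.actsAs_stochIntegral (D : Diagonalisation d ϑ h T) (hT : 0 ≤ T)
    (hh : Measurable h) (hh1 : ∀ t ∈ Set.Icc 0 T, ‖h t‖ = 1) {ξ : Fock d}
    {a c : OneParticle d → Fock d} {C : ℝ} (hξ : IsFieldPair ξ a c C) {k : ℝ → ℝ}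
    (hk : Differentiable ℝ k) (hk' : Continuous (deriv k)) :
    D.ActsAs hξ (firstChannel d
      (fun s => (k s : ℂ) * (Complex.exp (-(Complex.I * ϑ)) * h s)) T)
      (stochIntegral k D.W T) := by
  set e : ℝ → ℂ := fun s => Complex.exp (-(Complex.I * ϑ)) * h s with he
  have hph : IsPhase e T := isPhase_mul hh hh1 ϑ
  set w : ℝ → OneParticle d := fun t => firstChannel d e t with hw
  -- The same Riemann sums are used for the one-particle vector and for the random variable, so each
  -- finite stage follows from the quadratures at finitely many times by linearity.
  set qn : ℕ → OneParticle d := fun n => k T • w T + (-1 : ℝ) • ∑ j ∈ Finset.range (n + 1),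
    (T / ((n : ℝ) + 1)) • (deriv k (j * (T / (n + 1))) • w (j * (T / (n + 1)))) with hqn
  have hR : Tendsto (fun n : ℕ => ∑ j ∈ Finset.range (n + 1),
      (T / ((n : ℝ) + 1)) • (deriv k (j * (T / (n + 1))) • w (j * (T / (n + 1))))) atTop
      (𝓝 (∫ t in (0 : ℝ)..T, deriv k t • w t)) :=
    tendsto_riemannSum (F := fun t => deriv k t • w t) hT
      (hk'.continuousOn.smul hph.continuousOn_firstChannel)
  have hq : Tendsto qn atTop (𝓝 (firstChannel d (fun s => (k s : ℂ) * e s) T)) := by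
    have h1 := (tendsto_const_nhds (x := k T • w T)).add (hR.const_smul (-1 : ℝ))
    have h2 := hph.firstChannel_mul (d := d) hT hk hk'
    rw [sub_eq_add_neg, ← neg_one_smul ℝ (∫ t in (0 : ℝ)..T, deriv k t • firstChannel d e t)] at h2
    rw [h2]
    exact h1
  have hw1 : ∀ t ∈ Set.Icc 0 T, D.ActsAs hξ (w t) (D.W t) :=
    fun t ht => D.field_quadrature hξ ht
  have hqn1 : ∀ n, D.ActsAs hξ (qn n) (stochSum k D.W T n) := by
    intro n
    have h1 := ((hw1 T ⟨hT, le_rfl⟩).const_smul (k T)).add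
      ((Diagonalisation.ActsAs.sum (Finset.range (n + 1)) fun j hj =>
        ((hw1 _ (partition_mem hT hj)).const_smul (deriv k (j * (T / (n + 1))))).const_smul
          (T / ((n : ℝ) + 1))).const_smul (-1))
    have h2 : stochSum k D.W T n = fun ω => k T * D.W T ω + -1 * ∑ j ∈ Finset.range (n + 1),
        T / ((n : ℝ) + 1) * (deriv k (j * (T / (n + 1))) * D.W (j * (T / (n + 1))) ω) := by
      funext ω
      rw [stochSum, neg_one_mul, sub_eq_add_neg]
    rw [h2]
    exact h1
  have hlim : Tendsto (fun n => D.J (hξ.field (qn n))) atTop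
      (𝓝 (D.J (hξ.field (firstChannel d (fun s => (k s : ℂ) * e s) T)))) :=
    (D.J.continuous.tendsto _).comp ((hξ.field.continuous.tendsto _).comp hq)
  -- L² convergence gives almost sure convergence along a subsequence, while the random variables
  -- converge at every point; the two limits are compared almost surely.
  obtain ⟨ns, hns, hae⟩ := (tendstoInMeasure_of_tendsto_Lp hlim).exists_seq_tendsto_ae
  filter_upwards [hae, ae_all_iff.2 hqn1] with ω h1 h2
  refine tendsto_nhds_unique h1 ?_
  simp_rw [h2]
  exact ((Complex.continuous_ofReal.tendsto _).comp
    ((D.tendsto_stochSum hT hk' ω).comp hns.tendsto_atTop)).mul_const _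

end StochIntegral

/-! ### The Born rule and the moments of the output -/

section Born

/-- Cyclicity Tr(A s²) = Tr(s A s) for Hilbert–Schmidt s. Polarisation writes the real parts through
‖sBb_i‖² with B = A, A + 1, 1, and summed over the basis these equal ∑ ‖B†sb_i‖², since adjoints
have the same Hilbert–Schmidt norm. -/
lemma re_trace_comp {E : Type*} [NormedAddCommGroup E] [InnerProductSpace ℂ E] [CompleteSpace E]
    {s A : E →L[ℂ] E} (hs : s.adjoint = s) (hA : A.adjoint = A)
    (hfin : ∑' i, ‖s (basis E i)‖ₑ ^ 2 ≠ ⊤) :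
    HasSum (fun i => (⟪s (basis E i), A (s (basis E i))⟫_ℂ).re) (trace (A ∘L (s ∘L s))).re := by
  have hb : ∀ B : E →L[ℂ] E, Summable (fun i => ‖B (s (basis E i))‖ ^ 2) := by
    have h1 : Summable fun i => ‖s (basis E i)‖ ^ 2 :=
      (hasSum_norm_sq_of_tsum ENNReal.toReal_nonneg (ENNReal.ofReal_toReal hfin).symm).summable
    intro B
    refine Summable.of_nonneg_of_le (fun i => by positivity) (fun i => ?_) (h1.mul_left (‖B‖ ^ 2))
    rw [← mul_pow]
    exact pow_le_pow_left₀ (norm_nonneg _) (B.le_opNorm _) 2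
  have hb2 : ∀ B : E →L[ℂ] E, HasSum (fun i => ‖s (B (basis E i))‖ ^ 2)
      (∑' i, ‖B.adjoint (s (basis E i))‖ ^ 2) := by
    intro B
    refine hasSum_norm_sq_of_tsum (tsum_nonneg fun i => by positivity) ?_
    rw [← tsum_enorm_sq_eq (hb B.adjoint).hasSum]
    have := tsum_enorm_sq_adjoint (basis E) (basis E) (s ∘L B)
    rw [ContinuousLinearMap.adjoint_comp, hs] at this
    exact this
  have hid := hb2 (ContinuousLinearMap.id ℂ E)
  have hA1 := hb2 (A + ContinuousLinearMap.id ℂ E)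
  have hA0 := hb2 A
  have hadj : (ContinuousLinearMap.id ℂ E).adjoint = ContinuousLinearMap.id ℂ E :=
    ContinuousLinearMap.adjoint_id
  rw [map_add, hadj, hA] at hA1
  rw [hA] at hA0
  rw [hadj] at hid
  have hpol : ∀ x y : E, (⟪x, y⟫_ℂ).re = (‖x + y‖ ^ 2 - ‖x‖ ^ 2 - ‖y‖ ^ 2) / 2 := by
    intro x y
    have h1 := @norm_add_sq ℂ E _ _ _ x y
    have h2 : RCLike.re ⟪x, y⟫_ℂ = (⟪x, y⟫_ℂ).re := rfl
    rw [h2] at h1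
    linarith
  have hterm : ∀ i, ⟪basis E i, (A ∘L (s ∘L s)) (basis E i)⟫_ℂ =
      ⟪s (A (basis E i)), s (basis E i)⟫_ℂ := by
    intro i
    rw [ContinuousLinearMap.comp_apply, ContinuousLinearMap.comp_apply,
      ← ContinuousLinearMap.adjoint_inner_left, hA, ← ContinuousLinearMap.adjoint_inner_left, hs]
  have hsum : Summable fun i => ⟪basis E i, (A ∘L (s ∘L s)) (basis E i)⟫_ℂ := by
    refine Summable.of_norm_bounded (hA0.summable.add hid.summable) fun i => ?_
    rw [hterm]
    refine (norm_inner_le_norm _ _).trans ?_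
    simp only [ContinuousLinearMap.id_apply]
    nlinarith [sq_nonneg (‖s (A (basis E i))‖ - ‖s (basis E i)‖), norm_nonneg (s (A (basis E i))),
      norm_nonneg (s (basis E i)), sq_nonneg (‖s (A (basis E i))‖), sq_nonneg (‖s (basis E i)‖)]
  have h1 : HasSum (fun i => (⟪basis E i, (A ∘L (s ∘L s)) (basis E i)⟫_ℂ).re)
      (trace (A ∘L (s ∘L s))).re := Complex.hasSum_re hsum.hasSum
  simp_rw [hterm, hpol] at h1
  have h2 := ((hA1.sub hA0).sub hid).div_const 2
  simp only [add_apply, ContinuousLinearMap.id_apply, map_add] at h2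
  have h3 := ((((hb (A + ContinuousLinearMap.id ℂ E)).hasSum).sub (hb A).hasSum).sub
    (hb (ContinuousLinearMap.id ℂ E)).hasSum).div_const 2
  simp only [add_apply, ContinuousLinearMap.id_apply] at h3
  rw [h1.unique h2]
  have h4 : ∀ i, (⟪s (basis E i), A (s (basis E i))⟫_ℂ).re =
      (‖A (s (basis E i)) + s (basis E i)‖ ^ 2 - ‖A (s (basis E i))‖ ^ 2 -
        ‖s (basis E i)‖ ^ 2) / 2 := by
    intro i
    rw [← inner_conj_symm, Complex.conj_re, hpol]
  simp_rw [h4]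
  exact h3

variable {d : ℕ} [NeZero d] {ϑ : ℝ} {h : ℝ → ℂ} {T : ℝ}

lemma coeFn_indicatorOp {Ω : Type*} {mΩ : MeasurableSpace Ω} (Q : Measure Ω) {G : Set Ω}
    (hG : MeasurableSet G) (φ : Lp ℂ 2 Q) : indicatorOp Q G hG φ =ᵐ[Q] G.indicator φ :=
  ((Lp.memLp φ).indicator hG).coeFn_toLp

lemma Diagonalisation.J_pvm (D : Diagonalisation d ϑ h T) {G : Set D.Ω} (hG : MeasurableSet G)
    (x : Fock d) : D.J (D.pvm G hG x) = indicatorOp D.Q G hG (D.J x) :=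
  D.J.apply_symm_apply _

lemma Diagonalisation.adjoint_pvm (D : Diagonalisation d ϑ h T) {G : Set D.Ω}
    (hG : MeasurableSet G) : (D.pvm G hG).adjoint = D.pvm G hG := by
  refine ((ContinuousLinearMap.eq_adjoint_iff _ _).2 fun x y => ?_).symm
  rw [← D.J.inner_map_map, ← D.J.inner_map_map x, D.J_pvm, D.J_pvm, L2.inner_def, L2.inner_def]
  refine integral_congr_ae ?_
  filter_upwards [coeFn_indicatorOp D.Q hG (D.J x), coeFn_indicatorOp D.Q hG (D.J y)] with ω h1 h2
  rw [h1, h2]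
  by_cases hω : ω ∈ G
  · rw [Set.indicator_of_mem hω, Set.indicator_of_mem hω]
  · rw [Set.indicator_of_notMem hω, Set.indicator_of_notMem hω, inner_zero_left, inner_zero_right]

lemma Diagonalisation.ofReal_inner_pvm (D : Diagonalisation d ϑ h T) {G : Set D.Ω}
    (hG : MeasurableSet G) (x : Fock d) : 0 ≤ (⟪x, D.pvm G hG x⟫_ℂ).re ∧
    ENNReal.ofReal (⟪x, D.pvm G hG x⟫_ℂ).re = ∫⁻ ω in G, ‖D.J x ω‖ₑ ^ 2 ∂D.Q := by
  have h1 : ⟪x, D.pvm G hG x⟫_ℂ = ((∫ ω in G, ‖D.J x ω‖ ^ 2 ∂D.Q : ℝ) : ℂ) := by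
    rw [← D.J.inner_map_map, D.J_pvm, L2.inner_def, ← integral_indicator hG,
      ← integral_complex_ofReal]
    refine integral_congr_ae ?_
    filter_upwards [coeFn_indicatorOp D.Q hG (D.J x)] with ω h1
    rw [h1]
    by_cases hω : ω ∈ G
    · rw [Set.indicator_of_mem hω, Set.indicator_of_mem hω, inner_self_eq_ofReal]
    · rw [Set.indicator_of_notMem hω, Set.indicator_of_notMem hω, inner_zero_right,
        Complex.ofReal_zero]
  have h2 : Integrable (fun ω => ‖D.J x ω‖ ^ 2) D.Q :=
    (memLp_two_iff_integrable_sq_norm (Lp.memLp (D.J x)).1).1 (Lp.memLp (D.J x))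
  rw [h1, Complex.ofReal_re]
  refine ⟨integral_nonneg fun ω => by positivity, ?_⟩
  rw [ofReal_integral_eq_lintegral_ofReal h2.integrableOn
    (Eventually.of_forall fun ω => by positivity)]
  simp_rw [enorm_sq_eq_ofReal]

/-- The law of the output as a mixture of the laws of pure states. -/
lemma Diagonalisation.IsPhysicalProbability.eq_sum {D : Diagonalisation d ϑ h T}
    {ϱ s : Fock d →L[ℂ] Fock d} {P : Measure D.Ω} (hP : D.IsPhysicalProbability ϱ P)
    (hs : s.adjoint = s) (hϱ : s ∘L s = ϱ) (hfin : ∑' i, ‖s (basis (Fock d) i)‖ₑ ^ 2 ≠ ⊤) :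
    P = Measure.sum fun i => D.Q.withDensity fun ω => ‖D.J (s (basis (Fock d) i)) ω‖ₑ ^ 2 := by
  refine Measure.ext fun G hG => ?_
  have h1 := re_trace_comp hs (D.adjoint_pvm hG) hfin
  rw [hP G hG, ← hϱ, Measure.sum_apply _ hG, ← h1.tsum_eq,
    ENNReal.ofReal_tsum_of_nonneg (fun i => (D.ofReal_inner_pvm hG _).1) h1.summable]
  refine tsum_congr fun i => ?_
  rw [withDensity_apply _ hG, (D.ofReal_inner_pvm hG _).2]

/-! ### Moments of a random variable under a mixture of pure laws. -/

section Moments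

lemma measurable_enorm_J (D : Diagonalisation d ϑ h T) (x : Fock d) :
    Measurable fun ω => ‖D.J x ω‖ₑ ^ 2 :=
  (Lp.stronglyMeasurable (D.J x)).enorm.pow_const 2

lemma Diagonalisation.lintegral_enorm_J (D : Diagonalisation d ϑ h T) (x : Fock d) :
    ∫⁻ ω, ‖D.J x ω‖ₑ ^ 2 ∂D.Q = ‖x‖ₑ ^ 2 := by
  have h1 := D.ofReal_inner_pvm MeasurableSet.univ x
  rw [Measure.restrict_univ] at h1
  rw [← h1.2, enorm_sq_eq_ofReal]
  congr 1
  have h2 : D.pvm Set.univ MeasurableSet.univ x = x := by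
    apply D.J.injective
    rw [D.J_pvm]
    refine Lp.ext ?_
    filter_upwards [coeFn_indicatorOp D.Q MeasurableSet.univ (D.J x)] with ω h3
    rw [h3, Set.indicator_univ]
  rw [h2, inner_self_eq_ofReal, Complex.ofReal_re]


variable {D : Diagonalisation d ϑ h T} {ι : Type*} {P : Measure D.Ω} {X Y : D.Ω → ℝ}
  {Ξ u v : lp (fun _ : ι => Fock d) 2}

lemma hasSum_lp_norm_sq {E : Type*} [NormedAddCommGroup E] (x : lp (fun _ : ι => E) 2) :
    HasSum (fun i => ‖x i‖ ^ 2) (‖x‖ ^ 2) := by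
  have h1 := lp.hasSum_norm (p := 2) (by norm_num) x
  simpa using h1

lemma tsum_lp_enorm_sq {E : Type*} [NormedAddCommGroup E] (x : lp (fun _ : ι => E) 2) : ∑' i, ‖x i‖ₑ ^ 2 = ‖x‖ₑ ^ 2 := by
  rw [tsum_enorm_sq_eq (hasSum_lp_norm_sq x), enorm_sq_eq_ofReal]

lemma exists_lp {E : Type*} [NormedAddCommGroup E] {x : ι → E} (hx : ∑' i, ‖x i‖ₑ ^ 2 ≠ ⊤) :
    ∃ y : lp (fun _ : ι => E) 2, ∀ i, y i = x i := by
  have h1 : Summable fun i => ‖x i‖ ^ 2 :=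
    (hasSum_norm_sq_of_tsum ENNReal.toReal_nonneg (ENNReal.ofReal_toReal hx).symm).summable
  exact ⟨⟨x, memℓp_gen (by simpa using h1)⟩, fun i => rfl⟩

lemma isProbabilityMeasure_of_eq_sum
    (hP : P = Measure.sum fun i => D.Q.withDensity fun ω => ‖D.J (Ξ i) ω‖ₑ ^ 2)
    (hΞ : ‖Ξ‖ = 1) : IsProbabilityMeasure P := by
  refine ⟨?_⟩
  have h1 : ‖Ξ‖ₑ ^ 2 = 1 := by rw [enorm_sq_eq_ofReal, hΞ, one_pow, ENNReal.ofReal_one]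
  rw [hP, Measure.sum_apply _ MeasurableSet.univ, ← h1, ← tsum_lp_enorm_sq]
  refine tsum_congr fun i => ?_
  rw [withDensity_apply _ MeasurableSet.univ, Measure.restrict_univ, D.lintegral_enorm_J]

lemma lintegral_enorm_sq_of_eq_sum
    (hP : P = Measure.sum fun i => D.Q.withDensity fun ω => ‖D.J (Ξ i) ω‖ₑ ^ 2)
    (hX : Measurable X)
    (hu : ∀ i, (D.J (u i) : D.Ω → ℂ) =ᵐ[D.Q] fun ω => (X ω : ℂ) * D.J (Ξ i) ω) :
    ∫⁻ ω, ‖X ω‖ₑ ^ 2 ∂P = ‖u‖ₑ ^ 2 := by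
  rw [hP, lintegral_sum_measure, ← tsum_lp_enorm_sq]
  refine tsum_congr fun i => ?_
  rw [lintegral_withDensity_eq_lintegral_mul _ (measurable_enorm_J D _) (hX.enorm.pow_const 2),
    ← D.lintegral_enorm_J]
  refine lintegral_congr_ae ?_
  filter_upwards [hu i] with ω h1
  rw [h1, Pi.mul_apply, enorm_mul, mul_pow, mul_comm]
  congr 2
  rw [← ofReal_norm, ← ofReal_norm, Complex.norm_real]

lemma memLp_of_eq_sum
    (hP : P = Measure.sum fun i => D.Q.withDensity fun ω => ‖D.J (Ξ i) ω‖ₑ ^ 2)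
    (hX : Measurable X)
    (hu : ∀ i, (D.J (u i) : D.Ω → ℂ) =ᵐ[D.Q] fun ω => (X ω : ℂ) * D.J (Ξ i) ω) :
    MemLp X 2 P := by
  refine ⟨hX.aestronglyMeasurable, ?_⟩
  rw [eLpNorm_lt_top_iff_lintegral_rpow_enorm_lt_top (by norm_num) (by norm_num)]
  have h1 := lintegral_enorm_sq_of_eq_sum hP hX hu
  simp only [ENNReal.toReal_ofNat, ENNReal.rpow_ofNat]
  rw [h1]
  exact ENNReal.pow_lt_top enorm_lt_top

lemma integral_sq_of_eq_sum
    (hP : P = Measure.sum fun i => D.Q.withDensity fun ω => ‖D.J (Ξ i) ω‖ₑ ^ 2)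
    (hX : Measurable X)
    (hu : ∀ i, (D.J (u i) : D.Ω → ℂ) =ᵐ[D.Q] fun ω => (X ω : ℂ) * D.J (Ξ i) ω) :
    ∫ ω, X ω ^ 2 ∂P = ‖u‖ ^ 2 := by
  rw [integral_eq_lintegral_of_nonneg_ae (Eventually.of_forall fun ω => by positivity)
    (hX.pow_const 2).aestronglyMeasurable]
  have h1 : ∀ ω, ENNReal.ofReal (X ω ^ 2) = ‖X ω‖ₑ ^ 2 := fun ω => by
    rw [enorm_sq_eq_ofReal, Real.norm_eq_abs, sq_abs]
  simp_rw [h1]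
  rw [lintegral_enorm_sq_of_eq_sum hP hX hu, enorm_sq_eq_ofReal,
    ENNReal.toReal_ofReal (by positivity)]

lemma integral_of_eq_sum
    (hP : P = Measure.sum fun i => D.Q.withDensity fun ω => ‖D.J (Ξ i) ω‖ₑ ^ 2)
    (hΞ : ‖Ξ‖ = 1) (hX : Measurable X)
    (hu : ∀ i, (D.J (u i) : D.Ω → ℂ) =ᵐ[D.Q] fun ω => (X ω : ℂ) * D.J (Ξ i) ω) :
    ((∫ ω, X ω ∂P : ℝ) : ℂ) = ⟪Ξ, u⟫_ℂ := by
  have := isProbabilityMeasure_of_eq_sum hP hΞ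
  have h1 : Integrable X P := (memLp_of_eq_sum hP hX hu).integrable (by norm_num)
  rw [hP] at h1
  have h2 := hasSum_integral_measure h1
  rw [← hP] at h2
  have h3 : ∀ i, ((∫ ω, X ω ∂(D.Q.withDensity fun ω => ‖D.J (Ξ i) ω‖ₑ ^ 2) : ℝ) : ℂ) =
      ⟪Ξ i, u i⟫_ℂ := by
    intro i
    rw [integral_withDensity_eq_integral_toReal_smul (measurable_enorm_J D _)
      (Eventually.of_forall fun ω => ENNReal.pow_lt_top enorm_lt_top), ← D.J.inner_map_map,
      L2.inner_def, ← integral_complex_ofReal]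
    refine integral_congr_ae ?_
    filter_upwards [hu i] with ω h4
    rw [h4, enorm_sq_eq_ofReal, ENNReal.toReal_ofReal (by positivity), ← smul_eq_mul,
      inner_smul_right, inner_self_eq_ofReal, smul_eq_mul, Complex.ofReal_mul, mul_comm]
  have h5 := Complex.hasSum_ofReal.2 h2
  rw [funext h3] at h5
  exact h5.unique (lp.hasSum_inner Ξ u)

/-- Commutativity of the output: each ⟨u_i, v_i⟩ is the integral of the real function X Y |J ξ_i|².
This removes the cross term between the cosine and sine parts. -/
lemma inner_im_eq_zero_of_actsAs
    (hu : ∀ i, (D.J (u i) : D.Ω → ℂ) =ᵐ[D.Q] fun ω => (X ω : ℂ) * D.J (Ξ i) ω)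
    (hv : ∀ i, (D.J (v i) : D.Ω → ℂ) =ᵐ[D.Q] fun ω => (Y ω : ℂ) * D.J (Ξ i) ω) :
    (⟪u, v⟫_ℂ).im = 0 := by
  have h1 : ∀ i, ⟪u i, v i⟫_ℂ =
      ((∫ ω, X ω * Y ω * ‖D.J (Ξ i) ω‖ ^ 2 ∂D.Q : ℝ) : ℂ) := by
    intro i
    rw [← D.J.inner_map_map, L2.inner_def, ← integral_complex_ofReal]
    refine integral_congr_ae ?_
    filter_upwards [hu i, hv i] with ω h2 h3
    rw [h2, h3, ← smul_eq_mul, ← smul_eq_mul, inner_smul_left, inner_smul_right,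
      inner_self_eq_ofReal, Complex.conj_ofReal]
    push_cast
    ring
  have h2 := Complex.hasSum_im (lp.hasSum_inner u v)
  simp_rw [h1, Complex.ofReal_im] at h2
  exact h2.unique hasSum_zero

end Moments

end Born

/-! ### The spectra in terms of the temporal modes -/

section Mixture

variable {d : ℕ} {ι : Type*} {a c : ι → OneParticle d → Fock d} {C : ℝ}

lemma inner_cre_eq_conj {Ξ A B : lp (fun _ : ι => Fock d) 2} (q : OneParticle d)
    (hpair : ∀ i, IsFieldPair (Ξ i) (a i) (c i) C) (hA : ∀ i, A i = a i q)
    (hB : ∀ i, B i = c i q) : ⟪Ξ, B⟫_ℂ = conj ⟪Ξ, A⟫_ℂ := by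
  rw [inner_conj_symm]
  refine (lp.hasSum_inner (𝕜 := ℂ) Ξ B).unique ?_
  have h1 : ∀ i, ⟪A i, Ξ i⟫_ℂ = ⟪Ξ i, B i⟫_ℂ := fun i => by
    rw [hA, hB, ← inner_conj_symm, ← (hpair i).inner_cre, inner_conj_symm]
  have h2 := lp.hasSum_inner (𝕜 := ℂ) A Ξ
  rwa [funext h1] at h2

/-- The commutation relation summed over the mixture: the excess is ‖q‖² ∑ ‖ξ_i‖², and both factors
are 1. -/
lemma norm_cre_sq_eq {Ξ A B : lp (fun _ : ι => Fock d) 2} {q : OneParticle d} (hq : ‖q‖ = 1)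
    (hΞ : ‖Ξ‖ = 1) (hpair : ∀ i, IsFieldPair (Ξ i) (a i) (c i) C) (hA : ∀ i, A i = a i q)
    (hB : ∀ i, B i = c i q) : ‖B‖ ^ 2 = ‖A‖ ^ 2 + 1 := by
  have h1 := (hasSum_lp_norm_sq A).add (hasSum_lp_norm_sq Ξ)
  have h2 : ∀ i, ‖A i‖ ^ 2 + ‖Ξ i‖ ^ 2 = ‖B i‖ ^ 2 := fun i => by
    rw [hA, hB, (hpair i).norm_cre_sq, hq, one_pow, one_mul]
  rw [funext h2, hΞ, one_pow] at h1
  exact (hasSum_lp_norm_sq B).unique h1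

end Mixture

section Spectra

variable {d : ℕ} [NeZero d] {ϑ : ℝ} {h : ℝ → ℂ} {T : ℝ}

/-- The one-particle vector of the temporal mode `a_T(μ)`. -/
def modeVec (d : ℕ) [NeZero d] (h : ℝ → ℂ) (T μ : ℝ) : OneParticle d :=
  firstChannel d (fun t => ((1 / √T : ℝ) : ℂ) * Complex.exp (-(Complex.I * μ * t)) * h t) T

lemma mode_eq (μ : ℝ) : mode d h T μ = annihilation (modeVec d h T μ) := rfl

lemma isPhase_exp_mul (hh : Measurable h) (hh1 : ∀ t ∈ Set.Icc 0 T, ‖h t‖ = 1) (μ : ℝ) :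
    IsPhase (fun t => Complex.exp (-(Complex.I * μ * t)) * h t) T := by
  refine ⟨Measurable.mul (Continuous.measurable (by fun_prop)) hh, fun s hs => ?_⟩
  rw [norm_mul, hh1 s hs, mul_one, Complex.norm_exp]
  simp

lemma isFirstChannel_mode (hh : Measurable h) (hh1 : ∀ t ∈ Set.Icc 0 T, ‖h t‖ = 1) (μ : ℝ) :
    IsFirstChannel d
      (fun t => ((1 / √T : ℝ) : ℂ) * Complex.exp (-(Complex.I * μ * t)) * h t) T := by
  have h1 := ((isPhase_exp_mul hh hh1 μ).isFirstChannel (d := d) le_rfl).const_mul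
    ((1 / √T : ℝ) : ℂ)
  simpa only [← mul_assoc ((1 / √T : ℝ) : ℂ)] using h1

lemma norm_modeVec (hT : 0 < T) (hh : Measurable h) (hh1 : ∀ t ∈ Set.Icc 0 T, ‖h t‖ = 1) (μ : ℝ) :
    ‖modeVec d h T μ‖ = 1 := by
  have hph := isPhase_exp_mul hh hh1 μ
  have h1 : modeVec d h T μ = ((1 / √T : ℝ) : ℂ) •
      firstChannel d (fun t => Complex.exp (-(Complex.I * μ * t)) * h t) T := by
    rw [← firstChannel_const_mul (hph.isFirstChannel le_rfl), modeVec]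
    simp_rw [mul_assoc]
  rw [← pow_eq_one_iff_of_nonneg (norm_nonneg _) two_ne_zero, h1, norm_smul, mul_pow,
    hph.norm_firstChannel_sq hT.le le_rfl, Complex.norm_real, Real.norm_eq_abs, sq_abs, div_pow,
    Real.sq_sqrt hT.le, one_pow, one_div_mul_cancel hT.ne']

lemma firstChannel_modes (hh : Measurable h) (hh1 : ∀ t ∈ Set.Icc 0 T, ‖h t‖ = 1) (μ : ℝ)
    (α β : ℂ) {c : ℝ → ℂ} (hc : ∀ t : ℝ, c t =
      α * (((1 / √T : ℝ) : ℂ) * Complex.exp (-(Complex.I * μ * t)) * h t) +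
      β * (((1 / √T : ℝ) : ℂ) * Complex.exp (-(Complex.I * (-μ : ℝ) * t)) * h t)) :
    firstChannel d c T = α • modeVec d h T μ + β • modeVec d h T (-μ) := by
  have h1 := isFirstChannel_mode (d := d) hh hh1 μ
  have h2 := isFirstChannel_mode (d := d) hh hh1 (-μ)
  rw [funext hc, firstChannel_add (h1.const_mul α) (h2.const_mul β), firstChannel_const_mul h1,
    firstChannel_const_mul h2]
  rfl

/-- Euler's formula splits the cosine into the frequencies ±μ; the factor √T undoes the
normalisation of the modes. -/
lemma firstChannel_cos (hT : 0 < T) (hh : Measurable h) (hh1 : ∀ t ∈ Set.Icc 0 T, ‖h t‖ = 1)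
    (μ ϑ : ℝ) :
    firstChannel d (fun s => (Real.cos (μ * s) : ℂ) * (Complex.exp (-(Complex.I * ϑ)) * h s)) T =
      (Complex.exp (-(Complex.I * ϑ)) * √T / 2) • modeVec d h T μ +
      (Complex.exp (-(Complex.I * ϑ)) * √T / 2) • modeVec d h T (-μ) := by
  refine firstChannel_modes hh hh1 μ _ _ fun t => ?_
  have hT' : ((√T : ℝ) : ℂ) ≠ 0 := by exact_mod_cast (Real.sqrt_pos.2 hT).ne'
  have e1 : (μ * t : ℂ) * Complex.I = -(Complex.I * ((-μ : ℝ) : ℂ) * t) := by push_cast; ring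
  have e2 : -(μ * t : ℂ) * Complex.I = -(Complex.I * μ * t) := by ring
  rw [Complex.ofReal_cos, Complex.cos, Complex.ofReal_mul, e1, e2]
  push_cast
  field_simp
  ring

lemma firstChannel_sin (hT : 0 < T) (hh : Measurable h) (hh1 : ∀ t ∈ Set.Icc 0 T, ‖h t‖ = 1)
    (μ ϑ : ℝ) :
    firstChannel d (fun s => (Real.sin (μ * s) : ℂ) * (Complex.exp (-(Complex.I * ϑ)) * h s)) T =
      (Complex.I * (Complex.exp (-(Complex.I * ϑ)) * √T / 2)) • modeVec d h T μ +
      (-(Complex.I * (Complex.exp (-(Complex.I * ϑ)) * √T / 2))) • modeVec d h T (-μ) := by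
  refine firstChannel_modes hh hh1 μ _ _ fun t => ?_
  have hT' : ((√T : ℝ) : ℂ) ≠ 0 := by exact_mod_cast (Real.sqrt_pos.2 hT).ne'
  have e1 : (μ * t : ℂ) * Complex.I = -(Complex.I * ((-μ : ℝ) : ℂ) * t) := by push_cast; ring
  have e2 : -(μ * t : ℂ) * Complex.I = -(Complex.I * μ * t) := by ring
  rw [Complex.ofReal_sin, Complex.sin, Complex.ofReal_mul, e1, e2]
  push_cast
  field_simp
  ring

variable {ι : Type*}

/-- The vectors `a_T(±μ) ξ_i`, `a_T†(±μ) ξ_i` of a mixture `ξ`. -/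
structure ModeData (h : ℝ → ℂ) (T μ : ℝ) (Ξ Ap Am Cp Cm : lp (fun _ : ι => Fock d) 2)
    (a c : ι → OneParticle d → Fock d) (C : ℝ) : Prop where
  norm_eq : ‖Ξ‖ = 1
  pair : ∀ i, IsFieldPair (Ξ i) (a i) (c i) C
  ap : ∀ i, Ap i = a i (modeVec d h T μ)
  am : ∀ i, Am i = a i (modeVec d h T (-μ))
  cp : ∀ i, Cp i = c i (modeVec d h T μ)
  cm : ∀ i, Cm i = c i (modeVec d h T (-μ))

variable {Ξ Ap Am Cp Cm : lp (fun _ : ι => Fock d) 2} {a c : ι → OneParticle d → Fock d} {C μ : ℝ}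

lemma norm_add_I_smul_sq {V : Type*} [NormedAddCommGroup V] [InnerProductSpace ℂ V] {u v : V}
    (huv : (⟪u, v⟫_ℂ).im = 0) : ‖u + Complex.I • v‖ ^ 2 = ‖u‖ ^ 2 + ‖v‖ ^ 2 ∧
      ‖u - Complex.I • v‖ ^ 2 = ‖u‖ ^ 2 + ‖v‖ ^ 2 := by
  have h1 : RCLike.re ⟪u, Complex.I • v⟫_ℂ = 0 := by
    rw [inner_smul_right]
    change (Complex.I * ⟪u, v⟫_ℂ).re = 0
    rw [Complex.I_mul_re, huv, neg_zero]
  rw [@norm_add_sq ℂ, @norm_sub_sq ℂ, h1, norm_smul, Complex.norm_I]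
  constructor <;> ring

/-- The moments of the stochastic integrals at the frequency `μ`, in terms of the modes. -/
lemma ModeData.spectra (hM : ModeData h T μ Ξ Ap Am Cp Cm a c C) (hT : 0 < T) (hh : Measurable h)
    (hh1 : ∀ t ∈ Set.Icc 0 T, ‖h t‖ = 1) {D : Diagonalisation d ϑ h T} {P : Measure D.Ω}
    (hP : P = Measure.sum fun i => D.Q.withDensity fun ω => ‖D.J (Ξ i) ω‖ₑ ^ 2) {e : ℂ}
    (he : e = Complex.exp (Complex.I * ϑ)) :
    HasSecondMoments P D.W T μ ∧
    elasticSpectrum P D.W T μ = ‖⟪Ξ, e • Ap + conj e • Cm⟫_ℂ‖ ^ 2 ∧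
    inelasticSpectrum P D.W T μ =
      ‖e • Ap + conj e • Cm‖ ^ 2 - ‖⟪Ξ, e • Ap + conj e • Cm⟫_ℂ‖ ^ 2 ∧
    inelasticSpectrum P D.W T μ =
      ‖e • Am + conj e • Cp‖ ^ 2 - ‖⟪Ξ, e • Am + conj e • Cp⟫_ℂ‖ ^ 2 := by
  have hce : Complex.exp (-(Complex.I * ϑ)) = conj e := by
    rw [he, ← Complex.exp_conj]
    simp
  set X := cosIntegral D.W T μ with hX
  set Y := sinIntegral D.W T μ with hY
  set z : ℂ := conj e * √T / 2 with hz
  have hzc : conj z = e * √T / 2 := by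
    rw [hz, map_div₀, map_mul, Complex.conj_conj, Complex.conj_ofReal, Complex.conj_ofNat]
  have hcd : Differentiable ℝ fun t => Real.cos (μ * t) := by fun_prop
  have hsd : Differentiable ℝ fun t => Real.sin (μ * t) := by fun_prop
  have hcd' : Continuous (deriv fun t => Real.cos (μ * t)) :=
    ContDiff.continuous_deriv (n := 1) (by fun_prop) le_rfl
  have hsd' : Continuous (deriv fun t => Real.sin (μ * t)) :=
    ContDiff.continuous_deriv (n := 1) (by fun_prop) le_rfl
  have hXm : Measurable X := D.measurable_stochIntegral hT.le hcd'
  have hYm : Measurable Y := D.measurable_stochIntegral hT.le hsd'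
  -- u and v are the vectors XΞ and YΞ, written out as creation minus frequency-dependent phases: z
  -- multiplies creation parts and conj z annihilation parts, with an extra ±i for the sine.
  set u : lp (fun _ : ι => Fock d) 2 := (z • Cp + z • Cm) + (conj z • Ap + conj z • Am) with hu
  set v : lp (fun _ : ι => Fock d) 2 := ((Complex.I * z) • Cp + (-(Complex.I * z)) • Cm) +
    (conj (Complex.I * z) • Ap + conj (-(Complex.I * z)) • Am) with hv
  have hfield : ∀ i (α β : ℂ), (hM.pair i).field
      (α • modeVec d h T μ + β • modeVec d h T (-μ)) =
      (α • Cp i + β • Cm i) + (conj α • Ap i + conj β • Am i) := by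
    intro i α β
    rw [(hM.pair i).field_apply, (hM.pair i).cre_add, (hM.pair i).ann_add, (hM.pair i).cre_smul,
      (hM.pair i).cre_smul, (hM.pair i).ann_smul, (hM.pair i).ann_smul, hM.ap, hM.am, hM.cp, hM.cm]
  have hui : ∀ i, (D.J (u i) : D.Ω → ℂ) =ᵐ[D.Q] fun ω => (X ω : ℂ) * D.J (Ξ i) ω := by
    intro i
    have h1 := D.actsAs_stochIntegral hT.le hh hh1 (hM.pair i) hcd hcd'
    rw [firstChannel_cos hT hh hh1, hce, Diagonalisation.ActsAs, hfield] at h1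
    exact h1
  have hvi : ∀ i, (D.J (v i) : D.Ω → ℂ) =ᵐ[D.Q] fun ω => (Y ω : ℂ) * D.J (Ξ i) ω := by
    intro i
    have h1 := D.actsAs_stochIntegral hT.le hh hh1 (hM.pair i) hsd hsd'
    rw [firstChannel_sin hT hh hh1, hce, Diagonalisation.ActsAs, hfield] at h1
    exact h1
  have hprob := isProbabilityMeasure_of_eq_sum hP hM.norm_eq
  have hXL := memLp_of_eq_sum hP hXm hui
  have hYL := memLp_of_eq_sum hP hYm hvi
  have hEX := integral_of_eq_sum hP hM.norm_eq hXm hui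
  have hEY := integral_of_eq_sum hP hM.norm_eq hYm hvi
  have hTT : ((√T : ℝ) : ℂ) * (√T : ℝ) = T := by
    rw [← Complex.ofReal_mul, Real.mul_self_sqrt hT.le]
  -- In u + iv the coefficients of C₊ and A₋ cancel; in u - iv those of C₋ and A₊ do. This yields
  -- the two expressions for one spectrum.
  have hplus : u + Complex.I • v = ((√T : ℝ) : ℂ) • (e • Ap + conj e • Cm) := by
    rw [hu, hv]
    simp only [map_neg, map_mul, Complex.conj_I, hzc]
    simp only [hz]
    match_scalars <;> ring_nf <;> simp only [Complex.I_sq] <;> ring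
  have hminus : u - Complex.I • v = ((√T : ℝ) : ℂ) • (e • Am + conj e • Cp) := by
    rw [hu, hv]
    simp only [map_neg, map_mul, Complex.conj_I, hzc]
    simp only [hz]
    match_scalars <;> ring_nf <;> simp only [Complex.I_sq] <;> ring
  have hip : ⟪Ξ, u + Complex.I • v⟫_ℂ =
      ((∫ ω, X ω ∂P : ℝ) : ℂ) + ((∫ ω, Y ω ∂P : ℝ) : ℂ) * Complex.I := by
    rw [inner_add_right, inner_smul_right, ← hEX, ← hEY, mul_comm Complex.I]
  have him : ⟪Ξ, u - Complex.I • v⟫_ℂ =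
      ((∫ ω, X ω ∂P : ℝ) : ℂ) + ((-∫ ω, Y ω ∂P : ℝ) : ℂ) * Complex.I := by
    rw [inner_sub_right, inner_smul_right, ← hEX, ← hEY, mul_comm Complex.I, Complex.ofReal_neg]
    ring
  have hsq : ∀ x y : ℝ, ‖(x : ℂ) + (y : ℂ) * Complex.I‖ ^ 2 = x ^ 2 + y ^ 2 := fun x y => by
    rw [Complex.sq_norm, Complex.normSq_add_mul_I]
  have hnp := (norm_add_I_smul_sq (inner_im_eq_zero_of_actsAs hui hvi)).1
  have hnm := (norm_add_I_smul_sq (inner_im_eq_zero_of_actsAs hui hvi)).2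
  have hscale : ∀ x : lp (fun _ : ι => Fock d) 2,
      ‖((√T : ℝ) : ℂ) • x‖ ^ 2 = T * ‖x‖ ^ 2 ∧
      ‖⟪Ξ, ((√T : ℝ) : ℂ) • x⟫_ℂ‖ ^ 2 = T * ‖⟪Ξ, x⟫_ℂ‖ ^ 2 := by
    intro x
    rw [inner_smul_right, norm_smul, norm_mul, mul_pow, mul_pow, Complex.norm_real,
      Real.norm_eq_abs, sq_abs, Real.sq_sqrt hT.le]
    exact ⟨rfl, rfl⟩
  have hel : ∫ ω, ((X ω : ℂ) + Complex.I * (Y ω : ℂ)) ∂P = ⟪Ξ, u + Complex.I • v⟫_ℂ := by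
    have hXi : Integrable X P := hXL.integrable (by norm_num)
    have hYi : Integrable Y P := hYL.integrable (by norm_num)
    rw [integral_add hXi.ofReal (hYi.ofReal.const_mul _), integral_const_mul,
      integral_complex_ofReal, integral_complex_ofReal, hip, mul_comm Complex.I]
  have hV : inelasticSpectrum P D.W T μ = 1 / T * (‖u‖ ^ 2 + ‖v‖ ^ 2 -
      ((∫ ω, X ω ∂P) ^ 2 + (∫ ω, Y ω ∂P) ^ 2)) := by
    rw [inelasticSpectrum, ← hX, ← hY, variance_eq_sub hXL, variance_eq_sub hYL,
      ← integral_sq_of_eq_sum hP hXm hui, ← integral_sq_of_eq_sum hP hYm hvi]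
    simp only [Pi.pow_apply]
    ring
  refine ⟨⟨hXL, hYL⟩, ?_, ?_, ?_⟩
  · rw [elasticSpectrum, ← hX, ← hY, hel, hplus, (hscale _).2]
    field_simp
  · rw [hV, ← hnp, ← hsq, ← hip, hplus, (hscale _).1, (hscale _).2]
    field_simp
  · rw [hV, ← hnm, ← neg_sq (∫ ω, Y ω ∂P), ← hsq, ← him, hminus, (hscale _).1, (hscale _).2]
    field_simp

end Spectra

/-! ### Relations between complementary quadratures -/

section Complementary

variable {V : Type*} [NormedAddCommGroup V] [InnerProductSpace ℂ V] {Ξ Ap Am Cp Cm : V}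

lemma norm_sub_inner_smul_sq (hΞ : ‖Ξ‖ = 1) (x : V) :
    ‖x - ⟪Ξ, x⟫_ℂ • Ξ‖ ^ 2 = ‖x‖ ^ 2 - ‖⟪Ξ, x⟫_ℂ‖ ^ 2 := by
  have h1 : RCLike.re ⟪x, ⟪Ξ, x⟫_ℂ • Ξ⟫_ℂ = ‖⟪Ξ, x⟫_ℂ‖ ^ 2 := by
    rw [inner_smul_right, ← inner_conj_symm x Ξ, Complex.mul_conj', ← Complex.ofReal_pow]
    exact Complex.ofReal_re _
  rw [@norm_sub_sq ℂ, h1, norm_smul, hΞ, mul_one]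
  ring

lemma re_inner_add_sub (α β : V) : (⟪α + β, α - β⟫_ℂ).re = ‖α‖ ^ 2 - ‖β‖ ^ 2 := by
  have h1 : (⟪α, β⟫_ℂ).re = (⟪β, α⟫_ℂ).re := by rw [← inner_conj_symm, Complex.conj_re]
  rw [inner_add_left, inner_sub_right, inner_sub_right, inner_self_eq_ofReal, inner_self_eq_ofReal]
  simp only [Complex.add_re, Complex.sub_re, Complex.ofReal_re]
  linarith

/-- Cauchy–Schwarz for α + β and α - β. It plays the role of the Robertson inequality, without
commutators of unbounded operators. -/
lemma norm_sq_sub_le_sqrt (α β : V) :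
    ‖α‖ ^ 2 - ‖β‖ ^ 2 ≤ √(‖α + β‖ ^ 2 * ‖α - β‖ ^ 2) := by
  rw [← re_inner_add_sub, ← mul_pow, Real.sqrt_sq (by positivity)]
  exact (Complex.re_le_norm _).trans (norm_inner_le_norm _ _)

lemma norm_add_sq_add_norm_sub_sq (α β : V) :
    ‖α + β‖ ^ 2 + ‖α - β‖ ^ 2 = 2 * (‖α‖ ^ 2 + ‖β‖ ^ 2) := by
  rw [@norm_add_sq ℂ, @norm_sub_sq ℂ]
  ring

/-- Multiplying e by ±i multiplies conj e by ∓i. After removing a common unimodular factor, only the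
relative sign of the two terms has changed. -/
lemma norm_add_of_phase_shift {e e' : ℂ} (he' : e' = Complex.I * e ∨ e' = -(Complex.I * e))
    (x y : V) : ‖e' • x + conj e' • y‖ = ‖e • x - conj e • y‖ := by
  rcases he' with rfl | rfl
  · have : (Complex.I * e) • x + conj (Complex.I * e) • y =
        Complex.I • (e • x - conj e • y) := by
      rw [map_mul, Complex.conj_I]
      module
    rw [this, norm_smul, Complex.norm_I, one_mul]
  · have : (-(Complex.I * e)) • x + conj (-(Complex.I * e)) • y =
        (-Complex.I) • (e • x - conj e • y) := by
      rw [map_neg, map_mul, Complex.conj_I]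
      module
    rw [this, norm_smul, norm_neg, Complex.norm_I, one_mul]

lemma bounds_of_robertson {a b S S' : ℝ} (ha : 0 ≤ a) (hb : 0 ≤ b) (hSS0 : 0 ≤ S * S')
    (hSS : S + S' = 2 * (1 + (a + b))) (r1 : 1 + (b - a) ≤ √(S * S'))
    (r2 : 1 + (a - b) ≤ √(S * S')) : (S + S') / 2 = 1 + (a + b) ∧
    √(S * S') ≥ 1 + |a - b| ∧ S * S' ≥ 1 ∧ (S + S') / 2 ≥ 1 := by
  have r3 : 1 + |a - b| ≤ √(S * S') := by
    rcases abs_cases (a - b) with h | h <;> linarith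
  refine ⟨by linarith, r3, ?_, by linarith⟩
  have h1 : 1 ≤ √(S * S') := le_trans (by linarith [abs_nonneg (a - b)]) r3
  have h2 := Real.mul_self_sqrt hSS0
  nlinarith

/-- The relations between the spectra of two complementary quadratures, in terms of the vectors
`A± = a(±μ) Ξ`, `C± = a†(±μ) Ξ`. -/
lemma complementary_relations (hΞ : ‖Ξ‖ = 1) (hp : ⟪Ξ, Cp⟫_ℂ = conj ⟪Ξ, Ap⟫_ℂ)
    (hm : ⟪Ξ, Cm⟫_ℂ = conj ⟪Ξ, Am⟫_ℂ) (hp2 : ‖Cp‖ ^ 2 = ‖Ap‖ ^ 2 + 1)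
    (hm2 : ‖Cm‖ ^ 2 = ‖Am‖ ^ 2 + 1) {e e' : ℂ} (he : ‖e‖ = 1)
    (he' : e' = Complex.I * e ∨ e' = -(Complex.I * e)) {E E' S S' : ℝ}
    (hE : E = ‖⟪Ξ, e • Ap + conj e • Cm⟫_ℂ‖ ^ 2)
    (hS : S = ‖e • Ap + conj e • Cm‖ ^ 2 - ‖⟪Ξ, e • Ap + conj e • Cm⟫_ℂ‖ ^ 2)
    (hS2 : S = ‖e • Am + conj e • Cp‖ ^ 2 - ‖⟪Ξ, e • Am + conj e • Cp⟫_ℂ‖ ^ 2)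
    (hE' : E' = ‖⟪Ξ, e' • Ap + conj e' • Cm⟫_ℂ‖ ^ 2)
    (hS' : S' = ‖e' • Ap + conj e' • Cm‖ ^ 2 - ‖⟪Ξ, e' • Ap + conj e' • Cm⟫_ℂ‖ ^ 2)
    (hS2' : S' = ‖e' • Am + conj e' • Cp‖ ^ 2 - ‖⟪Ξ, e' • Am + conj e' • Cp⟫_ℂ‖ ^ 2) :
    (E + E') / 2 = ‖⟪Ξ, Ap⟫_ℂ‖ ^ 2 + ‖⟪Ξ, Am⟫_ℂ‖ ^ 2 ∧
    (S + S') / 2 = 1 + (‖Ap - ⟪Ξ, Ap⟫_ℂ • Ξ‖ ^ 2 + ‖Am - ⟪Ξ, Am⟫_ℂ • Ξ‖ ^ 2) ∧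
    √(S * S') ≥ 1 + |‖Ap - ⟪Ξ, Ap⟫_ℂ • Ξ‖ ^ 2 - ‖Am - ⟪Ξ, Am⟫_ℂ • Ξ‖ ^ 2| ∧
    S * S' ≥ 1 ∧ (S + S') / 2 ≥ 1 := by
  -- π is the projection onto the orthogonal complement of Ξ. It centres each mode and turns second
  -- moments into variances.
  obtain ⟨π, hπ⟩ : ∃ π : V → V, ∀ x, π x = x - ⟪Ξ, x⟫_ℂ • Ξ := ⟨_, fun _ => rfl⟩
  have hπn : ∀ x, ‖π x‖ ^ 2 = ‖x‖ ^ 2 - ‖⟪Ξ, x⟫_ℂ‖ ^ 2 := fun x => by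
    rw [hπ, norm_sub_inner_smul_sq hΞ x]
  have hπl : ∀ (z w : ℂ) (x y : V), π (z • x + w • y) = z • π x + w • π y := by
    intro z w x y
    simp only [hπ, inner_add_right, inner_smul_right]
    module
  rw [← hπ, ← hπ]
  have hn1 : ∀ x : V, ‖e • x‖ = ‖x‖ := fun x => by rw [norm_smul, he, one_mul]
  have hn2 : ∀ x : V, ‖conj e • x‖ = ‖x‖ := fun x => by rw [norm_smul, RCLike.norm_conj, he, one_mul]
  have hEE : E + E' = 2 * (‖⟪Ξ, Ap⟫_ℂ‖ ^ 2 + ‖⟪Ξ, Am⟫_ℂ‖ ^ 2) := by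
    have h1 := norm_add_of_phase_shift he' ⟪Ξ, Ap⟫_ℂ ⟪Ξ, Cm⟫_ℂ
    simp only [smul_eq_mul] at h1
    rw [hE, hE', inner_add_right, inner_smul_right, inner_smul_right, inner_add_right,
      inner_smul_right, inner_smul_right, h1, norm_add_sq_add_norm_sub_sq, norm_mul, norm_mul, RCLike.norm_conj, he, hm, RCLike.norm_conj]
    ring
  set a := ‖π Ap‖ ^ 2 with ha
  set b := ‖π Am‖ ^ 2 with hb
  have hcp : ‖π Cp‖ ^ 2 = a + 1 := by
    rw [ha, hπn, hπn, hp2, hp, RCLike.norm_conj]; ring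
  have hcm : ‖π Cm‖ ^ 2 = b + 1 := by
    rw [hb, hπn, hπn, hm2, hm, RCLike.norm_conj]; ring
  have s1 : S = ‖e • π Ap + conj e • π Cm‖ ^ 2 := by rw [hS, ← hπn, hπl]
  have s2 : S = ‖e • π Am + conj e • π Cp‖ ^ 2 := by rw [hS2, ← hπn, hπl]
  have s1' : S' = ‖e • π Ap - conj e • π Cm‖ ^ 2 := by rw [hS', ← hπn, hπl, norm_add_of_phase_shift he']
  have s2' : S' = ‖e • π Am - conj e • π Cp‖ ^ 2 := by rw [hS2', ← hπn, hπl, norm_add_of_phase_shift he']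
  have hSS : S + S' = 2 * (1 + (a + b)) := by
    rw [s1, s1', norm_add_sq_add_norm_sub_sq, hn1, hn2, hcm]
    ring
  -- The expression through A₊ and C₋ compares ‖πC₋‖² = b + 1 with ‖πA₊‖² = a. The expression
  -- through A₋ and C₊ exchanges a and b, and together they give the absolute value.
  have r1 : 1 + (b - a) ≤ √(S * S') := by
    have h1 := norm_sq_sub_le_sqrt (conj e • π Cm) (e • π Ap)
    rw [add_comm, norm_sub_rev, ← s1, ← s1', hn1, hn2, hcm, ← ha] at h1
    linarith only [h1]
  have r2 : 1 + (a - b) ≤ √(S * S') := by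
    have h1 := norm_sq_sub_le_sqrt (conj e • π Cp) (e • π Am)
    rw [add_comm, norm_sub_rev, ← s2, ← s2', hn1, hn2, hcp, ← hb] at h1
    linarith only [h1]
  have hSS0 : 0 ≤ S * S' := by
    rw [s1, s1']
    exact mul_nonneg (sq_nonneg _) (sq_nonneg _)
  exact ⟨by rw [hEE]; exact mul_div_cancel_left₀ _ two_ne_zero,
    bounds_of_robertson (sq_nonneg _) (sq_nonneg _) hSS0 hSS r1 r2⟩

end Complementary

/-! ### The output of a Hudson–Parthasarathy evolution -/

section Output

lemma opApply_centred {E : Type*} [NormedAddCommGroup E] [InnerProductSpace ℂ E] [CompleteSpace E]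
    (ϱ : E →L[ℂ] E) (X : E →ₗ.[ℂ] E) {ψ : E} (hψ : ψ ∈ X.domain) :
    opApply (centred ϱ X) ψ = opApply X ψ - mean ϱ X • ψ := by
  have h1 : ψ ∈ (centred ϱ X).domain := hψ
  rw [opApply, opApply, dif_pos h1, dif_pos hψ]
  rfl

section Mean

variable {d : ℕ}

lemma mean_annihilation {ϱ : Fock d →L[ℂ] Fock d} {q : OneParticle d}
    {Ξ A : lp (fun _ : basisIndex (Fock d) => Fock d) 2}
    (hΞ : ∀ i, Ξ i = CFC.sqrt ϱ (basis (Fock d) i)) (hA : ∀ i, IsAnn q (Ξ i) (A i)) :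
    mean ϱ (annihilation q) = ⟪Ξ, A⟫_ℂ := by
  rw [mean, ← (lp.hasSum_inner (𝕜 := ℂ) Ξ A).tsum_eq]
  refine tsum_congr fun i => ?_
  rw [← hΞ, (hA i).opApply_annihilation]

lemma meanAbsSq_centred_annihilation {ϱ : Fock d →L[ℂ] Fock d} {q : OneParticle d}
    {Ξ A : lp (fun _ : basisIndex (Fock d) => Fock d) 2}
    (hΞ : ∀ i, Ξ i = CFC.sqrt ϱ (basis (Fock d) i)) (hA : ∀ i, IsAnn q (Ξ i) (A i)) :
    meanAbsSq ϱ (centred ϱ (annihilation q)) = ‖A - ⟪Ξ, A⟫_ℂ • Ξ‖ ^ 2 := by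
  rw [meanAbsSq, ← (hasSum_lp_norm_sq (A - ⟪Ξ, A⟫_ℂ • Ξ)).tsum_eq]
  refine tsum_congr fun i => ?_
  rw [← hΞ, opApply_centred ϱ _ (hA i).annihilation_apply.1, (hA i).opApply_annihilation,
    mean_annihilation hΞ hA]
  rfl

end Mean

variable {H : Type*} [NormedAddCommGroup H] [InnerProductSpace ℂ H] [CompleteSpace H] {d : ℕ}
  [NeZero d] {h : ℝ → ℂ} {T μ : ℝ}

/-- The output state is a mixture on which the modes act with finite second moments. -/
lemma IsHPEvolution.exists_modeData {H₀ : H →L[ℂ] H} {R : Fin d → H →L[ℂ] H}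
    {U : ℝ → SysFock H d →L[ℂ] SysFock H d} (hU : IsHPEvolution H₀ R U) (hT : 0 < T)
    {ρ : H →L[ℂ] H} (hρ : IsState ρ) (f : OneParticle d) (h : ℝ → ℂ) (μ : ℝ)
    {ϱ : Fock d →L[ℂ] Fock d} (hϱ : ϱ = reducedFieldState ρ f (U T)) :
    ∃ (Ξ Ap Am Cp Cm : lp (fun _ : basisIndex (Fock d) => Fock d) 2)
      (a c : basisIndex (Fock d) → OneParticle d → Fock d) (C : ℝ),
      ModeData h T μ Ξ Ap Am Cp Cm a c C ∧ (∀ i, Ξ i = CFC.sqrt ϱ (basis (Fock d) i)) ∧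
      FiniteSecondMoment ϱ (mode d h T μ) ∧ FiniteSecondMoment ϱ (mode d h T (-μ)) := by
  have hV : ∀ Ψ, ‖U T Ψ‖ = ‖Ψ‖ := fun Ψ => hU.norm_apply hT.le Ψ
  have hone := tsum_sqrt_reducedFieldState hρ f hV
  obtain ⟨C, hC, hD⟩ := hU.exists_isAnn_reducedFieldState hT.le hρ f
  rw [← hϱ] at hone hD
  choose D hDann hDsum using hD
  have hfin : ∀ q, ∑' i, ‖D q (basis (Fock d) i)‖ₑ ^ 2 ≠ ⊤ := fun q =>
    ne_top_of_le_ne_top ENNReal.ofReal_ne_top (hDsum q)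
  have hle : ∀ i q, ‖D q (basis (Fock d) i)‖ ≤ C * ‖q‖ := by
    intro i q
    have h1 := (ENNReal.le_tsum (f := fun i => ‖D q (basis (Fock d) i)‖ₑ ^ 2) i).trans (hDsum q)
    rw [enorm_sq_eq_ofReal, ENNReal.ofReal_le_ofReal_iff (by positivity)] at h1
    exact (sq_le_sq₀ (norm_nonneg _) (by positivity)).1 h1
  -- Every term of a Hilbert–Schmidt sum is bounded by the whole sum, so one constant C serves all
  -- basis indices i.
  choose c hc using fun i => exists_isFieldPair (fun q => hDann q (basis (Fock d) i)) (hle i)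
  obtain ⟨Ξ, hΞ⟩ := exists_lp (x := fun i => CFC.sqrt ϱ (basis (Fock d) i))
    (by rw [hone]; exact ENNReal.one_ne_top)
  have hΞ1 : ‖Ξ‖ = 1 := by
    have h1 := tsum_lp_enorm_sq Ξ
    simp_rw [hΞ, hone] at h1
    rw [enorm_sq_eq_ofReal, ← ENNReal.ofReal_one,
      ENNReal.ofReal_eq_ofReal_iff zero_le_one (by positivity)] at h1
    exact (pow_eq_one_iff_of_nonneg (norm_nonneg _) two_ne_zero).1 h1.symm
  have hA : ∀ q, ∃ A : lp (fun _ : basisIndex (Fock d) => Fock d) 2,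
      ∀ i, A i = D q (basis (Fock d) i) := fun q => exists_lp (hfin q)
  have hB : ∀ q, ∃ B : lp (fun _ : basisIndex (Fock d) => Fock d) 2, ∀ i, B i = c i q := by
    intro q
    obtain ⟨A, hA⟩ := hA q
    have h1 := (hasSum_lp_norm_sq A).add ((hasSum_lp_norm_sq Ξ).mul_left (‖q‖ ^ 2))
    have h2 : ∀ i, ‖A i‖ ^ 2 + ‖q‖ ^ 2 * ‖Ξ i‖ ^ 2 = ‖c i q‖ ^ 2 := fun i => by
      rw [hA, hΞ, (hc i).norm_cre_sq]
    rw [funext h2] at h1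
    refine exists_lp ?_
    rw [tsum_enorm_sq_eq h1]
    exact ENNReal.ofReal_ne_top
  have hmom : ∀ q, FiniteSecondMoment ϱ (annihilation q) := by
    intro q
    obtain ⟨A, hA⟩ := hA q
    refine ⟨fun ψ => (hDann q ψ).annihilation_apply.1, ?_⟩
    simp_rw [fun i => (hDann q (basis (Fock d) i)).opApply_annihilation, ← hA]
    exact (hasSum_lp_norm_sq A).summable
  obtain ⟨Ap, hAp⟩ := hA (modeVec d h T μ)
  obtain ⟨Am, hAm⟩ := hA (modeVec d h T (-μ))
  obtain ⟨Cp, hCp⟩ := hB (modeVec d h T μ)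
  obtain ⟨Cm, hCm⟩ := hB (modeVec d h T (-μ))
  refine ⟨Ξ, Ap, Am, Cp, Cm, fun i q => D q (basis (Fock d) i), c, C,
    ⟨hΞ1, fun i => ?_, hAp, hAm, hCp, hCm⟩, hΞ, hmom _, hmom _⟩
  rw [hΞ]
  exact hc i

lemma exp_phase_shift {ϑ ϑ' : ℝ} (hϑ : ϑ' = ϑ + Real.pi / 2 ∨ ϑ' = ϑ - Real.pi / 2) :
    Complex.exp (Complex.I * ϑ') = Complex.I * Complex.exp (Complex.I * ϑ) ∨
      Complex.exp (Complex.I * ϑ') = -(Complex.I * Complex.exp (Complex.I * ϑ)) := by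
  rcases hϑ with rfl | rfl
  · left
    have h1 : Complex.I * ((ϑ + Real.pi / 2 : ℝ) : ℂ) =
        Real.pi / 2 * Complex.I + Complex.I * ϑ := by
      push_cast; ring
    rw [h1, Complex.exp_add, Complex.exp_pi_div_two_mul_I]
  · right
    have h1 : Complex.I * ((ϑ - Real.pi / 2 : ℝ) : ℂ) =
        -Real.pi / 2 * Complex.I + Complex.I * ϑ := by
      push_cast; ring
    rw [h1, Complex.exp_add, Complex.exp_neg_pi_div_two_mul_I, neg_mul]

/-- The relations between the spectra of two complementary quadratures of the output. -/
lemma IsHPEvolution.spectra {H₀ : H →L[ℂ] H} {R : Fin d → H →L[ℂ] H}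
    {U : ℝ → SysFock H d →L[ℂ] SysFock H d} (hU : IsHPEvolution H₀ R U) (hT : 0 < T)
    {ρ : H →L[ℂ] H} (hρ : IsState ρ) (f : OneParticle d) (hh : Measurable h)
    (hh1 : ∀ t ∈ Set.Icc 0 T, ‖h t‖ = 1) (μ : ℝ) {ϑ ϑ' : ℝ}
    (hϑ : ϑ' = ϑ + Real.pi / 2 ∨ ϑ' = ϑ - Real.pi / 2)
    {ϱ : Fock d →L[ℂ] Fock d} (hϱ : ϱ = reducedFieldState ρ f (U T))
    {D : Diagonalisation d ϑ h T} {P : Measure D.Ω} (hP : D.IsPhysicalProbability ϱ P)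
    {D' : Diagonalisation d ϑ' h T} {P' : Measure D'.Ω} (hP' : D'.IsPhysicalProbability ϱ P') :
    (FiniteSecondMoment ϱ (mode d h T μ) ∧ FiniteSecondMoment ϱ (mode d h T (-μ)) ∧
      HasSecondMoments P D.W T μ ∧ HasSecondMoments P' D'.W T μ) ∧
    (elasticSpectrum P D.W T μ + elasticSpectrum P' D'.W T μ) / 2 =
      ‖mean ϱ (mode d h T μ)‖ ^ 2 + ‖mean ϱ (mode d h T (-μ))‖ ^ 2 ∧
    (inelasticSpectrum P D.W T μ + inelasticSpectrum P' D'.W T μ) / 2 =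
      1 + (meanAbsSq ϱ (centred ϱ (mode d h T μ)) + meanAbsSq ϱ (centred ϱ (mode d h T (-μ)))) ∧
    √(inelasticSpectrum P D.W T μ * inelasticSpectrum P' D'.W T μ) ≥
      1 + |meanAbsSq ϱ (centred ϱ (mode d h T μ)) -
        meanAbsSq ϱ (centred ϱ (mode d h T (-μ)))| ∧
    inelasticSpectrum P D.W T μ * inelasticSpectrum P' D'.W T μ ≥ 1 ∧
    (inelasticSpectrum P D.W T μ + inelasticSpectrum P' D'.W T μ) / 2 ≥ 1 := by
  have hV : ∀ Ψ, ‖U T Ψ‖ = ‖Ψ‖ := fun Ψ => hU.norm_apply hT.le Ψ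
  have hpos : ϱ.IsPositive := hϱ ▸ isPositive_reducedFieldState hρ f hV
  have hone : ∑' i, ‖CFC.sqrt ϱ (basis (Fock d) i)‖ₑ ^ 2 = 1 :=
    hϱ ▸ tsum_sqrt_reducedFieldState hρ f hV
  have hne : ∑' i, ‖CFC.sqrt ϱ (basis (Fock d) i)‖ₑ ^ 2 ≠ ⊤ := by
    rw [hone]; exact ENNReal.one_ne_top
  obtain ⟨Ξ, Ap, Am, Cp, Cm, a, c, C, hM, hΞ, hm1, hm2⟩ := hU.exists_modeData hT hρ f h μ hϱ
  have hsum := hP.eq_sum (adjoint_sqrt ϱ) (sqrt_comp_sqrt hpos) hne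
  have hsum' := hP'.eq_sum (adjoint_sqrt ϱ) (sqrt_comp_sqrt hpos) hne
  simp_rw [← hΞ] at hsum hsum'
  obtain ⟨k1, k2, k3, k4⟩ := hM.spectra hT hh hh1 hsum rfl
  obtain ⟨k1', k2', k3', k4'⟩ := hM.spectra hT hh hh1 hsum' rfl
  have hap : ∀ i, IsAnn (modeVec d h T μ) (Ξ i) (Ap i) := fun i => by
    rw [hM.ap]; exact (hM.pair i).ann _
  have ham : ∀ i, IsAnn (modeVec d h T (-μ)) (Ξ i) (Am i) := fun i => by
    rw [hM.am]; exact (hM.pair i).ann _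
  refine ⟨⟨hm1, hm2, k1, k1'⟩, ?_⟩
  rw [mode_eq, mode_eq, mean_annihilation hΞ hap, mean_annihilation hΞ ham,
    meanAbsSq_centred_annihilation hΞ hap, meanAbsSq_centred_annihilation hΞ ham]
  have he : ‖Complex.exp (Complex.I * ϑ)‖ = 1 := by rw [Complex.norm_exp]; simp
  exact complementary_relations hM.norm_eq (inner_cre_eq_conj _ hM.pair hM.ap hM.cp)
    (inner_cre_eq_conj _ hM.pair hM.am hM.cm)
    (norm_cre_sq_eq (norm_modeVec hT hh hh1 μ) hM.norm_eq hM.pair hM.ap hM.cp)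
    (norm_cre_sq_eq (norm_modeVec hT hh hh1 (-μ)) hM.norm_eq hM.pair hM.am hM.cm)
    he (exp_phase_shift hϑ) k2 k3 k4 k2' k3' k4'

end Output

end QuantumOutput

end

/-! ### The theorem. -/

open QuantumOutput in
theorem theorem1 {H : Type*} [NormedAddCommGroup H] [InnerProductSpace ℂ H] [CompleteSpace H]
    {d : ℕ} [NeZero d]
    -- a Hudson-Parthasarathy evolution and an initial state of the system
    (H₀ : H →L[ℂ] H) (hH₀ : IsSelfAdjoint H₀) (R : Fin d → H →L[ℂ] H)
    (U : ℝ → SysFock H d →L[ℂ] SysFock H d) (hU : IsHPEvolution H₀ R U)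
    (ρ : H →L[ℂ] H) (hρ : IsState ρ)
    -- the frequency and two complementary phases
    (μ ϑ ϑ' : ℝ) (hϑ : ϑ' = ϑ + Real.pi / 2 ∨ ϑ' = ϑ - Real.pi / 2) :
    -- the relations and bounds at a finite time `T`
    (∀ T : ℝ, 0 < T →
      ∀ h : ℝ → ℂ, Measurable h → (∀ t ∈ Set.Icc 0 T, ‖h t‖ = 1) →
      ∀ f : OneParticle d,
      ∀ (D : Diagonalisation d ϑ h T) (P : Measure D.Ω),
        D.IsPhysicalProbability (reducedFieldState ρ f (U T)) P →
      ∀ (D' : Diagonalisation d ϑ' h T) (P' : Measure D'.Ω),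
        D'.IsPhysicalProbability (reducedFieldState ρ f (U T)) P' →
      -- all the second moments involved are finite
      (FiniteSecondMoment (reducedFieldState ρ f (U T)) (mode d h T μ) ∧
        FiniteSecondMoment (reducedFieldState ρ f (U T)) (mode d h T (-μ)) ∧
        HasSecondMoments P D.W T μ ∧ HasSecondMoments P' D'.W T μ) ∧
      -- the mean of the elastic spectra
      (elasticSpectrum P D.W T μ + elasticSpectrum P' D'.W T μ) / 2 =
        ‖mean (reducedFieldState ρ f (U T)) (mode d h T μ)‖ ^ 2 +
        ‖mean (reducedFieldState ρ f (U T)) (mode d h T (-μ))‖ ^ 2 ∧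
      -- the mean of the inelastic spectra
      (inelasticSpectrum P D.W T μ + inelasticSpectrum P' D'.W T μ) / 2 =
        1 + (meanAbsSq (reducedFieldState ρ f (U T))
              (centred (reducedFieldState ρ f (U T)) (mode d h T μ)) +
            meanAbsSq (reducedFieldState ρ f (U T))
              (centred (reducedFieldState ρ f (U T)) (mode d h T (-μ)))) ∧
      -- the Robertson-type bound
      √(inelasticSpectrum P D.W T μ * inelasticSpectrum P' D'.W T μ) ≥
        1 + |meanAbsSq (reducedFieldState ρ f (U T))
              (centred (reducedFieldState ρ f (U T)) (mode d h T μ)) -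
            meanAbsSq (reducedFieldState ρ f (U T))
              (centred (reducedFieldState ρ f (U T)) (mode d h T (-μ)))| ∧
      -- the Heisenberg-type bound and the bound on the arithmetic mean
      inelasticSpectrum P D.W T μ * inelasticSpectrum P' D'.W T μ ≥ 1 ∧
      (inelasticSpectrum P D.W T μ + inelasticSpectrum P' D'.W T μ) / 2 ≥ 1) ∧
    -- the heterodyne bound: a common limit of the two inelastic spectra for `T → ∞` is at least one
    (∀ h : ℝ → ℝ → ℂ, (∀ T, 0 < T → Measurable (h T)) →
      (∀ T, 0 < T → ∀ t ∈ Set.Icc 0 T, ‖h T t‖ = 1) →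
      ∀ f : ℝ → OneParticle d,
      ∀ (D : ∀ T, Diagonalisation d ϑ (h T) T) (P : ∀ T, Measure (D T).Ω),
        (∀ T, 0 < T → (D T).IsPhysicalProbability (reducedFieldState ρ (f T) (U T)) (P T)) →
      ∀ (D' : ∀ T, Diagonalisation d ϑ' (h T) T) (P' : ∀ T, Measure (D' T).Ω),
        (∀ T, 0 < T → (D' T).IsPhysicalProbability (reducedFieldState ρ (f T) (U T)) (P' T)) →
      ∀ S : ℝ,
        Filter.Tendsto (fun T => inelasticSpectrum (P T) (D T).W T μ) Filter.atTop (nhds S) →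
        Filter.Tendsto (fun T => inelasticSpectrum (P' T) (D' T).W T μ) Filter.atTop (nhds S) →
        1 ≤ S) := by
  refine ⟨fun T hT h hh hh1 f D P hP D' P' hP' =>
    hU.spectra hT hρ f hh hh1 μ hϑ rfl hP hP', fun h hh hh1 f D P hP D' P' hP' S hS hS' => ?_⟩
  -- The arithmetic mean tends to the common limit S and is at least 1 for every T > 0. The
  -- diagonalisations, f and h may vary with T, since the finite-time bound is uniform in them.
  have h1 : Filter.Tendsto (fun T => (inelasticSpectrum (P T) (D T).W T μ +
      inelasticSpectrum (P' T) (D' T).W T μ) / 2) Filter.atTop (nhds ((S + S) / 2)) :=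
    (hS.add hS').div_const 2
  rw [add_self_div_two] at h1
  refine ge_of_tendsto h1 ?_
  filter_upwards [Filter.eventually_gt_atTop 0] with T hT
  exact (hU.spectra hT hρ (f T) (hh T hT) (hh1 T hT) μ hϑ rfl (hP T hT)
    (hP' T hT)).2.2.2.2.2
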